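/- Let $N\in\mathbb N$, let $m_1,\dots,m_N$ and $\mu_1,\dots,\mu_{2N}$ be nonzero real numbers, and write $\langle t\rangle=\sqrt{1+t^2}$, $L_m=i\partial_t+\frac1{2m}\Delta$, $J_{m,a}(t)=x_a+\frac{it}{m}\partial_{x_a}$ ($a=1,2$) and $J_m(t)^\beta=J_{m,1}(t)^{\beta_1}J_{m,2}(t)^{\beta_2}$ on $\mathbb R^2$. For $v=(v_1,\dots,v_N)$ put $v^\sharp=(v_1,\dots,v_N,\overline{v_1},\dots,\overline{v_N})$. Then there exist constants $\omega_0>0$ and $C_0>0$, depending only on $N$, $(m_j)$ and $(\mu_k)$, such that the following holds for all $T>0$ and $t_0\in[0,T)$. Let $g_{jk,a}(t,x)$ ($1\le j\le N$, $1\le k\le 2N$, $a=1,2$) be complex-valued coefficients with $g_{jk,a}(t,\cdot)\in L^\infty(\mathbb R^2)$, measurable in time (in the sense that $t\mapsto\int g_{jk,a}(t,x)\varphi(x)\,dx$ is measurable on $[t_0,T)$ for all Schwartz functions $\varphi$), and suppose that $$\Omega:=\sup_{t\in[t_0,T)}\ \sum_{|\beta|\le2}\sum_{j=1}^N\sum_{k=1}^{2N}\sum_{a=1}^2\langle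 t\rangle^{1-|\beta|}\,\bigl\|J_{\mu_k}(t)^\beta g_{jk,a}(t,\cdot)\bigr\|_{W^{2-|\beta|,\infty}(\mathbb R^2)}\le\omega_0 .$$ Here $\|f\|_{W^{n,\infty}}=\sum_{|\alpha|\le n}\|\partial^\alpha f\|_{L^\infty}$, with derivatives in the sense of distributions. Let $G=(G_j)\in L^1_{\mathrm{loc}}([t_0,T);L^2(\mathbb R^2;\mathbb C^N))$ and let $v=(v_j)\in C([t_0,T);L^2(\mathbb R^2;\mathbb C^N))$ be a weak solution of $$L_{m_j}v_j=\sum_{k=1}^{2N}\sum_{a=1}^2 g_{jk,a}\,\partial_{x_a}v_k^\sharp+G_j\quad\text{in }(t_0,T)\times\mathbb R^2,\qquad j=1,\dots,N,$$ meaning that for every $j$, every Schwartz function $\varphi$ on $\mathbb R^2$ and every $t\in[t_0,T)$ the equation holds after pairing with $\varphi$ in $x$ and integrating in time over $[t_0,t]$, where $g\,\partial_{x_a}w$ is the distribution $\partial_{x_a}(gw)-(\partial_{x_a}g)w$. Then for all $t\in[t_0,T)$ $$\|v(t)\|_{L^2}\le C_0\|v(t_0)\|_{L^2}+C_0\int_{t_0}^t\Bigl(\frac{\Omega}{\langle\tau\rangle}\|v(\tau)\|_{L^2}+\|G(\tau)\|_{L^2}\Bigr)d\tau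 .$$ -/

import Mathlib

open MeasureTheory Set
open scoped ENNReal SchwartzMap LineDeriv Laplacian

noncomputable section

namespace NLSEnergy

/-- The space `ℝ²`. -/
abbrev Plane : Type := EuclideanSpace ℝ (Fin 2)

/-- The standard basis vector `e_a` of `ℝ²`. -/
def stdVec (a : Fin 2) : Plane := EuclideanSpace.single a 1

/-- The Japanese bracket `⟨t⟩ = √(1 + t²)` of a real number. -/
def bracket (t : ℝ) : ℝ := Real.sqrt (1 + t ^ 2)

/-- The multi-indices `α = (α₁, α₂)` with `|α| = α₁ + α₂ ≤ n`. -/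
def multiIndices (n : ℕ) : Finset (ℕ × ℕ) :=
  (Finset.range (n + 1) ×ˢ Finset.range (n + 1)).filter fun α => α.1 + α.2 ≤ n

/-- The partial derivative `∂^α = ∂_1^{α₁} ∂_2^{α₂}` of a tempered distribution. -/
def partialPow (α : ℕ × ℕ) (f : 𝓢'(Plane, ℂ)) : 𝓢'(Plane, ℂ) :=
  (fun h => ∂_{stdVec 0} h)^[α.1] ((fun h => ∂_{stdVec 1} h)^[α.2] f)

/-- The operator `J_{m,a}(t) = x_a + (i t / m) ∂_a`, acting on tempered distributions. -/
def opJ (m t : ℝ) (a : Fin 2) (f : 𝓢'(Plane, ℂ)) : 𝓢'(Plane, ℂ) :=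
  TemperedDistribution.smulLeftCLM ℂ (fun x : Plane => ((x a : ℝ) : ℂ)) f
    + (Complex.I * (t : ℂ) / (m : ℂ)) • ∂_{stdVec a} f

/-- `J_m(t)^β = J_{m,1}(t)^{β₁} J_{m,2}(t)^{β₂}`. -/
def opJPow (m t : ℝ) (β : ℕ × ℕ) (f : 𝓢'(Plane, ℂ)) : 𝓢'(Plane, ℂ) :=
  (opJ m t 0)^[β.1] ((opJ m t 1)^[β.2] f)

/-- The multiplier `x ↦ x_a` has temperate growth, so that multiplication by it in `opJ` is the
genuine multiplication operator. -/
theorem hasTemperateGrowth_coord (a : Fin 2) :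
    (fun x : Plane => ((x a : ℝ) : ℂ)).HasTemperateGrowth :=
  (Complex.ofRealCLM.comp (EuclideanSpace.proj a : Plane →L[ℝ] ℝ)).hasTemperateGrowth

/-- The `L^∞` norm of a tempered distribution; it is `∞` unless the distribution is (given by) an
`L^∞` function. -/
def linftyNorm (f : 𝓢'(Plane, ℂ)) : ℝ≥0∞ :=
  ⨅ (h : Lp ℂ ∞ (volume : Measure Plane)) (_ : Lp.toTemperedDistribution h = f), ‖h‖ₑ

/-- The norm of `W^{n,∞}(ℝ²)`, the sum of the `L^∞` norms of the distributional derivatives of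
order at most `n`; it is `∞` off `W^{n,∞}`. -/
def sobolevNorm (n : ℕ) (f : 𝓢'(Plane, ℂ)) : ℝ≥0∞ :=
  ∑ α ∈ multiIndices n, linftyNorm (partialPow α f)

/-- Coefficients `g_{jk,a}(t,·) ∈ L^∞(ℝ²)`. The index set `{1,…,2N}` of `k` is written as
`Fin N ⊕ Fin N`. -/
abbrev Coeff (N : ℕ) : Type :=
  ℝ → Fin N → Fin N ⊕ Fin N → Fin 2 → Lp ℂ ∞ (volume : Measure Plane)

/-- `L²(ℝ²; ℂ^N)`, with norm `‖v‖² = ∑_j ‖v_j‖²`. -/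
abbrev L2 (N : ℕ) : Type := Lp (EuclideanSpace ℂ (Fin N)) 2 (volume : Measure Plane)

/-- The quantity `Ω_{t₁,t₂}`. -/
def bigOmega {N : ℕ} (μ : Fin N ⊕ Fin N → ℝ) (g : Coeff N) (t₁ t₂ : ℝ) : ℝ≥0∞ :=
  ⨆ t ∈ Ico t₁ t₂, ∑ β ∈ multiIndices 2, ∑ j, ∑ k, ∑ a,
    ENNReal.ofReal (bracket t ^ (1 - ((β.1 + β.2 : ℕ) : ℤ))) *
      sobolevNorm (2 - (β.1 + β.2))
        (opJPow (μ k) t β (Lp.toTemperedDistribution (g t j k a)))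

/-- `z^♯ = (z_1,…,z_N, conj z_1,…,conj z_N)`. -/
def sharp {N : ℕ} (z : EuclideanSpace ℂ (Fin N)) : Fin N ⊕ Fin N → ℂ :=
  Sum.elim (fun j => z j) fun j => starRingEnd ℂ (z j)

open Classical in
/-- The weak derivative `∂_a g` in `L^∞` of a function `g ∈ L^∞` (zero if the distribution `∂_a g`
is not an `L^∞` function). -/
def weakPartial (a : Fin 2) (g : Lp ℂ ∞ (volume : Measure Plane)) :
    Lp ℂ ∞ (volume : Measure Plane) :=
  if h : ∃ d : Lp ℂ ∞ (volume : Measure Plane),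
      Lp.toTemperedDistribution d = ∂_{stdVec a} (Lp.toTemperedDistribution g)
  then h.choose else 0

/-- The pairing of the distribution `g ∂_a w = ∂_a (g w) - (∂_a g) w` with a test function `φ`,
for `g ∈ W^{1,∞}` and `w ∈ L²`. -/
def coeffPairing (a : Fin 2) (g : Lp ℂ ∞ (volume : Measure Plane)) (w : Plane → ℂ)
    (φ : 𝓢(Plane, ℂ)) : ℂ :=
  -∫ x, (g x * w x * (∂_{stdVec a} φ) x + weakPartial a g x * w x * φ x)

/-- `v ∈ C([t₀,T); L²)` is a weak solution on `(t₀,T) × ℝ²` of the system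
`i ∂_t v_j + (1/(2 m_j)) Δ v_j = ∑_k ∑_a g_{jk,a} ∂_a v^♯_k + G_j`,
where `G ∈ L¹_loc([t₀,T); L²)` and `g` depends measurably on time. The equation is tested
against functions `φ` of `x`, and integrated in time. -/
structure IsSolution {N : ℕ} (m : Fin N → ℝ) (g : Coeff N) (G v : ℝ → L2 N) (t₀ T : ℝ) :
    Prop where
  coeff_measurable : ∀ j k a, ∀ φ : 𝓢(Plane, ℂ),
    AEStronglyMeasurable (fun t => ∫ x, g t j k a x * φ x) (volume.restrict (Ico t₀ T))
  source_integrable : ∀ t ∈ Ico t₀ T, IntervalIntegrable G volume t₀ t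
  continuousOn : ContinuousOn v (Ico t₀ T)
  equation : ∀ j, ∀ φ : 𝓢(Plane, ℂ), ∀ t ∈ Ico t₀ T,
    Complex.I * ((∫ x, v t x j * φ x) - ∫ x, v t₀ x j * φ x)
        + (1 / (2 * (m j : ℂ))) * ∫ τ in t₀..t, ∫ x, v τ x j * (Δ φ) x
      = ∫ τ in t₀..t, ((∑ k, ∑ a, coeffPairing a (g τ j k a) (fun x => sharp (v τ x) k) φ)
          + ∫ x, G τ x j * φ x)

end NLSEnergy

end

/-!
The estimate is an energy estimate for the functional `∑_j ⟨B_j v_j, v_j⟩`, where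
`B_j = 1 - κ sign(m_j) ∑_a A_a` and `A_a = ½ (θ_a sgn D_a + sgn D_a θ_a)` is an escape operator with
weight `θ_a = arctan (x_a / ⟨t⟩)`. These operators are bounded and self-adjoint, and for small `κ` the
functional is equivalent to `‖v‖²`.

Write `s = ⟨t⟩` and `k = 1 / (s - i x_a)`, so that `∂_a θ_a = s |k|²`. The commutator of `A_a` with the
Laplacian produces, with a favourable sign for either sign of the mass, the local smoothing
functional `s ⟨|D_a| k u, k u⟩ + s⁻¹ ‖u‖²`, called `smoothing`, up to an error `s⁻¹ ‖u‖²`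
(`im_inner_escape_deriv_le`). The bound on `Ω` controls `g`, `x_a g` and `x_a² g` together with
derivatives of `g` and `x_a g`, because `x_a = J_a - (i t / μ) ∂_a` (`coeffBound_of_bigOmega_le`).
Hence `g (s² + x_a²)` has size `Ω s` and a matching Lipschitz bound, and the loss of one derivative in
`g ∂_a v` can be distributed over both factors of `⟨B v, g ∂_a v⟩`: this pairing is bounded by `Ω`
times the smoothing functionals (`exists_enorm_inner_mulOp_deriv_le`). If `κ` is a large multiple of
`Ω`, the smoothing term absorbs all first order terms (`exists_energyInequality`), and the errors have
size `Ω ⟨t⟩⁻¹ ‖v‖²`.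

The two analytic facts behind this are elementary. The Gagliardo representation of `⟨|D_a| f, f⟩`
(`lintegral_shift_sub`) shows that it is stable under multiplication by Lipschitz functions
(`exists_halfEnergy_mulOp_le`). The Laplace representation `k = ∫₀^∞ e^{-λ s} e^{iλ x_a} dλ` writes `k`
as a superposition of modulations, which shows that `[sgn D_b, k]` gains one derivative
(`norm_inner_deriv_comm_le`).

A weak solution has too little regularity for this computation. It is therefore applied to
`R v_j`, with the resolvent `R = (1 - ε² Δ)⁻¹`. These functions satisfy an integral equation in `L²`
(`IsSolution.res_comp_eq`), and the errors caused by the regularization are commutators `[R, g ∂_a]`,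
which are bounded on `L²` uniformly in `ε` and tend strongly to zero (`norm_commErr_le_norm`,
`tendsto_commErr`). The energy inequality is quadratic in `‖R v‖`; comparison with the maximum in time
makes it linear (`le_of_sq_le_add_integral`), and `ε → 0` gives the claim.
-/

open FourierTransform

noncomputable section

namespace NLSEnergy

/-! ### Multiplication operators and Fourier multipliers -/

/-- The Hilbert space `L²(ℝ²; ℂ)`. -/
abbrev H : Type := Lp ℂ 2 (volume : Measure Plane)

theorem inner_eq_integral (f g : H) :
    inner ℂ f g = ∫ x, starRingEnd ℂ (f x) * g x := by
  rw [L2.inner_def]; simp [mul_comm]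

theorem integrable_conj_mul (f g : H) : Integrable fun x => starRingEnd ℂ (f x) * g x := by
  simpa [mul_comm] using L2.integrable_inner (𝕜 := ℂ) f g

open Classical in
/-- Multiplication by a function `b ∈ L^∞` on `L²`; it is the zero operator if `b ∉ L^∞`. -/
def mulOp (b : Plane → ℂ) : H →L[ℂ] H :=
  if hb : MemLp b ∞ volume then
    (ContinuousLinearMap.mul ℂ ℂ).holderL volume ∞ 2 2 (hb.toLp b) else 0

theorem coeFn_mulOp {b : Plane → ℂ} (hb : MemLp b ∞ volume) (f : H) :
    mulOp b f =ᵐ[volume] fun x => b x * f x := by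
  simp only [mulOp, dif_pos hb, ContinuousLinearMap.holderL_apply_apply]
  filter_upwards [ContinuousLinearMap.coeFn_holder (r := 2) (ContinuousLinearMap.mul ℂ ℂ)
    (hb.toLp b) f, hb.coeFn_toLp] with x hx hx'
  rw [hx, hx']; rfl

theorem norm_mulOp_le {b : Plane → ℂ} (hb : MemLp b ∞ volume) {C : ℝ}
    (hC : ∀ᵐ x, ‖b x‖ ≤ C) (f : H) : ‖mulOp b f‖ ≤ C * ‖f‖ := by
  refine Lp.norm_le_mul_norm_of_ae_le_mul ?_
  filter_upwards [coeFn_mulOp hb f, hC] with x hx hx'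
  rw [hx, norm_mul]
  gcongr

theorem memLp_conj {b : Plane → ℂ} (hb : MemLp b ∞ volume) :
    MemLp (fun x => starRingEnd ℂ (b x)) ∞ volume := hb.star

theorem memLp_mul {b c : Plane → ℂ} (hb : MemLp b ∞ volume) (hc : MemLp c ∞ volume) :
    MemLp (fun x => b x * c x) ∞ volume := hc.mul hb

theorem inner_mulOp_left {b : Plane → ℂ} (hb : MemLp b ∞ volume) (f g : H) :
    inner ℂ (mulOp b f) g = inner ℂ f (mulOp (fun x => starRingEnd ℂ (b x)) g) := by
  rw [inner_eq_integral, inner_eq_integral]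
  refine integral_congr_ae ?_
  filter_upwards [coeFn_mulOp hb f, coeFn_mulOp (memLp_conj hb) g] with x hx hx'
  rw [hx, hx', map_mul]; ring

theorem inner_mulOp_right {b : Plane → ℂ} (hb : MemLp b ∞ volume) (f g : H) :
    inner ℂ f (mulOp b g) = inner ℂ (mulOp (fun x => starRingEnd ℂ (b x)) f) g := by
  rw [inner_mulOp_left (memLp_conj hb)]; simp

theorem mulOp_mulOp {b c : Plane → ℂ} (hb : MemLp b ∞ volume) (hc : MemLp c ∞ volume) (f : H) :
    mulOp b (mulOp c f) = mulOp (fun x => b x * c x) f := by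
  refine Lp.ext ?_
  filter_upwards [coeFn_mulOp hb (mulOp c f), coeFn_mulOp hc f, coeFn_mulOp (memLp_mul hb hc) f]
    with x h1 h2 h3
  rw [h1, h2, h3, mul_assoc]

theorem mulOp_congr {b c : Plane → ℂ} (h : b =ᵐ[volume] c) : mulOp b = mulOp c := by
  by_cases hb : MemLp b ∞ volume
  · have hc : MemLp c ∞ volume := (memLp_congr_ae h).1 hb
    ext1 f
    refine Lp.ext ?_
    filter_upwards [coeFn_mulOp hb f, coeFn_mulOp hc f, h] with x h1 h2 h3
    rw [h1, h2, h3]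
  · have hc : ¬ MemLp c ∞ volume := fun hc => hb ((memLp_congr_ae h).2 hc)
    simp [mulOp, hb, hc]

theorem mulOp_const_mul (c : ℂ) {b : Plane → ℂ} (hb : MemLp b ∞ volume) (f : H) :
    mulOp (fun x => c * b x) f = c • mulOp b f := by
  refine Lp.ext ?_
  filter_upwards [coeFn_mulOp hb f, coeFn_mulOp (hb.const_mul c) f,
    Lp.coeFn_smul c (mulOp b f)] with x h1 h2 h4
  rw [h4]
  simp only [Pi.smul_apply, h1, smul_eq_mul]
  rw [h2, mul_assoc]

/-- The Fourier transform `𝓕 f` of `f ∈ L²`. -/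
def ft : H ≃ₗᵢ[ℂ] H := Lp.fourierTransformₗᵢ Plane ℂ

theorem inner_ft (f g : H) : inner ℂ (ft f) (ft g) = inner ℂ f g :=
  (Lp.fourierTransformₗᵢ Plane ℂ).inner_map_map f g

theorem norm_ft (f : H) : ‖ft f‖ = ‖f‖ := ft.norm_map f

/-- The Fourier multiplier with symbol `σ ∈ L^∞`. -/
def fourierMul (σ : Plane → ℂ) : H →L[ℂ] H :=
  (ft.symm.toContinuousLinearEquiv : H →L[ℂ] H) ∘L mulOp σ ∘L
    (ft.toContinuousLinearEquiv : H →L[ℂ] H)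

theorem ft_fourierMul (σ : Plane → ℂ) (f : H) : ft (fourierMul σ f) = mulOp σ (ft f) := by
  simp [fourierMul]

theorem coeFn_ft_fourierMul {σ : Plane → ℂ} (hσ : MemLp σ ∞ volume) (f : H) :
    ft (fourierMul σ f) =ᵐ[volume] fun ξ => σ ξ * ft f ξ := by
  rw [ft_fourierMul]; exact coeFn_mulOp hσ _

theorem norm_fourierMul_le {σ : Plane → ℂ} (hσ : MemLp σ ∞ volume) {C : ℝ}
    (hC : ∀ᵐ x, ‖σ x‖ ≤ C) (f : H) : ‖fourierMul σ f‖ ≤ C * ‖f‖ := by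
  rw [← norm_ft, ft_fourierMul, ← norm_ft f]
  exact norm_mulOp_le hσ hC _

theorem inner_fourierMul_left {σ : Plane → ℂ} (hσ : MemLp σ ∞ volume) (f g : H) :
    inner ℂ (fourierMul σ f) g = inner ℂ f (fourierMul (fun x => starRingEnd ℂ (σ x)) g) := by
  rw [← inner_ft, ← inner_ft f, ft_fourierMul, ft_fourierMul, inner_mulOp_left hσ]

/-- On Schwartz functions the `L²` multiplier agrees with the one of Mathlib. -/
theorem fourierMul_toLp {σ : Plane → ℂ} (hσ : MemLp σ ∞ volume) (hσ' : σ.HasTemperateGrowth)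
    (φ : 𝓢(Plane, ℂ)) :
    fourierMul σ (φ.toLp 2) = (SchwartzMap.fourierMultiplierCLM ℂ σ φ).toLp 2 := by
  apply ft.injective
  rw [ft_fourierMul]
  have h1 : ft (φ.toLp 2) = (𝓕 φ).toLp 2 := SchwartzMap.toLp_fourier_eq φ
  have h2 : ft ((SchwartzMap.fourierMultiplierCLM ℂ σ φ).toLp 2)
      = (𝓕 (SchwartzMap.fourierMultiplierCLM ℂ σ φ)).toLp 2 := SchwartzMap.toLp_fourier_eq _
  rw [h1, h2, SchwartzMap.fourierMultiplierCLM_apply, FourierTransform.fourier_fourierInv_eq]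
  refine Lp.ext ?_
  filter_upwards [coeFn_mulOp hσ ((𝓕 φ).toLp 2), (𝓕 φ).coeFn_toLp 2 volume,
    (SchwartzMap.smulLeftCLM ℂ σ (𝓕 φ)).coeFn_toLp 2 volume] with x e1 e2 e3
  rw [e1, e2, e3, SchwartzMap.smulLeftCLM_apply_apply hσ', smul_eq_mul]

theorem coeFn_star_eq (f : H) : ((star f : H) : Plane → ℂ) =ᵐ[volume] fun x => starRingEnd ℂ (f x) :=
  Lp.coeFn_star f

theorem norm_star_eq (f : H) : ‖star f‖ = ‖f‖ := by
  refine le_antisymm ?_ ?_ <;>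
  · refine Lp.norm_le_norm_of_ae_le ?_
    filter_upwards [coeFn_star_eq f] with x hx
    rw [hx]; simp

theorem exists_schwartz_tendsto (f : H) :
    ∃ φ : ℕ → 𝓢(Plane, ℂ), Filter.Tendsto (fun n => (φ n).toLp 2 volume) Filter.atTop (nhds f) := by
  have hd := SchwartzMap.denseRange_toLpCLM (E := Plane) (F := ℂ) (μ := volume)
    (p := 2) ENNReal.ofNat_ne_top
  obtain ⟨u, hu, hlim⟩ := mem_closure_iff_seq_limit.1 (hd f)
  choose φ hφ using hu
  refine ⟨φ, ?_⟩
  have : (fun n => (φ n).toLp 2 volume) = u := by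
    ext1 n; exact hφ n
  rwa [this]

/-! ### Weak derivatives in `L²` -/

/-- `HasD a f d` says that `d ∈ L²` is the distributional derivative `∂_a f` of `f ∈ L²`. -/
def HasD (a : Fin 2) (f d : H) : Prop :=
  ∂_{stdVec a} (Lp.toTemperedDistribution f) = Lp.toTemperedDistribution d

theorem temperedDistribution_ext_iff {T U : 𝓢'(Plane, ℂ)} : T = U ↔ ∀ φ, T φ = U φ :=
  ⟨fun h φ => by rw [h], fun h => by ext φ; exact h φ⟩

theorem hasD_iff_integral {a : Fin 2} {f d : H} :
    HasD a f d ↔ ∀ φ : 𝓢(Plane, ℂ), ∫ x, φ x * d x = -∫ x, (∂_{stdVec a} φ) x * f x := by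
  rw [HasD, temperedDistribution_ext_iff]
  refine forall_congr' fun φ => ?_
  rw [TemperedDistribution.lineDerivOp_apply_apply]
  simp [eq_comm, integral_neg]

theorem stdVec_inner (a : Fin 2) (ξ : Plane) : inner ℝ ξ (stdVec a) = ξ a := by
  simp [stdVec, EuclideanSpace.inner_single_right]

/-- The symbol `2π i ξ_a` of `∂_a`. -/
def dsym (a : Fin 2) (ξ : Plane) : ℂ := 2 * Real.pi * Complex.I * (ξ a : ℂ)

theorem continuous_dsym (a : Fin 2) : Continuous (dsym a) := by
  unfold dsym; fun_prop

theorem norm_dsym (a : Fin 2) (ξ : Plane) : ‖dsym a ξ‖ = 2 * Real.pi * |ξ a| := by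
  simp [dsym, abs_of_pos Real.pi_pos]

theorem conj_dsym (a : Fin 2) (ξ : Plane) : starRingEnd ℂ (dsym a ξ) = - dsym a ξ := by
  simp [dsym, Complex.conj_ofNat]

/-- On the Fourier side, `∂_a` is multiplication by its symbol. -/
theorem hasD_iff_ft {a : Fin 2} {f d : H} :
    HasD a f d ↔ ft d =ᵐ[volume] fun ξ => dsym a ξ * ft f ξ := by
  have key : HasD a f d ↔ ∀ φ : 𝓢(Plane, ℂ),
      ∫ ξ, φ ξ * ft d ξ = ∫ ξ, φ ξ * (dsym a ξ * ft f ξ) := by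
    have h1 : HasD a f d ↔ 𝓕 (∂_{stdVec a} (Lp.toTemperedDistribution f)) =
        𝓕 (Lp.toTemperedDistribution d) := by
      refine ⟨fun h => by rw [h], fun h => ?_⟩
      have := congrArg (fun T : 𝓢'(Plane, ℂ) => 𝓕⁻ T) h
      simpa [HasD] using this
    have hg : (fun ξ : Plane => (inner ℝ ξ (stdVec a) : ℂ)).HasTemperateGrowth := by fun_prop
    rw [h1, TemperedDistribution.fourier_lineDerivOp_eq, Lp.fourier_toTemperedDistribution_eq,
      Lp.fourier_toTemperedDistribution_eq, temperedDistribution_ext_iff]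
    refine forall_congr' fun φ => ?_
    have e : ((2 * Real.pi * Complex.I) • TemperedDistribution.smulLeftCLM ℂ
        (fun ξ : Plane => (inner ℝ ξ (stdVec a) : ℂ))
          (Lp.toTemperedDistribution (𝓕 f : H))) φ
        = ∫ ξ, φ ξ * (dsym a ξ * ft f ξ) := by
      rw [_root_.smul_apply, TemperedDistribution.smulLeftCLM_apply_apply,
        Lp.toTemperedDistribution_apply, ← integral_smul]
      refine integral_congr_ae (Filter.Eventually.of_forall fun ξ => ?_)
      have e0 := SchwartzMap.smulLeftCLM_apply_apply hg φ ξ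
      beta_reduce
      erw [e0]
      simp only [smul_eq_mul, stdVec_inner, dsym]
      change _ = φ ξ * (_ * (𝓕 f : H) ξ)
      ring
    rw [e, Lp.toTemperedDistribution_apply, eq_comm]
    rfl
  rw [key]
  constructor
  · intro h
    have hloc : LocallyIntegrable (fun ξ => ft d ξ - dsym a ξ * ft f ξ) volume := by
      refine ((Lp.memLp (ft d)).locallyIntegrable (by norm_num)).sub ?_
      exact ((Lp.memLp (ft f)).locallyIntegrable (by norm_num)).continuous_mul
        (continuous_dsym a)
    have := ae_eq_zero_of_integral_contDiff_smul_eq_zero hloc ?_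
    · filter_upwards [this] with ξ hξ using sub_eq_zero.1 hξ
    · intro g hg hgc
      have h1 : HasCompactSupport (Complex.ofRealCLM ∘ g) := hgc.comp_left rfl
      have h2 : ContDiff ℝ (⊤ : ℕ∞) (Complex.ofRealCLM ∘ g) :=
        Complex.ofRealCLM.contDiff.comp hg
      have h3 := h (h1.toSchwartzMap h2)
      have hgl : ∀ {u : Plane → ℂ}, LocallyIntegrable u volume →
          Integrable (fun ξ => (g ξ : ℂ) * u ξ) volume := by
        intro u hu
        have := hu.integrable_smul_left_of_hasCompactSupport hg.continuous hgc
        simpa using this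
      have i1 := hgl ((Lp.memLp (ft d)).locallyIntegrable (by norm_num))
      have i2 := hgl (((Lp.memLp (ft f)).locallyIntegrable (by norm_num)).continuous_mul
        (continuous_dsym a))
      calc ∫ ξ, g ξ • (ft d ξ - dsym a ξ * ft f ξ)
          = ∫ ξ, ((g ξ : ℂ) * ft d ξ - (g ξ : ℂ) * (dsym a ξ * ft f ξ)) := by
            refine integral_congr_ae (Filter.Eventually.of_forall fun ξ => ?_)
            simp [mul_sub]
        _ = 0 := by
            rw [integral_sub i1 i2, sub_eq_zero]
            simpa using h3
  · intro h φ
    refine integral_congr_ae ?_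
    filter_upwards [h] with ξ hξ
    rw [hξ]

/-- Integration by parts. -/
theorem HasD.inner_left {a : Fin 2} {f d g e : H} (hf : HasD a f d) (hg : HasD a g e) :
    inner ℂ d g = - inner ℂ f e := by
  rw [← inner_ft, ← inner_ft f, inner_eq_integral, inner_eq_integral, ← integral_neg]
  refine integral_congr_ae ?_
  filter_upwards [hasD_iff_ft.1 hf, hasD_iff_ft.1 hg] with ξ h1 h2
  rw [h1, h2, map_mul, conj_dsym]; ring

theorem HasD.multiplier {a : Fin 2} {f d : H} (h : HasD a f d) {σ : Plane → ℂ}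
    (hσ : MemLp σ ∞ volume) : HasD a (fourierMul σ f) (fourierMul σ d) := by
  rw [hasD_iff_ft] at h ⊢
  filter_upwards [h, coeFn_ft_fourierMul hσ f, coeFn_ft_fourierMul hσ d] with ξ h1 h2 h3
  rw [h2, h3, h1]; ring

theorem hasD_fourierMul_of_symbol {a : Fin 2} {σ τ : Plane → ℂ} (hσ : MemLp σ ∞ volume)
    (hτ : MemLp τ ∞ volume) (h : ∀ ξ, τ ξ = dsym a ξ * σ ξ) (f : H) :
    HasD a (fourierMul σ f) (fourierMul τ f) := by
  rw [hasD_iff_ft]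
  filter_upwards [coeFn_ft_fourierMul hσ f, coeFn_ft_fourierMul hτ f] with ξ h2 h3
  rw [h2, h3, h]; ring

theorem hasD_toLp (a : Fin 2) (φ : 𝓢(Plane, ℂ)) :
    HasD a (φ.toLp 2) ((∂_{stdVec a} φ).toLp 2) := by
  rw [HasD, Lp.toTemperedDistribution_toLp_eq, Lp.toTemperedDistribution_toLp_eq,
    TemperedDistribution.lineDerivOp_toTemperedDistributionCLM_eq]

theorem HasD.add {a : Fin 2} {f d g e : H} (hf : HasD a f d) (hg : HasD a g e) :
    HasD a (f + g) (d + e) := by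
  have h := congrArg₂ (· + ·) hf hg
  have h1 := (Lp.toTemperedDistributionCLM ℂ (volume : Measure Plane) 2).map_add f g
  have h2 := (Lp.toTemperedDistributionCLM ℂ (volume : Measure Plane) 2).map_add d e
  simp only [Lp.toTemperedDistributionCLM_apply] at h1 h2
  rw [HasD, h1, h2, LineDerivAdd.lineDerivOp_add]
  exact h

theorem HasD.const_smul {a : Fin 2} {f d : H} (c : ℂ) (hf : HasD a f d) :
    HasD a (c • f) (c • d) := by
  have h1 := (Lp.toTemperedDistributionCLM ℂ (volume : Measure Plane) 2).map_smul c f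
  have h2 := (Lp.toTemperedDistributionCLM ℂ (volume : Measure Plane) 2).map_smul c d
  simp only [Lp.toTemperedDistributionCLM_apply] at h1 h2
  rw [HasD, h1, h2, LineDerivSMul.lineDerivOp_smul]
  exact congrArg (c • ·) hf

/-- The complex conjugate of a Schwartz function. -/
def conjS (φ : 𝓢(Plane, ℂ)) : 𝓢(Plane, ℂ) :=
  φ.postcompCLM (Complex.conjCLE : ℂ →L[ℝ] ℂ)

@[simp]
theorem conjS_apply (φ : 𝓢(Plane, ℂ)) (x : Plane) : conjS φ x = starRingEnd ℂ (φ x) := rfl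

theorem lineDeriv_conjS (v : Plane) (φ : 𝓢(Plane, ℂ)) : ∂_{v} (conjS φ) = conjS (∂_{v} φ) := by
  ext x
  rw [conjS_apply, SchwartzMap.lineDerivOp_apply_eq_fderiv,
    SchwartzMap.lineDerivOp_apply_eq_fderiv]
  have h : HasFDerivAt (conjS φ : Plane → ℂ)
      ((Complex.conjCLE : ℂ →L[ℝ] ℂ) ∘L (fderiv ℝ φ x)) x :=
    (Complex.conjCLE : ℂ →L[ℝ] ℂ).hasFDerivAt.comp x (φ.hasFDerivAt x)
  rw [h.fderiv]; simp

theorem HasD.conj {a : Fin 2} {f d : H} (hf : HasD a f d) : HasD a (star f) (star d) := by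
  rw [hasD_iff_integral] at hf ⊢
  intro φ
  have h := congrArg (starRingEnd ℂ) (hf (conjS φ))
  rw [map_neg, ← integral_conj, ← integral_conj] at h
  calc ∫ x, φ x * (star d : H) x
      = ∫ x, starRingEnd ℂ (conjS φ x * d x) := by
        refine integral_congr_ae ?_
        filter_upwards [coeFn_star_eq d] with x hx
        rw [hx]; simp
    _ = _ := h
    _ = _ := by
        congr 1
        refine integral_congr_ae ?_
        filter_upwards [coeFn_star_eq f] with x hx
        rw [hx, lineDeriv_conjS]; simp

/-- The Leibniz rule for a smooth bounded function with bounded derivative `c = ∂_a b`. -/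
theorem HasD.mul_left {a : Fin 2} {f d : H} (hf : HasD a f d) {b c : Plane → ℂ}
    (hb : MemLp b ∞ volume) (hc : MemLp c ∞ volume) (hb' : b.HasTemperateGrowth)
    (hbc : ∀ x, fderiv ℝ b x (stdVec a) = c x) :
    HasD a (mulOp b f) (mulOp b d + mulOp c f) := by
  rw [hasD_iff_integral] at hf ⊢
  intro φ
  have hderiv : ∀ x, (∂_{stdVec a} (SchwartzMap.smulLeftCLM ℂ b φ)) x
      = b x * (∂_{stdVec a} φ) x + c x * φ x := by
    intro x
    rw [SchwartzMap.lineDerivOp_apply_eq_fderiv, SchwartzMap.lineDerivOp_apply_eq_fderiv,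
      SchwartzMap.smulLeftCLM_apply hb', ← hbc]
    have hbd : DifferentiableAt ℝ b x := (hb'.1.differentiable (by simp)) x
    have := (hbd.hasFDerivAt.smul (φ.hasFDerivAt x)).fderiv
    change (fderiv ℝ (fun y => b y • φ y) x) _ = _
    erw [this]
    simp
  have hint : ∀ (ψ : 𝓢(Plane, ℂ)) (u : H), Integrable fun x => ψ x * u x := by
    intro ψ u
    have h2 := integrable_conj_mul ((conjS ψ).toLp 2) u
    refine h2.congr ?_
    filter_upwards [(conjS ψ).coeFn_toLp 2 volume] with x hx
    rw [hx]; simp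
  have h := hf (SchwartzMap.smulLeftCLM ℂ b φ)
  simp only [hderiv, SchwartzMap.smulLeftCLM_apply_apply hb', smul_eq_mul] at h
  have e1 : ∫ x, φ x * (mulOp b d + mulOp c f : H) x
      = (∫ x, b x * φ x * d x) + ∫ x, φ x * (mulOp c f) x := by
    have i1 : Integrable fun x => b x * φ x * d x := by
      refine (hint φ (mulOp b d)).congr ?_
      filter_upwards [coeFn_mulOp hb d] with x hx
      rw [hx]; ring
    rw [← integral_add i1 (hint φ _)]
    refine integral_congr_ae ?_
    filter_upwards [coeFn_mulOp hb d, Lp.coeFn_add (mulOp b d) (mulOp c f)]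
      with x h1 h2
    rw [h2, Pi.add_apply, h1]; ring
  have e2 : ∫ x, (b x * (∂_{stdVec a} φ) x + c x * φ x) * f x
      = (∫ x, (∂_{stdVec a} φ) x * (mulOp b f) x)
        + ∫ x, φ x * (mulOp c f) x := by
    rw [← integral_add (hint _ _) (hint _ _)]
    refine integral_congr_ae ?_
    filter_upwards [coeFn_mulOp hb f, coeFn_mulOp hc f] with x h1 h2
    rw [h1, h2]; ring
  rw [e1, h, e2]; ring

/-! ### The directional energy of order `1/2` -/

/-- The character `x ↦ e^{2π i ⟨v, x⟩}`. -/
def chr (v x : Plane) : ℂ := Complex.exp (((2 * Real.pi * inner ℝ v x : ℝ) : ℂ) * Complex.I)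

theorem norm_chr (v x : Plane) : ‖chr v x‖ = 1 := Complex.norm_exp_ofReal_mul_I _

theorem continuous_chr : Continuous fun p : Plane × Plane => chr p.1 p.2 := by
  unfold chr; fun_prop

theorem memLp_chr (v : Plane) : MemLp (chr v) ∞ volume :=
  memLp_top_of_bound (by unfold chr; fun_prop) 1
    (Filter.Eventually.of_forall fun x => (norm_chr v x).le)

/-- The translate `x ↦ φ (x + v)` of a Schwartz function. -/
def shiftS (v : Plane) (φ : 𝓢(Plane, ℂ)) : 𝓢(Plane, ℂ) :=
  SchwartzMap.compCLMOfAntilipschitz ℂ (g := fun x : Plane => x + v) (K := 1)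
    (Function.HasTemperateGrowth.id'.add (Function.HasTemperateGrowth.const v))
    (AntilipschitzWith.of_le_mul_dist fun x y => by simp) φ

@[simp]
theorem shiftS_apply (v : Plane) (φ : 𝓢(Plane, ℂ)) (x : Plane) : shiftS v φ x = φ (x + v) := rfl

/-- The translation `f ↦ f (· + v)` on `L²`. -/
def shift (v : Plane) : H →ₗᵢ[ℂ] H :=
  Lp.compMeasurePreservingₗᵢ ℂ (fun x : Plane => x + v) (measurePreserving_add_right volume v)

theorem coeFn_shift (v : Plane) (f : H) : shift v f =ᵐ[volume] fun x => f (x + v) :=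
  Lp.coeFn_compMeasurePreserving f (measurePreserving_add_right volume v)

theorem shift_toLp (v : Plane) (φ : 𝓢(Plane, ℂ)) :
    shift v (φ.toLp 2) = (shiftS v φ).toLp 2 := by
  refine Lp.ext ?_
  have h := (measurePreserving_add_right (volume : Measure Plane) v).quasiMeasurePreserving.ae_eq_comp
    (φ.coeFn_toLp 2 volume)
  filter_upwards [coeFn_shift v (φ.toLp 2), (shiftS v φ).coeFn_toLp 2 volume, h] with x h1 h2 h3
  rw [h1, h2]; exact h3

/-- Continuous maps on `L²` are determined by their values on Schwartz functions. -/
theorem eq_of_eq_on_schwartz {A B : H → H} (hA : Continuous A) (hB : Continuous B)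
    (h : ∀ φ : 𝓢(Plane, ℂ), A (φ.toLp 2) = B (φ.toLp 2)) (f : H) : A f = B f := by
  obtain ⟨φ, hφ⟩ := exists_schwartz_tendsto f
  refine tendsto_nhds_unique ((hA.tendsto f).comp hφ) ?_
  refine ((hB.tendsto f).comp hφ).congr fun n => ?_
  simp [h]

theorem ft_toLp (φ : 𝓢(Plane, ℂ)) : ft (φ.toLp 2) = (𝓕 φ).toLp 2 := SchwartzMap.toLp_fourier_eq φ

theorem ft_symm_toLp (φ : 𝓢(Plane, ℂ)) : ft.symm (φ.toLp 2) = (𝓕⁻ φ).toLp 2 :=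
  SchwartzMap.toLp_fourierInv_eq φ

theorem ft_shift (v : Plane) (f : H) : ft (shift v f) = mulOp (chr v) (ft f) := by
  refine eq_of_eq_on_schwartz (ft.continuous.comp (shift v).continuous)
    ((mulOp (chr v)).continuous.comp ft.continuous) (fun φ => ?_) f
  rw [Function.comp_apply, Function.comp_apply, shift_toLp, ft_toLp, ft_toLp]
  refine Lp.ext ?_
  filter_upwards [(𝓕 (shiftS v φ)).coeFn_toLp 2 volume, (𝓕 φ).coeFn_toLp 2 volume,
    coeFn_mulOp (memLp_chr v) ((𝓕 φ).toLp 2)] with ξ h1 h2 h3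
  rw [h1, h3, h2, SchwartzMap.fourier_coe, SchwartzMap.fourier_coe, Real.fourier_eq',
    Real.fourier_eq', ← integral_add_right_eq_self _ (-v), ← integral_const_mul]
  refine integral_congr_ae (Filter.Eventually.of_forall fun x => ?_)
  simp only [shiftS_apply, neg_add_cancel_right, chr, smul_eq_mul]
  rw [← mul_assoc, ← Complex.exp_add]
  congr 2
  simp only [inner_add_left, inner_neg_left]
  push_cast; ring

/-- Modulation translates the Fourier transform. -/
theorem ft_mulOp_chr (v : Plane) (f : H) : ft (mulOp (chr v) f) = shift (-v) (ft f) := by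
  have key : ∀ g : H, ft.symm (shift (-v) g) = mulOp (chr v) (ft.symm g) := by
    refine eq_of_eq_on_schwartz (ft.symm.continuous.comp (shift (-v)).continuous)
      ((mulOp (chr v)).continuous.comp ft.symm.continuous) (fun φ => ?_)
    rw [shift_toLp, ft_symm_toLp, ft_symm_toLp]
    refine Lp.ext ?_
    filter_upwards [(𝓕⁻ (shiftS (-v) φ)).coeFn_toLp 2 volume, (𝓕⁻ φ).coeFn_toLp 2 volume,
      coeFn_mulOp (memLp_chr v) ((𝓕⁻ φ).toLp 2)] with ξ h1 h2 h3
    rw [h1, h3, h2, SchwartzMap.fourierInv_coe, SchwartzMap.fourierInv_coe, Real.fourierInv_eq',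
      Real.fourierInv_eq', ← integral_add_right_eq_self _ v, ← integral_const_mul]
    refine integral_congr_ae (Filter.Eventually.of_forall fun x => ?_)
    simp only [shiftS_apply, add_neg_cancel_right, chr, smul_eq_mul]
    rw [← mul_assoc, ← Complex.exp_add]
    congr 2
    simp only [inner_add_left]
    push_cast; ring
  have := key (ft f)
  rw [ft.symm_apply_apply] at this
  rw [← this, ft.apply_symm_apply]

theorem lintegral_enorm_sq (f : H) : ∫⁻ x, ‖f x‖ₑ ^ 2 = ENNReal.ofReal (‖f‖ ^ 2) := by
  have h := Lp.enorm_def f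
  rw [eLpNorm_eq_lintegral_rpow_enorm_toReal (by norm_num) (by norm_num)] at h
  have h2 : ENNReal.ofReal (‖f‖ ^ 2) = ‖f‖ₑ ^ 2 := by
    rw [ENNReal.ofReal_pow (norm_nonneg _), ofReal_norm]
  rw [h2, h, ← ENNReal.rpow_natCast, ← ENNReal.rpow_mul]
  norm_num

/-- The homogeneous Sobolev quantity `⟨|D_a| f, f⟩` of order `1/2` in the direction `e_a`. -/
def halfEnergy (a : Fin 2) (f : H) : ℝ≥0∞ := ∫⁻ ξ, ‖dsym a ξ‖ₑ * ‖ft f ξ‖ₑ ^ 2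

/-- The weighted integral `∫ τ⁻² |e^{iτ} - 1|² dτ`. -/
def gagConst : ℝ≥0∞ :=
  ∫⁻ τ : ℝ, ENNReal.ofReal ((τ ^ 2)⁻¹) * ‖Complex.exp (Complex.I * (τ : ℂ)) - 1‖ₑ ^ 2

theorem measurable_gag_integrand : Measurable fun τ : ℝ =>
    ENNReal.ofReal ((τ ^ 2)⁻¹) * ‖Complex.exp (Complex.I * (τ : ℂ)) - 1‖ₑ ^ 2 := by
  fun_prop

theorem gag_scale (c : ℝ) :
    ∫⁻ τ : ℝ, ENNReal.ofReal ((τ ^ 2)⁻¹) *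
      ‖Complex.exp (Complex.I * ((c * τ : ℝ) : ℂ)) - 1‖ₑ ^ 2 = ENNReal.ofReal |c| * gagConst := by
  rcases eq_or_ne c 0 with rfl | hc
  · simp
  · have hF := measurable_gag_integrand
    set F : ℝ → ℝ≥0∞ := fun τ : ℝ =>
      ENNReal.ofReal ((τ ^ 2)⁻¹) * ‖Complex.exp (Complex.I * (τ : ℂ)) - 1‖ₑ ^ 2 with hFdef
    have h1 : ∫⁻ τ, F (c * τ) = ENNReal.ofReal |c⁻¹| * gagConst := by
      rw [← lintegral_map (μ := volume) hF (measurable_const_mul c), Real.map_volume_mul_left hc,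
        lintegral_smul_measure]
      rfl
    have h2 : ∀ τ : ℝ, ENNReal.ofReal ((τ ^ 2)⁻¹) *
      ‖Complex.exp (Complex.I * ((c * τ : ℝ) : ℂ)) - 1‖ₑ ^ 2 = ENNReal.ofReal (c ^ 2) * F (c * τ) := by
      intro τ
      simp only [hFdef]
      rw [← mul_assoc, ← ENNReal.ofReal_mul (by positivity)]
      congr 2
      field_simp
    simp_rw [h2]
    rw [lintegral_const_mul' _ _ ENNReal.ofReal_ne_top, h1, ← mul_assoc,
      ← ENNReal.ofReal_mul (by positivity)]
    congr 2
    rw [abs_inv, ← sq_abs]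
    field_simp

theorem lintegral_inv_one_add_sq_lt_top : ∫⁻ τ : ℝ, ENNReal.ofReal ((1 + τ ^ 2)⁻¹) < ∞ :=
  integrable_inv_one_add_sq.lintegral_lt_top

/-- An interpolated bound: a quantity that is at most `A |τ|` and at most `B`. -/
theorem inv_sq_mul_sq_le {A B d τ : ℝ} (hd : 0 ≤ d) (h1 : d ≤ A * |τ|)
    (h2 : d ≤ B) : (τ ^ 2)⁻¹ * d ^ 2 ≤ 2 * (A ^ 2 + B ^ 2) * (1 + τ ^ 2)⁻¹ := by
  rcases eq_or_ne τ 0 with rfl | hτ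
  · simp; positivity
  have hτ2 : 0 < τ ^ 2 := by positivity
  rw [inv_mul_eq_div, ← div_eq_mul_inv, div_le_div_iff₀ hτ2 (by positivity)]
  have e1 : d ^ 2 ≤ A ^ 2 * τ ^ 2 := by
    calc d ^ 2 ≤ (A * |τ|) ^ 2 := by gcongr
      _ = _ := by rw [mul_pow, sq_abs]
  have e2 : d ^ 2 ≤ B ^ 2 := by gcongr
  nlinarith [mul_le_mul_of_nonneg_right e2 hτ2.le, sq_nonneg A, sq_nonneg B,
    mul_nonneg (sq_nonneg A) hτ2.le, mul_nonneg (sq_nonneg B) hτ2.le]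

theorem gagConst_lt_top : gagConst < ∞ := by
  refine lt_of_le_of_lt (lintegral_mono (g := fun τ : ℝ =>
    ENNReal.ofReal 10 * ENNReal.ofReal ((1 + τ ^ 2)⁻¹)) fun τ => ?_) ?_
  · simp only
    rw [← ofReal_norm, ← ENNReal.ofReal_pow (norm_nonneg _),
      ← ENNReal.ofReal_mul (by positivity), ← ENNReal.ofReal_mul (by norm_num)]
    refine ENNReal.ofReal_le_ofReal ?_
    refine (inv_sq_mul_sq_le (A := 1) (B := 2) (norm_nonneg _) ?_ ?_).trans (le_of_eq (by norm_num))
    · simpa using Real.norm_exp_I_mul_ofReal_sub_one_le (x := τ)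
    · refine (norm_sub_le _ _).trans ?_
      rw [mul_comm, Complex.norm_exp_ofReal_mul_I]; norm_num
  · rw [lintegral_const_mul' _ _ ENNReal.ofReal_ne_top]
    exact ENNReal.mul_lt_top ENNReal.ofReal_lt_top lintegral_inv_one_add_sq_lt_top

theorem gagConst_pos : 0 < gagConst := by
  rw [gagConst, lintegral_pos_iff_support measurable_gag_integrand]
  refine lt_of_lt_of_le (b := volume (Ioo (0 : ℝ) 1)) (by simp) (measure_mono fun τ hτ => ?_)
  have h0 : 0 < τ := hτ.1
  rw [Function.mem_support]
  refine mul_ne_zero (by simpa using h0.ne') (pow_ne_zero _ ?_)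
  rw [Ne, enorm_eq_zero, sub_eq_zero, Complex.exp_eq_one_iff]
  rintro ⟨n, hn⟩
  have h1 : τ = n * (2 * Real.pi) := by
    have := congrArg Complex.im hn
    simpa using this
  have hpi := Real.pi_gt_three
  have hn0 : 0 < (n : ℝ) := by
    by_contra hcon
    push Not at hcon
    nlinarith [hτ.1]
  have hn1 : (1 : ℝ) ≤ n := by exact_mod_cast (by exact_mod_cast hn0 : 0 < n)
  nlinarith [hτ.2]

/-- The Gagliardo representation of `halfEnergy`. -/
theorem lintegral_shift_sub (a : Fin 2) (f : H) :
    ∫⁻ τ : ℝ, ENNReal.ofReal ((τ ^ 2)⁻¹) * ∫⁻ x, ‖f (x + τ • stdVec a) - f x‖ₑ ^ 2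
      = gagConst * halfEnergy a f := by
  have h1 : ∀ τ : ℝ, ∫⁻ x, ‖f (x + τ • stdVec a) - f x‖ₑ ^ 2
      = ∫⁻ ξ, ‖Complex.exp (Complex.I * ((2 * Real.pi * ξ a * τ : ℝ) : ℂ)) - 1‖ₑ ^ 2
          * ‖ft f ξ‖ₑ ^ 2 := by
    intro τ
    have e1 : ∫⁻ x, ‖f (x + τ • stdVec a) - f x‖ₑ ^ 2
        = ∫⁻ x, ‖(shift (τ • stdVec a) f - f : H) x‖ₑ ^ 2 := by
      refine lintegral_congr_ae ?_
      filter_upwards [coeFn_shift (τ • stdVec a) f, Lp.coeFn_sub (shift (τ • stdVec a) f) f]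
        with x hx hx'
      rw [hx', Pi.sub_apply, hx]
    rw [e1, lintegral_enorm_sq, ← norm_ft, ← lintegral_enorm_sq, map_sub, ft_shift]
    refine lintegral_congr_ae ?_
    filter_upwards [coeFn_mulOp (memLp_chr (τ • stdVec a)) (ft f),
      Lp.coeFn_sub (mulOp (chr (τ • stdVec a)) (ft f)) (ft f)] with ξ hx hx'
    have e2 : chr (τ • stdVec a) ξ
        = Complex.exp (Complex.I * ((2 * Real.pi * ξ a * τ : ℝ) : ℂ)) := by
      rw [chr, inner_smul_left, real_inner_comm, stdVec_inner]
      congr 1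
      push_cast
      simp; ring
    rw [hx', Pi.sub_apply, hx, ← mul_pow, ← enorm_mul, ← e2]
    congr 2; ring
  simp_rw [h1]
  have hmeas := (Lp.stronglyMeasurable (ft f)).measurable
  calc _ = ∫⁻ τ : ℝ, ∫⁻ ξ : Plane, ENNReal.ofReal ((τ ^ 2)⁻¹) *
        (‖Complex.exp (Complex.I * ((2 * Real.pi * ξ a * τ : ℝ) : ℂ)) - 1‖ₑ ^ 2
          * ‖ft f ξ‖ₑ ^ 2) := by
        refine lintegral_congr fun τ => ?_
        rw [lintegral_const_mul' _ _ ENNReal.ofReal_ne_top]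
    _ = ∫⁻ ξ : Plane, ∫⁻ τ : ℝ, ENNReal.ofReal ((τ ^ 2)⁻¹) *
        (‖Complex.exp (Complex.I * ((2 * Real.pi * ξ a * τ : ℝ) : ℂ)) - 1‖ₑ ^ 2
          * ‖ft f ξ‖ₑ ^ 2) := by
        refine lintegral_lintegral_swap (Measurable.aemeasurable ?_)
        unfold Function.uncurry
        fun_prop
    _ = ∫⁻ ξ : Plane, gagConst * (‖dsym a ξ‖ₑ * ‖ft f ξ‖ₑ ^ 2) := by
        refine lintegral_congr fun ξ => ?_
        simp_rw [← mul_assoc]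
        rw [lintegral_mul_const', gag_scale, ← ofReal_norm (dsym a ξ), norm_dsym,
          abs_mul, abs_of_pos (by positivity : 0 < 2 * Real.pi), mul_comm gagConst]
        simp
    _ = _ := by
        rw [lintegral_const_mul' _ _ gagConst_lt_top.ne]; rfl

/-! ### Stability properties of the energy of order `1/2` -/

theorem enorm_add_sq_le (u v : ℂ) : ‖u + v‖ₑ ^ 2 ≤ 2 * ‖u‖ₑ ^ 2 + 2 * ‖v‖ₑ ^ 2 := by
  rw [← ofReal_norm, ← ofReal_norm, ← ofReal_norm, ← ENNReal.ofReal_pow (norm_nonneg _),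
    ← ENNReal.ofReal_pow (norm_nonneg _), ← ENNReal.ofReal_pow (norm_nonneg _),
    ← ENNReal.ofReal_ofNat, ← ENNReal.ofReal_mul (by norm_num),
    ← ENNReal.ofReal_mul (by norm_num), ← ENNReal.ofReal_add (by positivity) (by positivity)]
  refine ENNReal.ofReal_le_ofReal ?_
  nlinarith [norm_add_le u v, norm_nonneg (u + v), sq_nonneg (‖u‖ - ‖v‖), norm_nonneg u,
    norm_nonneg v]

theorem halfEnergy_add_le (a : Fin 2) (f g : H) :
    halfEnergy a (f + g) ≤ 2 * halfEnergy a f + 2 * halfEnergy a g := by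
  have hf := (Lp.stronglyMeasurable (ft f)).measurable
  have hd : Measurable (dsym a) := (continuous_dsym a).measurable
  rw [halfEnergy, halfEnergy, halfEnergy, ← lintegral_const_mul' _ _ (by simp),
    ← lintegral_const_mul' _ _ (by simp), ← lintegral_add_left (by fun_prop)]
  refine lintegral_mono_ae ?_
  rw [map_add]
  filter_upwards [Lp.coeFn_add (ft f) (ft g)] with ξ h
  rw [h, Pi.add_apply]
  calc ‖dsym a ξ‖ₑ * ‖ft f ξ + ft g ξ‖ₑ ^ 2
      ≤ ‖dsym a ξ‖ₑ * (2 * ‖ft f ξ‖ₑ ^ 2 + 2 * ‖ft g ξ‖ₑ ^ 2) := by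
        gcongr
        exact enorm_add_sq_le _ _
    _ = _ := by ring

theorem halfEnergy_smul (a : Fin 2) (c : ℂ) (f : H) :
    halfEnergy a (c • f) = ENNReal.ofReal (‖c‖ ^ 2) * halfEnergy a f := by
  rw [halfEnergy, halfEnergy, ← lintegral_const_mul' _ _ ENNReal.ofReal_ne_top, map_smul]
  refine lintegral_congr_ae ?_
  filter_upwards [Lp.coeFn_smul c (ft f)] with ξ h
  rw [h, Pi.smul_apply, enorm_smul, ENNReal.ofReal_pow (norm_nonneg _), ofReal_norm]
  ring

theorem halfEnergy_fourierMul_le (a : Fin 2) {σ : Plane → ℂ} (hσ : MemLp σ ∞ volume)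
    (h : ∀ ξ, ‖σ ξ‖ ≤ 1) (f : H) : halfEnergy a (fourierMul σ f) ≤ halfEnergy a f := by
  refine lintegral_mono_ae ?_
  filter_upwards [coeFn_ft_fourierMul hσ f] with ξ hξ
  rw [hξ, enorm_mul]
  gcongr
  refine (mul_le_mul_left (b := ‖σ ξ‖ₑ) (c := 1) ?_ _).trans_eq (one_mul _)
  rw [← ofReal_norm, ← ENNReal.ofReal_one]
  exact ENNReal.ofReal_le_ofReal (h ξ)

theorem halfEnergy_star (a : Fin 2) (f : H) : halfEnergy a (star f) = halfEnergy a f := by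
  have h : gagConst * halfEnergy a (star f) = gagConst * halfEnergy a f := by
    rw [← lintegral_shift_sub, ← lintegral_shift_sub]
    refine lintegral_congr fun τ => ?_
    congr 1
    have hs := (measurePreserving_add_right (volume : Measure Plane)
      (τ • stdVec a)).quasiMeasurePreserving.ae_eq_comp (coeFn_star_eq f)
    refine lintegral_congr_ae ?_
    filter_upwards [coeFn_star_eq f, hs] with x h1 h2
    have h2' : (star f : H) (x + τ • stdVec a) = starRingEnd ℂ (f (x + τ • stdVec a)) := h2
    rw [h1, h2', ← map_sub, ← ofReal_norm, ← ofReal_norm, RCLike.norm_conj]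
  exact (ENNReal.mul_right_inj gagConst_pos.ne' gagConst_lt_top.ne).1 h

/-- The Cauchy-Schwarz inequality that distributes one derivative evenly over both factors. -/
theorem enorm_inner_deriv_le {a : Fin 2} {k k' : H} (h : HasD a k k') (f : H) :
    ‖(inner ℂ f k' : ℂ)‖ₑ ≤ halfEnergy a f ^ (2⁻¹ : ℝ) * halfEnergy a k ^ (2⁻¹ : ℝ) := by
  have hd : Measurable (dsym a) := (continuous_dsym a).measurable
  have hf := (Lp.stronglyMeasurable (ft f)).measurable
  have hk := (Lp.stronglyMeasurable (ft k)).measurable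
  rw [← inner_ft, inner_eq_integral]
  refine (enorm_integral_le_lintegral_enorm _).trans ?_
  have e1 : ∫⁻ ξ, ‖starRingEnd ℂ (ft f ξ) * ft k' ξ‖ₑ
      = ∫⁻ ξ, (‖dsym a ξ‖ₑ ^ (2⁻¹ : ℝ) * ‖ft f ξ‖ₑ) * (‖dsym a ξ‖ₑ ^ (2⁻¹ : ℝ) * ‖ft k ξ‖ₑ) := by
    refine lintegral_congr_ae ?_
    filter_upwards [hasD_iff_ft.1 h] with ξ hξ
    have e : ‖dsym a ξ‖ₑ = ‖dsym a ξ‖ₑ ^ (2⁻¹ : ℝ) * ‖dsym a ξ‖ₑ ^ (2⁻¹ : ℝ) := by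
      rw [← ENNReal.rpow_add_of_nonneg _ _ (by norm_num) (by norm_num)]; norm_num
    have ec : ‖starRingEnd ℂ (ft f ξ)‖ₑ = ‖ft f ξ‖ₑ := by
      rw [← ofReal_norm, ← ofReal_norm, RCLike.norm_conj]
    rw [hξ, enorm_mul, enorm_mul, ec]
    nth_rewrite 1 [e]
    ring
  rw [e1]
  refine (ENNReal.lintegral_mul_le_Lp_mul_Lq volume Real.HolderConjugate.two_two
    (by fun_prop) (by fun_prop)).trans (le_of_eq ?_)
  have e2 : ∀ g : H, (∫⁻ ξ, (‖dsym a ξ‖ₑ ^ (2⁻¹ : ℝ) * ‖ft g ξ‖ₑ) ^ (2 : ℝ)) = halfEnergy a g := by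
    intro g
    refine lintegral_congr fun ξ => ?_
    rw [ENNReal.mul_rpow_of_nonneg _ _ (by norm_num), ← ENNReal.rpow_mul]
    norm_num
  have e2' := e2 f
  have e2'' := e2 k
  rw [e2', e2'', one_div]

theorem halfEnergy_lt_top {a : Fin 2} {k k' : H} (h : HasD a k k') : halfEnergy a k < ∞ := by
  have e : halfEnergy a k = ∫⁻ ξ, ‖starRingEnd ℂ (ft k ξ) * ft k' ξ‖ₑ := by
    refine lintegral_congr_ae ?_
    filter_upwards [hasD_iff_ft.1 h] with ξ hξ
    have ec : ‖starRingEnd ℂ (ft k ξ)‖ₑ = ‖ft k ξ‖ₑ := by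
      rw [← ofReal_norm, ← ofReal_norm, RCLike.norm_conj]
    rw [hξ, enorm_mul, enorm_mul, ec]; ring
  rw [e]
  exact (integrable_conj_mul (ft k) (ft k')).hasFiniteIntegral

/-- The symbol `sgn ξ_b` of (`i` times) the Hilbert transform in the direction `e_b`. -/
def sgnSym (b : Fin 2) (ξ : Plane) : ℂ := ((SignType.sign (ξ b) : ℝ) : ℂ)

theorem norm_sgnSym_le (b : Fin 2) (ξ : Plane) : ‖sgnSym b ξ‖ ≤ 1 := by
  rw [sgnSym, Complex.norm_real]
  rcases lt_trichotomy (ξ b) 0 with h | h | h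
  · simp [sign_neg h]
  · simp [h]
  · simp [sign_pos h]

theorem conj_sgnSym (b : Fin 2) (ξ : Plane) : starRingEnd ℂ (sgnSym b ξ) = sgnSym b ξ := by
  simp [sgnSym]

theorem measurable_sgnSym (b : Fin 2) : Measurable (sgnSym b) := by
  have h : Measurable fun r : ℝ => (SignType.sign r : ℝ) := by
    have e : (fun r : ℝ => (SignType.sign r : ℝ)) =
        fun r => if 0 < r then 1 else if r < 0 then -1 else 0 := by
      ext r
      rw [sign_apply]
      split_ifs <;> simp
    rw [e]
    exact Measurable.ite measurableSet_Ioi measurable_const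
      (Measurable.ite measurableSet_Iio measurable_const measurable_const)
  unfold sgnSym
  exact Complex.measurable_ofReal.comp (h.comp (by fun_prop))

theorem memLp_sgnSym (b : Fin 2) : MemLp (sgnSym b) ∞ volume :=
  memLp_top_of_bound (measurable_sgnSym b).aestronglyMeasurable 1
    (Filter.Eventually.of_forall (norm_sgnSym_le b))

/-- The Fourier multiplier `sgn D_b`. -/
def sgnOp (b : Fin 2) : H →L[ℂ] H := fourierMul (sgnSym b)

theorem norm_sgnOp_le (b : Fin 2) (f : H) : ‖sgnOp b f‖ ≤ ‖f‖ := by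
  simpa [sgnOp] using norm_fourierMul_le (memLp_sgnSym b)
    (Filter.Eventually.of_forall (norm_sgnSym_le b)) f

/-- The operator `sgn D_b` is self-adjoint. -/
theorem inner_sgnOp_left (b : Fin 2) (f g : H) :
    inner ℂ (sgnOp b f) g = inner ℂ f (sgnOp b g) := by
  rw [sgnOp, inner_fourierMul_left (memLp_sgnSym b)]
  simp only [conj_sgnSym]

theorem HasD.sgn {a : Fin 2} {f d : H} (h : HasD a f d) (b : Fin 2) :
    HasD a (sgnOp b f) (sgnOp b d) := h.multiplier (memLp_sgnSym b)

theorem halfEnergy_sgnOp_le (a b : Fin 2) (f : H) :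
    halfEnergy a (sgnOp b f) ≤ halfEnergy a f :=
  halfEnergy_fourierMul_le a (memLp_sgnSym b) (norm_sgnSym_le b) f

/-- `⟨S k, -i ∂_a k⟩ = ⟨|D_a| k, k⟩`. -/
theorem inner_sgnOp_deriv {a : Fin 2} {k k' : H} (h : HasD a k k') :
    (inner ℂ (sgnOp a k) k' : ℂ) = Complex.I * ((halfEnergy a k).toReal : ℂ) := by
  have hd : Measurable (dsym a) := (continuous_dsym a).measurable
  have hk := (Lp.stronglyMeasurable (ft k)).measurable
  have e : (halfEnergy a k).toReal = ∫ ξ, ‖dsym a ξ‖ * ‖ft k ξ‖ ^ 2 := by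
    rw [integral_eq_lintegral_of_nonneg_ae (Filter.Eventually.of_forall fun ξ => by positivity)
      (by fun_prop), halfEnergy]
    congr 1
    refine lintegral_congr fun ξ => ?_
    rw [ENNReal.ofReal_mul (norm_nonneg _), ENNReal.ofReal_pow (norm_nonneg _), ofReal_norm,
      ofReal_norm]
  rw [e, ← inner_ft, inner_eq_integral, ← integral_complex_ofReal, ← integral_const_mul]
  refine integral_congr_ae ?_
  filter_upwards [hasD_iff_ft.1 h, coeFn_ft_fourierMul (memLp_sgnSym a) k] with ξ h1 h2
  rw [sgnOp, h1, h2, map_mul, conj_sgnSym, norm_dsym]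
  have h3 : starRingEnd ℂ (ft k ξ) * ft k ξ = ((‖ft k ξ‖ ^ 2 : ℝ) : ℂ) := by
    rw [mul_comm, Complex.mul_conj, Complex.normSq_eq_norm_sq]
  have h4 : sgnSym a ξ * (ξ a : ℂ) = ((|ξ a| : ℝ) : ℂ) := by
    rw [sgnSym, ← sign_mul_self]; push_cast; ring
  calc sgnSym a ξ * starRingEnd ℂ (ft k ξ) * (dsym a ξ * ft k ξ)
      = 2 * Real.pi * Complex.I * (sgnSym a ξ * (ξ a : ℂ)) * (starRingEnd ℂ (ft k ξ) * ft k ξ) := by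
        rw [dsym]; ring
    _ = _ := by rw [h3, h4]; push_cast; ring

/-- Multiplication by a bounded function whose Lipschitz constant grows at most like `ρ` preserves
the order `1/2` energy, up to an `L²` error in which `ρ` is absorbed by the decay of `f`. -/
theorem exists_halfEnergy_mulOp_le : ∃ K : ℝ, 0 < K ∧ ∀ (a : Fin 2) (b : Plane → ℂ)
    (_ : MemLp b ∞ volume) (M C : ℝ) (ρ : Plane → ℝ) (f z : H), 0 ≤ M → 0 ≤ C →
    (∀ᵐ x, ‖b x‖ ≤ M) → (∀ x, 1 ≤ ρ x) →
    (∀ τ : ℝ, ∀ᵐ x, ‖b (x + τ • stdVec a) - b x‖ ≤ M * ρ x * |τ|) →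
    (∀ᵐ x, ρ x * ‖f x‖ ≤ C * ‖z x‖) →
    halfEnergy a (mulOp b f) ≤
      ENNReal.ofReal (K * M ^ 2) * (halfEnergy a f + ENNReal.ofReal (C ^ 2 * ‖z‖ ^ 2)) := by
  set P : ℝ≥0∞ := ∫⁻ τ : ℝ, ENNReal.ofReal ((1 + τ ^ 2)⁻¹) with hP
  have hPt : P ≠ ∞ := lintegral_inv_one_add_sq_lt_top.ne
  have hg0 := gagConst_pos
  have hgt := gagConst_lt_top
  set K : ℝ := 2 + 20 * (P / gagConst).toReal with hK
  have hPg : P / gagConst ≠ ∞ := ENNReal.div_ne_top hPt hg0.ne'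
  refine ⟨K, by positivity, fun a b hb M C ρ f z hM hC h1 hρ h2 h3 => ?_⟩
  have hmain : gagConst * halfEnergy a (mulOp b f) ≤
      ENNReal.ofReal (2 * M ^ 2) * (gagConst * halfEnergy a f)
        + P * ENNReal.ofReal (20 * M ^ 2 * (C ^ 2 * ‖z‖ ^ 2)) := by
    rw [← lintegral_shift_sub, ← lintegral_shift_sub, ← lintegral_const_mul' _ _
      ENNReal.ofReal_ne_top, hP, ← lintegral_mul_const' _ _ ENNReal.ofReal_ne_top,
      ← lintegral_add_right _ (by fun_prop)]
    refine lintegral_mono fun τ => ?_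
    have hz := (Lp.stronglyMeasurable z).measurable
    have hf := (Lp.stronglyMeasurable f).measurable
    have hz2 : ENNReal.ofReal (20 * M ^ 2 * (C ^ 2 * ‖z‖ ^ 2))
        = ∫⁻ x, ENNReal.ofReal (20 * M ^ 2 * C ^ 2) * ‖z x‖ₑ ^ 2 := by
      rw [lintegral_const_mul' _ _ ENNReal.ofReal_ne_top, lintegral_enorm_sq,
        ← ENNReal.ofReal_mul (by positivity)]
      congr 1; ring
    rw [hz2, ← lintegral_const_mul' _ _ ENNReal.ofReal_ne_top,
      ← lintegral_const_mul' _ _ ENNReal.ofReal_ne_top,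
      ← lintegral_const_mul' _ _ ENNReal.ofReal_ne_top,
      ← lintegral_const_mul' _ _ ENNReal.ofReal_ne_top,
      ← lintegral_add_right _ (by fun_prop)]
    refine lintegral_mono_ae ?_
    have hq := (measurePreserving_add_right (volume : Measure Plane)
      (τ • stdVec a)).quasiMeasurePreserving
    filter_upwards [coeFn_mulOp hb f, hq.ae_eq_comp (coeFn_mulOp hb f), h1, hq.ae h1, h2 τ, h3]
      with x e1 e2 e3 e4 e5 e6
    have e2' : mulOp b f (x + τ • stdVec a) = b (x + τ • stdVec a) * f (x + τ • stdVec a) := e2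
    rw [e2', e1]
    set y := x + τ • stdVec a
    simp only [← ofReal_norm]
    rw [← ENNReal.ofReal_pow (norm_nonneg _), ← ENNReal.ofReal_pow (norm_nonneg _),
      ← ENNReal.ofReal_pow (norm_nonneg _), ← ENNReal.ofReal_mul (by positivity),
      ← ENNReal.ofReal_mul (by positivity), ← ENNReal.ofReal_mul (by positivity),
      ← ENNReal.ofReal_mul (by positivity), ← ENNReal.ofReal_mul (by positivity),
      ← ENNReal.ofReal_add (by positivity) (by positivity)]
    refine ENNReal.ofReal_le_ofReal ?_
    -- Split the difference of the product; in the second part the Lipschitz bound is used for small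
    -- `τ` and the trivial bound `2 M` for large `τ`.
    have t1 : ‖b y * f y - b x * f x‖ ≤ M * ‖f y - f x‖ + ‖b y - b x‖ * ‖f x‖ := by
      have : b y * f y - b x * f x = b y * (f y - f x) + (b y - b x) * f x := by ring
      rw [this]
      refine (norm_add_le _ _).trans ?_
      rw [norm_mul, norm_mul]
      gcongr
    have t2 : ‖b y - b x‖ ≤ 2 * M := by
      linarith [norm_sub_le (b y) (b x)]
    have t3 := inv_sq_mul_sq_le (A := M * ρ x) (B := 2 * M) (norm_nonneg (b y - b x)) e5 t2
    have hρx := hρ x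
    have t4 : (M * ρ x) ^ 2 + (2 * M) ^ 2 ≤ 5 * M ^ 2 * ρ x ^ 2 := by
      nlinarith [mul_nonneg (sq_nonneg M) (by nlinarith : (0:ℝ) ≤ ρ x ^ 2 - 1)]
    have t5 : (ρ x * ‖f x‖) ^ 2 ≤ (C * ‖z x‖) ^ 2 := by
      have : 0 ≤ ρ x * ‖f x‖ := by positivity
      gcongr
    have hτ : 0 ≤ (τ ^ 2)⁻¹ := by positivity
    have hτ' : 0 ≤ (1 + τ ^ 2)⁻¹ := by positivity
    calc (τ ^ 2)⁻¹ * ‖b y * f y - b x * f x‖ ^ 2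
        ≤ (τ ^ 2)⁻¹ * (2 * (M * ‖f y - f x‖) ^ 2 + 2 * (‖b y - b x‖ * ‖f x‖) ^ 2) := by
          gcongr
          nlinarith [norm_nonneg (b y * f y - b x * f x), mul_nonneg hM (norm_nonneg (f y - f x)),
            mul_nonneg (norm_nonneg (b y - b x)) (norm_nonneg (f x)),
            sq_nonneg (M * ‖f y - f x‖ - ‖b y - b x‖ * ‖f x‖)]
      _ = 2 * M ^ 2 * ((τ ^ 2)⁻¹ * ‖f y - f x‖ ^ 2)
          + 2 * ((τ ^ 2)⁻¹ * ‖b y - b x‖ ^ 2) * ‖f x‖ ^ 2 := by ring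
      _ ≤ 2 * M ^ 2 * ((τ ^ 2)⁻¹ * ‖f y - f x‖ ^ 2)
          + 2 * (2 * (5 * M ^ 2 * ρ x ^ 2) * (1 + τ ^ 2)⁻¹) * ‖f x‖ ^ 2 := by
          have t6 : (τ ^ 2)⁻¹ * ‖b y - b x‖ ^ 2 ≤ 2 * (5 * M ^ 2 * ρ x ^ 2) * (1 + τ ^ 2)⁻¹ :=
            t3.trans (by gcongr)
          have t7 := mul_le_mul_of_nonneg_right t6 (sq_nonneg ‖f x‖)
          linarith
      _ = 2 * M ^ 2 * ((τ ^ 2)⁻¹ * ‖f y - f x‖ ^ 2)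
          + (1 + τ ^ 2)⁻¹ * (20 * M ^ 2 * (ρ x * ‖f x‖) ^ 2) := by ring
      _ ≤ 2 * M ^ 2 * ((τ ^ 2)⁻¹ * ‖f y - f x‖ ^ 2)
          + (1 + τ ^ 2)⁻¹ * (20 * M ^ 2 * (C * ‖z x‖) ^ 2) := by gcongr
      _ = _ := by ring
  have hdiv : ∀ x y : ℝ≥0∞, gagConst * x ≤ y → x ≤ y / gagConst := fun x y h => by
    rw [ENNReal.le_div_iff_mul_le (Or.inl hg0.ne') (Or.inl hgt.ne), mul_comm]; exact h
  refine (hdiv _ _ hmain).trans ?_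
  rw [ENNReal.add_div]
  have p1 : ENNReal.ofReal (2 * M ^ 2) * (gagConst * halfEnergy a f) / gagConst
      = ENNReal.ofReal (2 * M ^ 2) * halfEnergy a f := by
    rw [mul_comm gagConst, ← mul_assoc, ENNReal.mul_div_cancel_right hg0.ne' hgt.ne]
  have p2 : P * ENNReal.ofReal (20 * M ^ 2 * (C ^ 2 * ‖z‖ ^ 2)) / gagConst
      = ENNReal.ofReal (20 * (P / gagConst).toReal * M ^ 2) * ENNReal.ofReal (C ^ 2 * ‖z‖ ^ 2) := by
    rw [ENNReal.mul_div_right_comm, ← ENNReal.ofReal_mul (by positivity)]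
    nth_rewrite 1 [← ENNReal.ofReal_toReal hPg]
    rw [← ENNReal.ofReal_mul (by positivity)]
    congr 1; ring
  rw [p1, p2, mul_add]
  have hpos : 0 ≤ (P / gagConst).toReal := ENNReal.toReal_nonneg
  gcongr
  · rw [hK]; linarith
  · rw [hK]; linarith

/-! ### The weight `k` and its commutator with `sgn D` -/

/-- The weight `k(x) = 1 / (s - i x_a)`, the boundary value of a function holomorphic in a half
plane, with `|k|² = 1 / (s² + x_a²)`. -/
def wk (s : ℝ) (a : Fin 2) (x : Plane) : ℂ := ((s : ℂ) - Complex.I * (x a : ℂ))⁻¹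

theorem wk_den_ne {s : ℝ} (hs : 0 < s) (r : ℝ) : (s : ℂ) - Complex.I * (r : ℂ) ≠ 0 := by
  intro h
  have := congrArg Complex.re h
  simp at this
  exact hs.ne' this

theorem normSq_wk_den (s r : ℝ) : ‖(s : ℂ) - Complex.I * (r : ℂ)‖ ^ 2 = s ^ 2 + r ^ 2 := by
  rw [← Complex.normSq_eq_norm_sq, Complex.normSq_apply]; simp; ring

theorem norm_sq_wk (s : ℝ) (a : Fin 2) (x : Plane) :
    ‖wk s a x‖ ^ 2 = (s ^ 2 + x a ^ 2)⁻¹ := by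
  rw [wk, norm_inv, inv_pow, normSq_wk_den]

theorem conj_wk_mul_wk (s : ℝ) (a : Fin 2) (x : Plane) :
    starRingEnd ℂ (wk s a x) * wk s a x = (((s ^ 2 + x a ^ 2)⁻¹ : ℝ) : ℂ) := by
  rw [mul_comm, Complex.mul_conj, Complex.normSq_eq_norm_sq, norm_sq_wk]

theorem norm_wk_le {s : ℝ} (hs : 0 < s) (a : Fin 2) (x : Plane) : ‖wk s a x‖ ≤ s⁻¹ := by
  refine abs_le_of_sq_le_sq' ?_ (by positivity) |>.2
  rw [norm_sq_wk, inv_pow]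
  gcongr
  nlinarith [sq_nonneg (x a)]

theorem weight_mul_norm_wk_le {s : ℝ} (hs : 0 < s) (a : Fin 2) (x : Plane) :
    (1 + |x a| / s) * ‖wk s a x‖ ≤ 2 * s⁻¹ := by
  refine abs_le_of_sq_le_sq' ?_ (by positivity) |>.2
  rw [mul_pow, norm_sq_wk, ← div_eq_mul_inv, div_le_iff₀ (by positivity)]
  have e : (1 + |x a| / s) ^ 2 = (s + |x a|) ^ 2 * s⁻¹ ^ 2 := by field_simp
  rw [e]
  have h : (s + |x a|) ^ 2 ≤ 4 * (s ^ 2 + x a ^ 2) := by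
    rw [← sq_abs (x a)]; nlinarith [sq_nonneg (s - |x a|), sq_nonneg (s), sq_nonneg (|x a|)]
  calc (s + |x a|) ^ 2 * s⁻¹ ^ 2 ≤ 4 * (s ^ 2 + x a ^ 2) * s⁻¹ ^ 2 := by gcongr
    _ = _ := by ring

theorem continuous_wk {s : ℝ} (hs : 0 < s) (a : Fin 2) : Continuous (wk s a) := by
  unfold wk
  exact Continuous.inv₀ (by fun_prop) fun x => wk_den_ne hs (x a)

theorem memLp_wk {s : ℝ} (hs : 0 < s) (a : Fin 2) : MemLp (wk s a) ∞ volume :=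
  memLp_top_of_bound (continuous_wk hs a).aestronglyMeasurable s⁻¹
    (Filter.Eventually.of_forall (norm_wk_le hs a))

theorem hasTemperateGrowth_inv_one_add_sq (s : ℝ) (a : Fin 2) :
    (fun x : Plane => (1 + (x a / s) ^ 2)⁻¹).HasTemperateGrowth := by
  have h1 := Function.hasTemperateGrowth_one_add_norm_sq_rpow ℝ (-1)
  have h2 : (fun x : Plane => x a / s).HasTemperateGrowth := by
    have := (s⁻¹ • (EuclideanSpace.proj a : Plane →L[ℝ] ℝ)).hasTemperateGrowth
    have e : (fun x : Plane => x a / s) = (s⁻¹ • (EuclideanSpace.proj a : Plane →L[ℝ] ℝ)) := by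
      ext x
      simp [div_eq_inv_mul]
    rwa [e]
  have e : (fun x : Plane => (1 + (x a / s) ^ 2)⁻¹)
      = (fun r : ℝ => (1 + ‖r‖ ^ 2) ^ (-1 : ℝ)) ∘ fun x : Plane => x a / s := by
    ext x
    simp [Real.rpow_neg_one]
  rw [e]
  exact h1.comp h2

theorem hasTemperateGrowth_wk {s : ℝ} (hs : 0 < s) (a : Fin 2) :
    (wk s a).HasTemperateGrowth := by
  have h1 : (fun x : Plane => (((1 + (x a / s) ^ 2)⁻¹ : ℝ) : ℂ)).HasTemperateGrowth :=
    Complex.ofRealCLM.hasTemperateGrowth.comp (hasTemperateGrowth_inv_one_add_sq s a)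
  have h2 : (fun x : Plane => ((s : ℂ)⁻¹ + Complex.I * ((s : ℂ)⁻¹) ^ 2 * (x a : ℂ))).HasTemperateGrowth :=
    (Function.HasTemperateGrowth.const _).add
      ((Function.HasTemperateGrowth.const _).mul (hasTemperateGrowth_coord a))
  refine (congrArg Function.HasTemperateGrowth ?_).mpr (h2.mul h1)
  ext x
  have hs' : (s : ℂ) ≠ 0 := by exact_mod_cast hs.ne'
  have h3 : (1 + ((x a : ℂ) / s) ^ 2) ≠ 0 := by
    have : (0 : ℝ) < 1 + (x a / s) ^ 2 := by positivity
    exact_mod_cast this.ne'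
  have hd := wk_den_ne hs (x a)
  simp only [wk, Pi.mul_apply]
  push_cast
  rw [inv_eq_iff_eq_inv, ← div_eq_mul_inv, inv_div, eq_div_iff]
  · field_simp
    linear_combination (-(x a : ℂ)^2) * Complex.I_sq
  · intro h
    have := congrArg Complex.re h
    simp [pow_two] at this
    exact hs.ne' this

theorem stdVec_apply (a b : Fin 2) : stdVec b a = if a = b then 1 else 0 := by
  simp [stdVec]

/-- The derivative `∂_b k`. -/
def wkDeriv (s : ℝ) (a b : Fin 2) (x : Plane) : ℂ :=
  if a = b then Complex.I * wk s a x ^ 2 else 0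

theorem fderiv_wk {s : ℝ} (hs : 0 < s) (a b : Fin 2) (x : Plane) :
    fderiv ℝ (wk s a) x (stdVec b) = wkDeriv s a b x := by
  have h0 : HasFDerivAt (fun y : Plane => (s : ℂ) - Complex.I * (y a : ℂ))
      (-(Complex.I • (Complex.ofRealCLM.comp (EuclideanSpace.proj a : Plane →L[ℝ] ℝ)))) x := by
    have := ((Complex.ofRealCLM.comp (EuclideanSpace.proj a : Plane →L[ℝ] ℝ)).hasFDerivAt
      (x := x)).const_smul Complex.I
    simpa using this.const_sub (s : ℂ)
  have h1 := (hasDerivAt_inv (wk_den_ne hs (x a))).comp_hasFDerivAt_of_eq x h0 rfl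
  have h2 : fderiv ℝ (wk s a) x = _ := h1.fderiv
  rw [h2]
  simp only [wkDeriv, wk]
  split_ifs with hab
  · simp [stdVec_apply, hab, mul_comm]
  · simp [stdVec_apply, hab]

theorem norm_wkDeriv_le {s : ℝ} (hs : 0 < s) (a b : Fin 2) (x : Plane) :
    ‖wkDeriv s a b x‖ ≤ s⁻¹ ^ 2 := by
  unfold wkDeriv
  split_ifs
  · rw [norm_mul, Complex.norm_I, one_mul, norm_pow]
    gcongr
    exact norm_wk_le hs a x
  · simp; positivity

theorem memLp_wkDeriv {s : ℝ} (hs : 0 < s) (a b : Fin 2) : MemLp (wkDeriv s a b) ∞ volume := by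
  refine memLp_top_of_bound ?_ (s⁻¹ ^ 2) (Filter.Eventually.of_forall (norm_wkDeriv_le hs a b))
  unfold wkDeriv
  split_ifs
  · exact (((continuous_wk hs a).pow 2).const_mul _).aestronglyMeasurable
  · exact aestronglyMeasurable_const

theorem HasD.wk_mul {s : ℝ} (hs : 0 < s) (a b : Fin 2) {f d : H} (h : HasD b f d) :
    HasD b (mulOp (wk s a) f) (mulOp (wk s a) d + mulOp (wkDeriv s a b) f) :=
  h.mul_left (memLp_wk hs a) (memLp_wkDeriv hs a b) (hasTemperateGrowth_wk hs a) (fderiv_wk hs a b)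

theorem norm_mulOp_wk_le {s : ℝ} (hs : 0 < s) (a : Fin 2) (f : H) :
    ‖mulOp (wk s a) f‖ ≤ s⁻¹ * ‖f‖ :=
  norm_mulOp_le (memLp_wk hs a) (Filter.Eventually.of_forall (norm_wk_le hs a)) f

/-- The Laplace representation `k = ∫₀^∞ e^{-λ s} e^{iλ x_a} dλ`, in weak form. -/
theorem inner_mulOp_wk {s : ℝ} (hs : 0 < s) (a : Fin 2) (p q : H) :
    (inner ℂ p (mulOp (wk s a) q) : ℂ) = ∫ l in Ioi (0 : ℝ), (Real.exp (-(s * l)) : ℂ) *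
      inner ℂ p (mulOp (chr ((l / (2 * Real.pi)) • stdVec a)) q) := by
  have hchr : ∀ (l : ℝ) (x : Plane), chr ((l / (2 * Real.pi)) • stdVec a) x
      = Complex.exp (Complex.I * (x a : ℂ) * l) := by
    intro l x
    rw [chr, inner_smul_left, real_inner_comm, stdVec_inner]
    congr 1
    have hpi : (Real.pi : ℂ) ≠ 0 := by exact_mod_cast Real.pi_ne_zero
    push_cast
    simp
    field_simp
  have hk : ∀ x : Plane, wk s a x = ∫ l in Ioi (0 : ℝ), (Real.exp (-(s * l)) : ℂ) *
      Complex.exp (Complex.I * (x a : ℂ) * l) := by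
    intro x
    have h := integral_exp_mul_complex_Ioi (a := -((s : ℂ) - Complex.I * (x a : ℂ)))
      (by simpa using hs) 0
    rw [wk]
    simp only [Complex.ofReal_zero, mul_zero, Complex.exp_zero, neg_div_neg_eq, one_div] at h
    rw [← h]
    refine setIntegral_congr_fun measurableSet_Ioi fun l _ => ?_
    push_cast
    rw [← Complex.exp_add]; congr 1; ring
  have e1 : (inner ℂ p (mulOp (wk s a) q) : ℂ) = ∫ x, ∫ l in Ioi (0 : ℝ),
      (Real.exp (-(s * l)) : ℂ) * (Complex.exp (Complex.I * (x a : ℂ) * l) *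
        (starRingEnd ℂ (p x) * q x)) := by
    rw [inner_eq_integral]
    refine integral_congr_ae ?_
    filter_upwards [coeFn_mulOp (memLp_wk hs a) q] with x hx
    rw [hx, hk]
    simp_rw [← mul_assoc]
    rw [integral_mul_const, integral_mul_const]
    ring
  have e2 : ∀ l : ℝ, (inner ℂ p (mulOp (chr ((l / (2 * Real.pi)) • stdVec a)) q) : ℂ)
      = ∫ x, Complex.exp (Complex.I * (x a : ℂ) * l) * (starRingEnd ℂ (p x) * q x) := by
    intro l
    rw [inner_eq_integral]
    refine integral_congr_ae ?_
    filter_upwards [coeFn_mulOp (memLp_chr ((l / (2 * Real.pi)) • stdVec a)) q] with x hx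
    rw [hx, hchr]; ring
  simp_rw [e2]
  rw [e1, integral_integral_swap]
  · simp_rw [integral_const_mul]
  · have hexp : Integrable (fun l : ℝ => (Real.exp (-(s * l)) : ℂ))
        (volume.restrict (Ioi 0)) := by
      have h := (exp_neg_integrableOn_Ioi 0 hs).ofReal (𝕜 := ℂ)
      simpa [neg_mul] using h
    have hp := ((integrable_conj_mul p q).mul_prod hexp)
    refine (hp.bdd_mul (c := 1) (f := fun z : Plane × ℝ =>
      Complex.exp (Complex.I * (z.1 a : ℂ) * z.2)) ?_ ?_).congr ?_
    · exact (by fun_prop : Continuous fun z : Plane × ℝ =>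
        Complex.exp (Complex.I * (z.1 a : ℂ) * z.2)).aestronglyMeasurable
    · refine Filter.Eventually.of_forall fun z => ?_
      rw [Complex.norm_exp]; simp
    · refine Filter.Eventually.of_forall fun z => ?_
      simp only [Function.uncurry]; ring

/-- The sign changes under a translation by `h` only where `|ξ_a| ≤ |h|`; this is where the commutator
with `sgn D_b` gains a derivative. -/
theorem norm_dsym_mul_sgn_sub_le (a b : Fin 2) {l : ℝ} (hl : 0 ≤ l) (ξ : Plane) :
    ‖starRingEnd ℂ (dsym a ξ) *
      (sgnSym b ξ - sgnSym b (ξ + -((l / (2 * Real.pi)) • stdVec a)))‖ ≤ 2 * l := by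
  have hpi := Real.pi_pos
  have hb : (ξ + -((l / (2 * Real.pi)) • stdVec a)) b
      = ξ b - (l / (2 * Real.pi)) * (if b = a then 1 else 0) := by
    simp [stdVec_apply]; ring
  rw [norm_mul, RCLike.norm_conj, norm_dsym]
  have h2 : ‖sgnSym b ξ - sgnSym b (ξ + -((l / (2 * Real.pi)) • stdVec a))‖ ≤ 2 :=
    (norm_sub_le _ _).trans ((add_le_add (norm_sgnSym_le b ξ) (norm_sgnSym_le b _)).trans_eq
      (by norm_num))
  by_cases hab : b = a
  · subst hab
    rw [if_pos rfl, mul_one] at hb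
    by_cases hξ : |ξ b| ≤ l / (2 * Real.pi)
    · calc 2 * Real.pi * |ξ b| * _ ≤ 2 * Real.pi * (l / (2 * Real.pi)) * 2 := by gcongr
        _ = 2 * l := by field_simp
    · push Not at hξ
      have hl' : 0 ≤ l / (2 * Real.pi) := by positivity
      have : sgnSym b ξ = sgnSym b (ξ + -((l / (2 * Real.pi)) • stdVec b)) := by
        rw [sgnSym, sgnSym, hb]
        rcases lt_abs.1 hξ with h | h
        · rw [sign_pos (by linarith), sign_pos (by linarith)]
        · rw [sign_neg (by linarith), sign_neg (by linarith)]
      rw [this, sub_self]; simp; positivity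
  · rw [if_neg hab, mul_zero, sub_zero] at hb
    have : sgnSym b ξ = sgnSym b (ξ + -((l / (2 * Real.pi)) • stdVec a)) := by
      rw [sgnSym, sgnSym, hb]
    rw [this, sub_self]; simp; positivity

theorem integral_mul_exp_neg {s : ℝ} (hs : 0 < s) :
    ∫ l in Ioi (0 : ℝ), Real.exp (-(s * l)) * (2 * l) = 2 * s⁻¹ ^ 2 := by
  have h := Real.integral_rpow_mul_exp_neg_mul_Ioi (a := 2) (by norm_num) hs
  have h2 : Real.Gamma 2 = 1 := by simp
  rw [h2] at h
  have e : ∀ l : ℝ, Real.exp (-(s * l)) * (2 * l)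
      = 2 * (l ^ ((2 : ℝ) - 1) * Real.exp (-(s * l))) := by
    intro l; norm_num; ring
  simp_rw [e]
  rw [integral_const_mul, h]
  norm_num

/-- The commutator `[sgn D_b, k]` gains one derivative in the direction `e_a`. -/
theorem norm_inner_deriv_comm_le {s : ℝ} (hs : 0 < s) (a b : Fin 2) {ψ ψ' : H}
    (h : HasD a ψ ψ') (f : H) :
    ‖(inner ℂ ψ' (sgnOp b (mulOp (wk s a) f) - mulOp (wk s a) (sgnOp b f)) : ℂ)‖
      ≤ 2 * s⁻¹ ^ 2 * (‖ψ‖ * ‖f‖) := by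
  set v : ℝ → Plane := fun l => (l / (2 * Real.pi)) • stdVec a with hv
  have hexp : Integrable (fun l : ℝ => (Real.exp (-(s * l)) : ℂ))
      (volume.restrict (Ioi 0)) := by
    have h := (exp_neg_integrableOn_Ioi 0 hs).ofReal (𝕜 := ℂ)
    simpa [neg_mul] using h
  have hcont : ∀ p q : H, Measurable fun l : ℝ => (inner ℂ p (mulOp (chr (v l)) q) : ℂ) := by
    intro p q
    have e : (fun l : ℝ => (inner ℂ p (mulOp (chr (v l)) q) : ℂ))
        = fun l => ∫ x, starRingEnd ℂ (p x) * (chr (v l) x * q x) := by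
      ext l
      rw [inner_eq_integral]
      refine integral_congr_ae ?_
      filter_upwards [coeFn_mulOp (memLp_chr (v l)) q] with x hx
      rw [hx]
    rw [e]
    have hp := (Lp.stronglyMeasurable p).measurable
    have hq := (Lp.stronglyMeasurable q).measurable
    have hc : Measurable fun z : ℝ × Plane => chr (v z.1) z.2 := by
      refine (continuous_chr.comp (g := fun p : Plane × Plane => chr p.1 p.2)
        (f := fun z : ℝ × Plane => (v z.1, z.2)) ?_).measurable
      simp only [hv]; fun_prop
    have hm : StronglyMeasurable fun z : ℝ × Plane =>
        starRingEnd ℂ (p z.2) * (chr (v z.1) z.2 * q z.2) := by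
      refine Measurable.stronglyMeasurable ?_
      exact ((Complex.continuous_conj.measurable.comp (hp.comp measurable_snd))).mul
        (hc.mul (hq.comp measurable_snd))
    exact hm.integral_prod_right.measurable
  have hint : ∀ p q : H, Integrable (fun l : ℝ => (Real.exp (-(s * l)) : ℂ) *
      inner ℂ p (mulOp (chr (v l)) q)) (volume.restrict (Ioi 0)) := by
    intro p q
    refine hexp.mul_bdd (c := ‖p‖ * ‖q‖) (hcont p q).aestronglyMeasurable
      (Filter.Eventually.of_forall fun l => ?_)
    refine (norm_inner_le_norm _ _).trans ?_
    gcongr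
    simpa using norm_mulOp_le (memLp_chr (v l)) (C := 1)
      (Filter.Eventually.of_forall fun x => (norm_chr (v l) x).le) q
  have e1 : (inner ℂ ψ' (sgnOp b (mulOp (wk s a) f) - mulOp (wk s a) (sgnOp b f)) : ℂ)
      = ∫ l in Ioi (0 : ℝ), (Real.exp (-(s * l)) : ℂ) *
        (inner ℂ (sgnOp b ψ') (mulOp (chr (v l)) f) - inner ℂ ψ' (mulOp (chr (v l)) (sgnOp b f))) := by
    rw [inner_sub_right, ← inner_sgnOp_left, inner_mulOp_wk hs, inner_mulOp_wk hs,
      ← integral_sub (hint _ _) (hint _ _)]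
    refine integral_congr_ae (Filter.Eventually.of_forall fun l => ?_)
    simp only [hv]; ring
  have e2 : ∀ l ∈ Ioi (0 : ℝ), ‖(inner ℂ (sgnOp b ψ') (mulOp (chr (v l)) f)
      - inner ℂ ψ' (mulOp (chr (v l)) (sgnOp b f)) : ℂ)‖ ≤ 2 * l * (‖ψ‖ * ‖f‖) := by
    intro l hl
    have hl0 : (0 : ℝ) ≤ l := le_of_lt hl
    -- Modulation by `e^{iλ x_a}` translates frequencies by `λ / 2π`, so on the Fourier side the
    -- commutator of the modulation with `sgn D_b` is multiplication by a difference of signs.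
    set m : Plane → ℂ := fun ξ => starRingEnd ℂ (dsym a ξ) *
      (sgnSym b ξ - sgnSym b (ξ + -(v l))) with hm
    have hmb : ∀ ξ, ‖m ξ‖ ≤ 2 * l := fun ξ => norm_dsym_mul_sgn_sub_le a b hl0 ξ
    have hmm : MemLp m ∞ volume := by
      refine memLp_top_of_bound (Measurable.aestronglyMeasurable ?_) (2 * l)
        (Filter.Eventually.of_forall hmb)
      exact (Complex.continuous_conj.measurable.comp (continuous_dsym a).measurable).mul
        ((measurable_sgnSym b).sub ((measurable_sgnSym b).comp (measurable_id.add_const _)))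
    have e3 : (inner ℂ (sgnOp b ψ') (mulOp (chr (v l)) f)
        - inner ℂ ψ' (mulOp (chr (v l)) (sgnOp b f)) : ℂ)
        = inner ℂ (ft ψ) (mulOp m (shift (-(v l)) (ft f))) := by
      rw [inner_sgnOp_left, ← inner_sub_right, ← inner_ft, inner_eq_integral, inner_eq_integral]
      refine integral_congr_ae ?_
      have hq := (measurePreserving_add_right (volume : Measure Plane)
        (-(v l))).quasiMeasurePreserving.ae_eq_comp (coeFn_ft_fourierMul (memLp_sgnSym b) f)
      rw [map_sub, sgnOp, ft_fourierMul, ft_mulOp_chr, ft_mulOp_chr]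
      filter_upwards [Lp.coeFn_sub (mulOp (sgnSym b) (shift (-(v l)) (ft f)))
          (shift (-(v l)) (ft (fourierMul (sgnSym b) f))),
        coeFn_mulOp (memLp_sgnSym b) (shift (-(v l)) (ft f)),
        coeFn_shift (-(v l)) (ft (fourierMul (sgnSym b) f)),
        coeFn_shift (-(v l)) (ft f), hq, hasD_iff_ft.1 h,
        coeFn_mulOp hmm (shift (-(v l)) (ft f))] with ξ g1 g2 g3 g4 g5 g6 g7
      have g5' : ft (fourierMul (sgnSym b) f) (ξ + -(v l))
        = sgnSym b (ξ + -(v l)) * ft f (ξ + -(v l)) := g5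
      rw [g1, Pi.sub_apply, g2, g3, g5', g6, g7, g4, map_mul]
      simp only [hm]; ring
    rw [e3]
    refine (norm_inner_le_norm _ _).trans ?_
    rw [norm_ft]
    have := norm_mulOp_le hmm (Filter.Eventually.of_forall hmb) (shift (-(v l)) (ft f))
    rw [(shift (-(v l))).norm_map, norm_ft] at this
    calc ‖ψ‖ * _ ≤ ‖ψ‖ * (2 * l * ‖f‖) := by gcongr
      _ = _ := by ring
  rw [e1]
  have hfin : Integrable (fun l : ℝ => Real.exp (-(s * l)) * (2 * l) * (‖ψ‖ * ‖f‖))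
      (volume.restrict (Ioi 0)) := by
    refine Integrable.mul_const ?_ _
    by_contra hcon
    have := integral_mul_exp_neg hs
    rw [integral_undef hcon] at this
    have : 0 < 2 * s⁻¹ ^ 2 := by positivity
    linarith
  refine (norm_integral_le_of_norm_le hfin ?_).trans (le_of_eq ?_)
  · filter_upwards [ae_restrict_mem measurableSet_Ioi] with l hl
    rw [norm_mul, Complex.norm_real, Real.norm_of_nonneg (Real.exp_pos _).le, mul_assoc]
    gcongr
    exact e2 l hl
  · rw [integral_mul_const, integral_mul_exp_neg hs]

theorem norm_comm_le {s : ℝ} (hs : 0 < s) (a b : Fin 2) (f : H) :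
    ‖sgnOp b (mulOp (wk s a) f) - mulOp (wk s a) (sgnOp b f)‖ ≤ 2 * s⁻¹ * ‖f‖ := by
  refine (norm_sub_le _ _).trans ?_
  have h1 := (norm_sgnOp_le b (mulOp (wk s a) f)).trans (norm_mulOp_wk_le hs a f)
  have h2 := (norm_mulOp_wk_le hs a (sgnOp b f)).trans
    (mul_le_mul_of_nonneg_left (norm_sgnOp_le b f) (inv_pos.2 hs).le)
  linarith

/-- If `∂_a g` is bounded on `L²`, in weak form, then testing with `ψ = sgn(D_a) g`, truncated in
frequency, bounds `⟨|D_a| g, g⟩`. -/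
theorem halfEnergy_le_of_inner_deriv_le (a : Fin 2) (g : H) {C : ℝ} (hC0 : 0 ≤ C)
    (h : ∀ ψ ψ' : H, HasD a ψ ψ' → ‖(inner ℂ ψ' g : ℂ)‖ ≤ C * ‖ψ‖) :
    halfEnergy a g ≤ ENNReal.ofReal (C * ‖g‖) := by
  have hd : Measurable (dsym a) := (continuous_dsym a).measurable
  have hg := (Lp.stronglyMeasurable (ft g)).measurable
  set B : ℕ → Set Plane := fun n => {ξ | |ξ a| ≤ n} with hB
  have hBm : ∀ n, MeasurableSet (B n) := fun n =>
    measurableSet_le (by fun_prop) measurable_const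
  have hmono : Monotone B := fun n m hnm ξ hξ =>
    show |ξ a| ≤ (m : ℝ) from le_trans hξ (Nat.cast_le.2 hnm)
  have hunion : ⋃ n, B n = univ := by
    refine eq_univ_of_forall fun ξ => ?_
    obtain ⟨n, hn⟩ := exists_nat_ge |ξ a|
    exact mem_iUnion.2 ⟨n, hn⟩
  -- The truncation to `|ξ_a| ≤ n` makes `∂_a sgn D_a` a bounded multiplier.
  rw [halfEnergy, ← setLIntegral_univ, ← hunion,
    setLIntegral_iUnion_of_directed _ hmono.directed_le]
  refine iSup_le fun n => ?_
  set σ : Plane → ℂ := (B n).indicator (sgnSym a) with hσ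
  set τ : Plane → ℂ := fun ξ => dsym a ξ * σ ξ with hτ
  have hσ1 : ∀ ξ, ‖σ ξ‖ ≤ 1 := fun ξ =>
    (norm_indicator_le_norm_self _ _).trans (norm_sgnSym_le a ξ)
  have hσm : MemLp σ ∞ volume := memLp_top_of_bound
    ((measurable_sgnSym a).indicator (hBm n)).aestronglyMeasurable 1
    (Filter.Eventually.of_forall hσ1)
  have hτm : MemLp τ ∞ volume := by
    refine memLp_top_of_bound
      (hd.mul ((measurable_sgnSym a).indicator (hBm n))).aestronglyMeasurable (2 * Real.pi * n)
      (Filter.Eventually.of_forall fun ξ => ?_)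
    by_cases hξ : ξ ∈ B n
    · have hξ' : |ξ a| ≤ n := hξ
      have h1 := hσ1 ξ
      simp only [hτ]
      rw [norm_mul, norm_dsym]
      calc 2 * Real.pi * |ξ a| * ‖σ ξ‖ ≤ 2 * Real.pi * n * 1 := by
            have := Real.pi_pos
            gcongr
        _ = _ := mul_one _
    · simp only [hτ, hσ, indicator_of_notMem hξ, mul_zero, norm_zero]
      have := Real.pi_pos
      positivity
  have hder := hasD_fourierMul_of_symbol hσm hτm (fun ξ => rfl) g
  have hbound := h _ _ hder
  have hnorm : ‖fourierMul σ g‖ ≤ ‖g‖ := by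
    simpa using norm_fourierMul_le hσm (Filter.Eventually.of_forall hσ1) g
  have e : (inner ℂ (fourierMul τ g) g : ℂ)
      = -Complex.I * ((∫ ξ in B n, ‖dsym a ξ‖ * ‖ft g ξ‖ ^ 2 : ℝ) : ℂ) := by
    rw [← inner_ft, inner_eq_integral, ← integral_complex_ofReal, ← integral_const_mul,
      ← integral_indicator (hBm n)]
    refine integral_congr_ae ?_
    filter_upwards [coeFn_ft_fourierMul hτm g] with ξ hξ
    rw [hξ, map_mul]
    simp only [hτ, hσ, map_mul]
    by_cases hm : ξ ∈ B n
    · rw [indicator_of_mem hm, indicator_of_mem hm, conj_sgnSym, norm_dsym]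
      have h3 : starRingEnd ℂ (ft g ξ) * ft g ξ = ((‖ft g ξ‖ ^ 2 : ℝ) : ℂ) := by
        rw [mul_comm, Complex.mul_conj, Complex.normSq_eq_norm_sq]
      have h4 : sgnSym a ξ * (ξ a : ℂ) = ((|ξ a| : ℝ) : ℂ) := by
        rw [sgnSym, ← sign_mul_self]; push_cast; ring
      calc starRingEnd ℂ (dsym a ξ) * sgnSym a ξ * starRingEnd ℂ (ft g ξ) * ft g ξ
          = - (2 * Real.pi * Complex.I * (sgnSym a ξ * (ξ a : ℂ))
            * (starRingEnd ℂ (ft g ξ) * ft g ξ)) := by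
            rw [conj_dsym, dsym]; ring
        _ = _ := by rw [h3, h4]; push_cast; ring
    · rw [indicator_of_notMem hm, indicator_of_notMem hm]; simp
  have hint0 : 0 ≤ ∫ ξ in B n, ‖dsym a ξ‖ * ‖ft g ξ‖ ^ 2 :=
    integral_nonneg fun ξ => by positivity
  rw [e, norm_mul, norm_neg, Complex.norm_I, one_mul, Complex.norm_real,
    Real.norm_of_nonneg hint0] at hbound
  have hintg : Integrable (fun ξ => ‖dsym a ξ‖ * ‖ft g ξ‖ ^ 2) (volume.restrict (B n)) := by
    have hsq : Integrable (fun ξ => ‖ft g ξ‖ ^ 2) (volume.restrict (B n)) :=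
      ((Lp.memLp (ft g)).integrable_norm_pow (by norm_num)).restrict
    refine hsq.bdd_mul (c := 2 * Real.pi * n) (by fun_prop) ?_
    filter_upwards [ae_restrict_mem (hBm n)] with ξ hξ
    have hξ' : |ξ a| ≤ n := hξ
    rw [norm_norm, norm_dsym]
    have := Real.pi_pos
    gcongr
  calc ∫⁻ ξ in B n, ‖dsym a ξ‖ₑ * ‖ft g ξ‖ₑ ^ 2
      = ENNReal.ofReal (∫ ξ in B n, ‖dsym a ξ‖ * ‖ft g ξ‖ ^ 2) := by
        rw [ofReal_integral_eq_lintegral_ofReal hintg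
          (Filter.Eventually.of_forall fun ξ => by positivity)]
        refine lintegral_congr fun ξ => ?_
        rw [ENNReal.ofReal_mul (norm_nonneg _), ENNReal.ofReal_pow (norm_nonneg _), ofReal_norm,
          ofReal_norm]
    _ ≤ ENNReal.ofReal (C * ‖g‖) := by
        refine ENNReal.ofReal_le_ofReal (hbound.trans ?_)
        gcongr

/-- The gain of one derivative in `norm_inner_deriv_comm_le`, expressed through `halfEnergy`. -/
theorem halfEnergy_comm_le {s : ℝ} (hs : 0 < s) (a b : Fin 2) (f : H) :
    halfEnergy a (sgnOp b (mulOp (wk s a) f) - mulOp (wk s a) (sgnOp b f))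
      ≤ ENNReal.ofReal (4 * s⁻¹ ^ 3 * ‖f‖ ^ 2) := by
  refine (halfEnergy_le_of_inner_deriv_le a _ (C := 2 * s⁻¹ ^ 2 * ‖f‖) (by positivity) fun ψ ψ' h => ?_).trans ?_
  · refine (norm_inner_deriv_comm_le hs a b h f).trans (le_of_eq (by ring))
  · refine ENNReal.ofReal_le_ofReal ?_
    calc 2 * s⁻¹ ^ 2 * ‖f‖ * _ ≤ 2 * s⁻¹ ^ 2 * ‖f‖ * (2 * s⁻¹ * ‖f‖) := by
          gcongr
          exact norm_comm_le hs a b f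
      _ = _ := by ring

/-! ### The local smoothing functional -/

/-- The bounded weight `θ = arctan (x_a / s)`, with `∂_a θ = s |k|²`. -/
def th (s : ℝ) (a : Fin 2) (x : Plane) : ℂ := (Real.arctan (x a / s) : ℂ)

/-- The derivative `∂_b θ`. -/
def thDeriv (s : ℝ) (a b : Fin 2) (x : Plane) : ℂ :=
  if a = b then ((s * (s ^ 2 + x a ^ 2)⁻¹ : ℝ) : ℂ) else 0

theorem norm_th_le (s : ℝ) (a : Fin 2) (x : Plane) : ‖th s a x‖ ≤ 2 := by
  rw [th, Complex.norm_real, Real.norm_eq_abs, abs_le]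
  have h1 := Real.neg_pi_div_two_lt_arctan (x a / s)
  have h2 := Real.arctan_lt_pi_div_two (x a / s)
  have h3 := Real.pi_lt_four
  constructor <;> linarith

theorem conj_th (s : ℝ) (a : Fin 2) (x : Plane) : starRingEnd ℂ (th s a x) = th s a x :=
  Complex.conj_ofReal _

theorem measurable_th (s : ℝ) (a : Fin 2) : Measurable (th s a) :=
  Complex.measurable_ofReal.comp (Real.measurable_arctan.comp (by fun_prop))

theorem memLp_th (s : ℝ) (a : Fin 2) : MemLp (th s a) ∞ volume :=
  memLp_top_of_bound (measurable_th s a).aestronglyMeasurable 2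
    (Filter.Eventually.of_forall (norm_th_le s a))

theorem abs_arctan_sub_le (y z : ℝ) : |Real.arctan y - Real.arctan z| ≤ |y - z| := by
  have h := Convex.norm_image_sub_le_of_norm_deriv_le (f := Real.arctan) (C := 1) (s := univ)
    (x := z) (y := y) (fun x _ => Real.differentiableAt_arctan x) (fun x _ => ?_) convex_univ
    (mem_univ _) (mem_univ _)
  · simpa using h
  · rw [Real.deriv_arctan, Real.norm_of_nonneg (by positivity)]
    rw [div_le_one (by positivity)]
    nlinarith [sq_nonneg x]

theorem hasTemperateGrowth_arctan : Real.arctan.HasTemperateGrowth := by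
  have hd : fderiv ℝ Real.arctan = fun y : ℝ =>
      ((1 + ‖y‖ ^ 2) ^ (-1 : ℝ)) • (1 : ℝ →L[ℝ] ℝ) := by
    ext y
    simp [Real.rpow_neg_one]
  refine Function.HasTemperateGrowth.of_fderiv (k := 0) (C := 2) ?_
    Real.differentiable_arctan fun y => ?_
  · rw [hd]
    exact Function.HasTemperateGrowth.smul
      (Function.hasTemperateGrowth_one_add_norm_sq_rpow ℝ (-1))
      (Function.HasTemperateGrowth.const _)
  · have h1 := Real.neg_pi_div_two_lt_arctan y
    have h2 := Real.arctan_lt_pi_div_two y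
    have h3 := Real.pi_lt_four
    rw [Real.norm_eq_abs, pow_zero, mul_one, abs_le]
    constructor <;> linarith

theorem hasTemperateGrowth_th (s : ℝ) (a : Fin 2) : (th s a).HasTemperateGrowth := by
  have h2 : (fun x : Plane => x a / s).HasTemperateGrowth := by
    have := (s⁻¹ • (EuclideanSpace.proj a : Plane →L[ℝ] ℝ)).hasTemperateGrowth
    have e : (fun x : Plane => x a / s) = (s⁻¹ • (EuclideanSpace.proj a : Plane →L[ℝ] ℝ)) := by
      ext x
      simp [div_eq_inv_mul]
    rwa [e]
  exact Complex.ofRealCLM.hasTemperateGrowth.comp (hasTemperateGrowth_arctan.comp h2)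

theorem fderiv_th {s : ℝ} (hs : 0 < s) (a b : Fin 2) (x : Plane) :
    fderiv ℝ (th s a) x (stdVec b) = thDeriv s a b x := by
  have h0 : HasFDerivAt (fun y : Plane => y a / s)
      (s⁻¹ • (EuclideanSpace.proj a : Plane →L[ℝ] ℝ)) x := by
    have := (s⁻¹ • (EuclideanSpace.proj a : Plane →L[ℝ] ℝ)).hasFDerivAt (x := x)
    refine this.congr_of_eventuallyEq (Filter.Eventually.of_forall fun y => ?_)
    simp [div_eq_inv_mul]
  have h1 := (Complex.ofRealCLM.hasFDerivAt).comp x (h0.arctan)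
  have h2 : fderiv ℝ (th s a) x = _ := h1.fderiv
  rw [h2]
  simp only [thDeriv]
  split_ifs with hab
  · subst hab
    simp [stdVec_apply]
    have h3 : (1 + ((x a : ℂ) / s) ^ 2) ≠ 0 := by
      have : (0 : ℝ) < 1 + (x a / s) ^ 2 := by positivity
      exact_mod_cast this.ne'
    have h4 : ((s : ℂ) ^ 2 + (x a : ℂ) ^ 2) ≠ 0 := by
      have : (0 : ℝ) < s ^ 2 + (x a) ^ 2 := by positivity
      exact_mod_cast this.ne'
    have hs' : (s : ℂ) ≠ 0 := by exact_mod_cast hs.ne'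
    field_simp
  · simp [stdVec_apply, hab]

theorem norm_thDeriv_le {s : ℝ} (hs : 0 < s) (a b : Fin 2) (x : Plane) :
    ‖thDeriv s a b x‖ ≤ s⁻¹ := by
  unfold thDeriv
  split_ifs
  · rw [Complex.norm_real, Real.norm_of_nonneg (by positivity), ← div_eq_mul_inv, inv_eq_one_div,
      div_le_div_iff₀ (by positivity) hs]
    nlinarith [sq_nonneg (x a)]
  · simp; positivity

theorem memLp_thDeriv {s : ℝ} (hs : 0 < s) (a b : Fin 2) : MemLp (thDeriv s a b) ∞ volume := by
  refine memLp_top_of_bound ?_ s⁻¹ (Filter.Eventually.of_forall (norm_thDeriv_le hs a b))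
  refine Measurable.aestronglyMeasurable ?_
  unfold thDeriv
  split_ifs
  · fun_prop
  · exact measurable_const

theorem HasD.th_mul {s : ℝ} (hs : 0 < s) (a b : Fin 2) {f d : H} (h : HasD b f d) :
    HasD b (mulOp (th s a) f) (mulOp (th s a) d + mulOp (thDeriv s a b) f) :=
  h.mul_left (memLp_th s a) (memLp_thDeriv hs a b) (hasTemperateGrowth_th s a) (fderiv_th hs a b)

theorem norm_mulOp_th_le (s : ℝ) (a : Fin 2) (f : H) : ‖mulOp (th s a) f‖ ≤ 2 * ‖f‖ :=
  norm_mulOp_le (memLp_th s a) (Filter.Eventually.of_forall (norm_th_le s a)) f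

theorem inner_mulOp_th_left (s : ℝ) (a : Fin 2) (f g : H) :
    (inner ℂ (mulOp (th s a) f) g : ℂ) = inner ℂ f (mulOp (th s a) g) := by
  rw [inner_mulOp_left (memLp_th s a)]
  simp only [conj_th]

/-- The local smoothing functional `s ⟨|D_a| k u, k u⟩ + s⁻¹ ‖u‖²`: it controls half a derivative
of `u` in the direction `e_a` on the region `|x_a| ≲ s`. -/
def smoothing (s : ℝ) (a : Fin 2) (u : H) : ℝ≥0∞ :=
  ENNReal.ofReal s * halfEnergy a (mulOp (wk s a) u) + ENNReal.ofReal (s⁻¹ * ‖u‖ ^ 2)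

theorem smoothing_lt_top {s : ℝ} (hs : 0 < s) {a : Fin 2} {u d : H} (h : HasD a u d) :
    smoothing s a u < ∞ :=
  ENNReal.add_lt_top.2 ⟨ENNReal.mul_lt_top ENNReal.ofReal_lt_top
    (halfEnergy_lt_top (h.wk_mul hs a a)), ENNReal.ofReal_lt_top⟩

theorem norm_add_sq_le_two (u v : H) : ‖u + v‖ ^ 2 ≤ 2 * ‖u‖ ^ 2 + 2 * ‖v‖ ^ 2 := by
  nlinarith [norm_add_le u v, norm_nonneg (u + v), sq_nonneg (‖u‖ - ‖v‖), norm_nonneg u,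
    norm_nonneg v]

theorem ofReal_le_two_mul_add {x y z : ℝ} (hx : 0 ≤ x) (hy : 0 ≤ y) (h : z ≤ 2 * x + 2 * y) :
    ENNReal.ofReal z ≤ 2 * ENNReal.ofReal x + 2 * ENNReal.ofReal y := by
  have e : (2 : ℝ≥0∞) = ENNReal.ofReal 2 := by simp
  rw [e, ← ENNReal.ofReal_mul (by norm_num), ← ENNReal.ofReal_mul (by norm_num),
    ← ENNReal.ofReal_add (by positivity) (by positivity)]
  exact ENNReal.ofReal_le_ofReal h

theorem smoothing_add_le {s : ℝ} (hs : 0 < s) (a : Fin 2) (u v : H) :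
    smoothing s a (u + v) ≤ 2 * smoothing s a u + 2 * smoothing s a v := by
  have h1 : ENNReal.ofReal (s⁻¹ * ‖u + v‖ ^ 2)
      ≤ 2 * ENNReal.ofReal (s⁻¹ * ‖u‖ ^ 2) + 2 * ENNReal.ofReal (s⁻¹ * ‖v‖ ^ 2) := by
    refine ofReal_le_two_mul_add (by positivity) (by positivity) ?_
    have := mul_le_mul_of_nonneg_left (norm_add_sq_le_two u v) (inv_pos.2 hs).le
    linarith
  calc smoothing s a (u + v)
      ≤ ENNReal.ofReal s * (2 * halfEnergy a (mulOp (wk s a) u)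
        + 2 * halfEnergy a (mulOp (wk s a) v)) + (2 * ENNReal.ofReal (s⁻¹ * ‖u‖ ^ 2)
          + 2 * ENNReal.ofReal (s⁻¹ * ‖v‖ ^ 2)) := by
        rw [smoothing, map_add]
        gcongr
        exact halfEnergy_add_le _ _ _
    _ = _ := by rw [smoothing, smoothing]; ring

theorem smoothing_smul (s : ℝ) (a : Fin 2) (c : ℂ) (u : H) :
    smoothing s a (c • u) = ENNReal.ofReal (‖c‖ ^ 2) * smoothing s a u := by
  have h1 : ENNReal.ofReal (s⁻¹ * ‖c • u‖ ^ 2)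
      = ENNReal.ofReal (‖c‖ ^ 2) * ENNReal.ofReal (s⁻¹ * ‖u‖ ^ 2) := by
    rw [norm_smul, ← ENNReal.ofReal_mul (by positivity)]; congr 1; ring
  rw [smoothing, smoothing, map_smul, halfEnergy_smul, h1]; ring

/-- A bound on `k z` in the energy of order `1/2`, modulo `‖u‖²`, gives a bound on `smoothing`. -/
theorem smoothing_le_of_le {s : ℝ} (hs : 1 ≤ s) (a : Fin 2) {u z : H} {A B : ℝ} (hA : 0 ≤ A)
    (hz : ‖z‖ ≤ B * ‖u‖)
    (h : halfEnergy a (mulOp (wk s a) z) ≤ ENNReal.ofReal A *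
      (halfEnergy a (mulOp (wk s a) u) + ENNReal.ofReal (s⁻¹ ^ 2 * ‖u‖ ^ 2))) :
    smoothing s a z ≤ ENNReal.ofReal (A + B ^ 2) * smoothing s a u := by
  have hs0 : 0 < s := by linarith
  have e1 : ENNReal.ofReal s * ENNReal.ofReal (s⁻¹ ^ 2 * ‖u‖ ^ 2)
      = ENNReal.ofReal (s⁻¹ * ‖u‖ ^ 2) := by
    rw [← ENNReal.ofReal_mul hs0.le]; congr 1; field_simp
  have e2 : ENNReal.ofReal (s⁻¹ * ‖z‖ ^ 2)
      ≤ ENNReal.ofReal (B ^ 2) * ENNReal.ofReal (s⁻¹ * ‖u‖ ^ 2) := by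
    rw [← ENNReal.ofReal_mul (by positivity)]
    refine ENNReal.ofReal_le_ofReal ?_
    calc s⁻¹ * ‖z‖ ^ 2 ≤ s⁻¹ * (B * ‖u‖) ^ 2 := by gcongr
      _ = _ := by ring
  calc smoothing s a z ≤ ENNReal.ofReal s * (ENNReal.ofReal A *
      (halfEnergy a (mulOp (wk s a) u) + ENNReal.ofReal (s⁻¹ ^ 2 * ‖u‖ ^ 2)))
        + ENNReal.ofReal (B ^ 2) * ENNReal.ofReal (s⁻¹ * ‖u‖ ^ 2) := by
        rw [smoothing]; gcongr
    _ = ENNReal.ofReal A * smoothing s a u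
        + ENNReal.ofReal (B ^ 2) * ENNReal.ofReal (s⁻¹ * ‖u‖ ^ 2) := by
        rw [smoothing, ← e1]; ring
    _ ≤ ENNReal.ofReal A * smoothing s a u + ENNReal.ofReal (B ^ 2) * smoothing s a u := by
        gcongr
        exact le_add_self
    _ = _ := by rw [← add_mul, ENNReal.ofReal_add hA (by positivity)]

theorem mulOp_comm {b c : Plane → ℂ} (hb : MemLp b ∞ volume) (hc : MemLp c ∞ volume) (f : H) :
    mulOp b (mulOp c f) = mulOp c (mulOp b f) := by
  rw [mulOp_mulOp hb hc, mulOp_mulOp hc hb]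
  simp only [mul_comm]

/-- The smoothing functional is stable under `sgn D_b`, since `[sgn D_b, k]` is of lower order. -/
theorem smoothing_sgnOp_le {s : ℝ} (hs : 1 ≤ s) (a b : Fin 2) (u : H) :
    smoothing s a (sgnOp b u) ≤ ENNReal.ofReal 9 * smoothing s a u := by
  have hs0 : 0 < s := by linarith
  have h := smoothing_le_of_le hs a (u := u) (z := sgnOp b u) (A := 8) (B := 1) (by norm_num)
    (by simpa using norm_sgnOp_le b u) ?_
  · norm_num at h ⊢; exact h
  set K := sgnOp b (mulOp (wk s a) u) - mulOp (wk s a) (sgnOp b u) with hK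
  have e : mulOp (wk s a) (sgnOp b u) = sgnOp b (mulOp (wk s a) u) + (-1 : ℂ) • K := by
    rw [hK]; module
  rw [e]
  refine (halfEnergy_add_le _ _ _).trans ?_
  rw [halfEnergy_smul]
  have h1 := halfEnergy_sgnOp_le a b (mulOp (wk s a) u)
  have h2 := halfEnergy_comm_le hs0 a b u
  have h3 : ENNReal.ofReal (4 * s⁻¹ ^ 3 * ‖u‖ ^ 2) ≤ 4 * ENNReal.ofReal (s⁻¹ ^ 2 * ‖u‖ ^ 2) := by
    have e4 : (4 : ℝ≥0∞) = ENNReal.ofReal 4 := by simp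
    rw [e4, ← ENNReal.ofReal_mul (by norm_num)]
    refine ENNReal.ofReal_le_ofReal ?_
    have hi : s⁻¹ ≤ 1 := inv_le_one_of_one_le₀ hs
    have hi0 : 0 < s⁻¹ := inv_pos.2 hs0
    have : s⁻¹ ^ 3 ≤ s⁻¹ ^ 2 := pow_le_pow_of_le_one hi0.le hi (by norm_num)
    have := mul_le_mul_of_nonneg_right this (sq_nonneg ‖u‖)
    linarith
  have e8 : ENNReal.ofReal 8 = 8 := by simp
  calc 2 * halfEnergy a (sgnOp b (mulOp (wk s a) u))
        + 2 * (ENNReal.ofReal (‖(-1 : ℂ)‖ ^ 2) * halfEnergy a K)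
      ≤ 2 * halfEnergy a (mulOp (wk s a) u) + 2 * (1 * (4 * ENNReal.ofReal (s⁻¹ ^ 2 * ‖u‖ ^ 2))) := by
        gcongr
        · simp
        · exact h2.trans h3
    _ ≤ 8 * halfEnergy a (mulOp (wk s a) u) + 8 * ENNReal.ofReal (s⁻¹ ^ 2 * ‖u‖ ^ 2) := by
        refine add_le_add ?_ (le_of_eq ?_)
        · gcongr; norm_num
        · rw [one_mul, ← mul_assoc]; norm_num
    _ = _ := by rw [e8, mul_add]

theorem coord_add (a b : Fin 2) (x : Plane) (τ : ℝ) :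
    (x + τ • stdVec a) b = x b + (if b = a then τ else 0) := by
  simp [stdVec_apply]

theorem exists_smoothing_th_le : ∃ K : ℝ, 0 < K ∧ ∀ (s : ℝ) (a b : Fin 2) (u : H), 1 ≤ s →
    smoothing s a (mulOp (th s b) u) ≤ ENNReal.ofReal K * smoothing s a u := by
  obtain ⟨K, hK, h⟩ := exists_halfEnergy_mulOp_le
  refine ⟨K * 2 ^ 2 + 2 ^ 2, by positivity, fun s a b u hs => ?_⟩
  have hs0 : 0 < s := by linarith
  refine smoothing_le_of_le hs a (by positivity) (norm_mulOp_th_le s b u) ?_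
  rw [mulOp_comm (memLp_wk hs0 a) (memLp_th s b)]
  refine h a (th s b) (memLp_th s b) 2 s⁻¹ (fun _ => 1) _ u (by norm_num) (by positivity)
    (Filter.Eventually.of_forall (norm_th_le s b)) (fun _ => le_rfl)
    (fun τ => Filter.Eventually.of_forall fun x => ?_) ?_
  · rw [th, th, ← Complex.ofReal_sub, Complex.norm_real, Real.norm_eq_abs, coord_add]
    refine (abs_arctan_sub_le _ _).trans ?_
    rw [← sub_div, add_sub_cancel_left, abs_div, abs_of_pos hs0, div_le_iff₀ hs0]
    have : |if b = a then τ else 0| ≤ |τ| := by split_ifs <;> simp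
    nlinarith [abs_nonneg τ]
  · filter_upwards [coeFn_mulOp (memLp_wk hs0 a) u] with x hx
    rw [hx, one_mul, norm_mul]
    gcongr
    exact norm_wk_le hs0 a x

/-- The smoothing functional is stable under complex conjugation, although the weight `k` is not
real: `conj k / k` is a bounded Lipschitz function. -/
theorem exists_smoothing_star_le : ∃ K : ℝ, 0 < K ∧ ∀ (s : ℝ) (a : Fin 2) (u : H), 1 ≤ s →
    smoothing s a (star u) ≤ ENNReal.ofReal K * smoothing s a u := by
  obtain ⟨K, hK, h⟩ := exists_halfEnergy_mulOp_le
  refine ⟨K * 2 ^ 2 + 1 ^ 2, by positivity, fun s a u hs => ?_⟩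
  have hs0 : 0 < s := by linarith
  refine smoothing_le_of_le hs a (by positivity) (by rw [norm_star_eq, one_mul]) ?_
  -- the unimodular quotient `conj k / k`
  set b : Plane → ℂ := fun x => -1 + 2 * (s : ℂ) * starRingEnd ℂ (wk s a x) with hb
  have hbk : ∀ x, b x * wk s a x = starRingEnd ℂ (wk s a x) := by
    intro x
    have h1 : wk s a x ≠ 0 := inv_ne_zero (wk_den_ne hs0 (x a))
    have h2 : starRingEnd ℂ (wk s a x) ≠ 0 := by simpa using h1
    have h3 : (wk s a x)⁻¹ + (starRingEnd ℂ (wk s a x))⁻¹ = 2 * (s : ℂ) := by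
      simp [wk]; ring
    simp only [hb]
    rw [← h3]; field_simp; ring
  have hb1 : ∀ x, ‖b x‖ ≤ 2 := by
    intro x
    have h1 : wk s a x ≠ 0 := inv_ne_zero (wk_den_ne hs0 (x a))
    have h2 := congrArg norm (hbk x)
    rw [norm_mul, RCLike.norm_conj] at h2
    have h3 : ‖b x‖ = 1 := by
      have := norm_pos_iff.2 h1
      exact mul_right_cancel₀ this.ne' (by rw [h2, one_mul])
    linarith
  have hbm : MemLp b ∞ volume := by
    refine memLp_top_of_bound (Continuous.aestronglyMeasurable ?_) 2
      (Filter.Eventually.of_forall hb1)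
    exact continuous_const.add (continuous_const.mul
      (Complex.continuous_conj.comp (continuous_wk hs0 a)))
  have e : mulOp (wk s a) (star u) = star (mulOp b (mulOp (wk s a) u)) := by
    refine Lp.ext ?_
    filter_upwards [coeFn_mulOp (memLp_wk hs0 a) (star u), coeFn_star_eq u,
      coeFn_star_eq (mulOp b (mulOp (wk s a) u)), coeFn_mulOp hbm (mulOp (wk s a) u),
      coeFn_mulOp (memLp_wk hs0 a) u] with x h1 h2 h3 h4 h5
    rw [h1, h2, h3, h4, h5, ← mul_assoc, hbk, map_mul, Complex.conj_conj]
  rw [e, halfEnergy_star]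
  refine h a b hbm 2 s⁻¹ (fun _ => 1) _ u (by norm_num) (by positivity)
    (Filter.Eventually.of_forall hb1) (fun _ => le_rfl)
    (fun τ => Filter.Eventually.of_forall fun x => ?_) ?_
  · have e1 : b (x + τ • stdVec a) - b x
        = 2 * (s : ℂ) * starRingEnd ℂ (wk s a (x + τ • stdVec a) - wk s a x) := by
      simp only [hb, map_sub]; ring
    have e2 : wk s a (x + τ • stdVec a) - wk s a x
        = Complex.I * τ * (wk s a (x + τ • stdVec a) * wk s a x) := by
      have n1 := wk_den_ne hs0 (x a)
      have n2 := wk_den_ne hs0 (x a + τ)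
      push_cast at n2
      simp only [wk, coord_add, if_true]
      push_cast
      field_simp
      ring
    rw [e1, e2]
    simp only [norm_mul, RCLike.norm_conj, Complex.norm_I, one_mul, mul_one, Complex.norm_real,
      Real.norm_of_nonneg hs0.le, Real.norm_eq_abs, Complex.norm_ofNat]
    have n1 := norm_wk_le hs0 a (x + τ • stdVec a)
    have n2 := norm_wk_le hs0 a x
    have hi : s⁻¹ ≤ 1 := inv_le_one_of_one_le₀ hs
    calc 2 * s * (|τ| * (‖wk s a (x + τ • stdVec a)‖ * ‖wk s a x‖))
        ≤ 2 * s * (|τ| * (s⁻¹ * s⁻¹)) := by gcongr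
      _ = 2 * |τ| * s⁻¹ := by field_simp
      _ ≤ 2 * |τ| * 1 := by gcongr
      _ = _ := mul_one _
  · filter_upwards [coeFn_mulOp (memLp_wk hs0 a) u] with x hx
    rw [hx, one_mul, norm_mul]
    gcongr
    exact norm_wk_le hs0 a x

/-! ### First order terms and the escape operator -/

theorem rpow_half_mul_rpow_half_le (x y : ℝ≥0∞) :
    x ^ (2⁻¹ : ℝ) * y ^ (2⁻¹ : ℝ) ≤ x + y := by
  calc x ^ (2⁻¹ : ℝ) * y ^ (2⁻¹ : ℝ) ≤ (x + y) ^ (2⁻¹ : ℝ) * (x + y) ^ (2⁻¹ : ℝ) := by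
        gcongr
        · exact le_self_add
        · exact le_add_self
    _ = x + y := by
        rw [← ENNReal.rpow_add_of_nonneg _ _ (by norm_num) (by norm_num)]; norm_num

/-- A first order term `g ∂_a w` is controlled by the local smoothing functionals as soon as
`g (s² + x_a²)` is bounded by `W s` and has the matching Lipschitz bound in the direction `e_a`. -/
theorem exists_enorm_inner_mulOp_deriv_le : ∃ K : ℝ, 0 < K ∧ ∀ (s : ℝ) (a : Fin 2)
    (g : Plane → ℂ) (W : ℝ), 1 ≤ s → MemLp g ∞ volume → 0 ≤ W →
    (∀ᵐ x, ‖g x * ((s ^ 2 + x a ^ 2 : ℝ) : ℂ)‖ ≤ W * s) →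
    (∀ τ : ℝ, ∀ᵐ x, ‖g (x + τ • stdVec a) * ((s ^ 2 + (x + τ • stdVec a) a ^ 2 : ℝ) : ℂ)
      - g x * ((s ^ 2 + x a ^ 2 : ℝ) : ℂ)‖ ≤ W * s * (1 + |x a| / s) * |τ|) →
    ∀ z w w' : H, HasD a w w' →
    ‖(inner ℂ z (mulOp g w') : ℂ)‖ₑ
      ≤ ENNReal.ofReal (K * W) * (smoothing s a z + smoothing s a w) := by
  obtain ⟨K, hK, hq⟩ := exists_halfEnergy_mulOp_le
  refine ⟨4 * K + 2, by positivity, fun s a g W hs hg hW h1 h2 z w w' hw => ?_⟩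
  have hs0 : 0 < s := by linarith
  -- Write `g = conj b |k|²`, so that `⟨z, g ∂_a w⟩ = ⟨b k z, k ∂_a w⟩`, with one weight `k` on each
  -- factor.
  set b : Plane → ℂ := fun x => starRingEnd ℂ (g x * ((s ^ 2 + x a ^ 2 : ℝ) : ℂ)) with hb
  have hb1 : ∀ᵐ x, ‖b x‖ ≤ W * s := by
    filter_upwards [h1] with x hx
    rwa [hb, RCLike.norm_conj]
  have hcm : Continuous fun x : Plane => ((s ^ 2 + x a ^ 2 : ℝ) : ℂ) := by fun_prop
  have hbm : MemLp b ∞ volume := by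
    refine memLp_top_of_bound ?_ (W * s) hb1
    exact Complex.continuous_conj.comp_aestronglyMeasurable
      (hg.aestronglyMeasurable.mul hcm.aestronglyMeasurable)
  set k := wk s a with hk
  have hkm : MemLp k ∞ volume := memLp_wk hs0 a
  set F : H := mulOp b (mulOp k z) with hF
  have hp := hw.wk_mul hs0 a a
  rw [← hk] at hp
  set p := mulOp k w' + mulOp (wkDeriv s a a) w with hpdef
  have e1 : (inner ℂ z (mulOp g w') : ℂ) = inner ℂ F p - inner ℂ F (mulOp (wkDeriv s a a) w) := by
    rw [hpdef, inner_add_right, add_sub_cancel_right, hF, inner_mulOp_left hbm,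
      inner_mulOp_left hkm, mulOp_mulOp (memLp_conj hbm) hkm,
      mulOp_mulOp (memLp_conj hkm) (memLp_mul (memLp_conj hbm) hkm)]
    congr 2
    refine mulOp_congr (Filter.Eventually.of_forall fun x => ?_)
    have e2 := conj_wk_mul_wk s a x
    have h3 : ((s ^ 2 + x a ^ 2 : ℝ) : ℂ) ≠ 0 := by
      have : (0 : ℝ) < s ^ 2 + (x a) ^ 2 := by positivity
      exact_mod_cast this.ne'
    simp only [hb, Complex.conj_conj]
    calc g x = g x * ((s ^ 2 + x a ^ 2 : ℝ) : ℂ) * (((s ^ 2 + x a ^ 2)⁻¹ : ℝ) : ℂ) := by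
          rw [Complex.ofReal_inv, mul_assoc, mul_inv_cancel₀ h3, mul_one]
      _ = _ := by rw [← e2, hk]; ring
  have hq1 := hq a b hbm (W * s) (2 * s⁻¹) (fun x => 1 + |x a| / s) (mulOp k z) z (by positivity)
    (by positivity) hb1 (fun x => by have : 0 ≤ |x a| / s := by positivity
                                     linarith) ?_ ?_
  rotate_left
  · intro τ
    filter_upwards [h2 τ] with x hx
    rw [hb]
    simp only
    rw [← map_sub, RCLike.norm_conj]
    exact hx
  · filter_upwards [coeFn_mulOp hkm z] with x hx
    rw [hx, norm_mul, ← mul_assoc]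
    exact mul_le_mul_of_nonneg_right (weight_mul_norm_wk_le hs0 a x) (norm_nonneg _)
  rw [← hF] at hq1
  set Q : ℝ≥0∞ := ENNReal.ofReal (4 * K) * smoothing s a z with hQ
  have hq2 : halfEnergy a F ≤ ENNReal.ofReal (W ^ 2) * (ENNReal.ofReal s * Q) := by
    refine hq1.trans ?_
    have e3 : ENNReal.ofReal ((2 * s⁻¹) ^ 2 * ‖z‖ ^ 2)
        = ENNReal.ofReal (4 * s⁻¹) * ENNReal.ofReal (s⁻¹ * ‖z‖ ^ 2) := by
      rw [← ENNReal.ofReal_mul (by positivity)]; congr 1; ring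
    have e4 : ENNReal.ofReal (K * (W * s) ^ 2)
        = ENNReal.ofReal (W ^ 2) * (ENNReal.ofReal s * ENNReal.ofReal (K * s)) := by
      rw [← ENNReal.ofReal_mul (by positivity), ← ENNReal.ofReal_mul (by positivity)]
      congr 1; ring
    rw [e3, e4, mul_assoc, mul_assoc]
    gcongr
    rw [hQ, smoothing, mul_add, mul_add, ← mul_assoc, ← mul_assoc,
      ← ENNReal.ofReal_mul (p := K * s) (by positivity),
      ← ENNReal.ofReal_mul (p := 4 * K) (by positivity)]
    have e5 : K * s * (4 * s⁻¹) = 4 * K := by field_simp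
    rw [e5]
    gcongr ENNReal.ofReal ?_ * _ + _
    rw [mul_comm]
    nlinarith
  have hI : ‖(inner ℂ F p : ℂ)‖ₑ ≤ ENNReal.ofReal W * (Q + smoothing s a w) := by
    refine (enorm_inner_deriv_le hp F).trans ?_
    calc halfEnergy a F ^ (2⁻¹ : ℝ) * halfEnergy a (mulOp k w) ^ (2⁻¹ : ℝ)
        ≤ (ENNReal.ofReal (W ^ 2) * (ENNReal.ofReal s * Q)) ^ (2⁻¹ : ℝ)
          * halfEnergy a (mulOp k w) ^ (2⁻¹ : ℝ) := by gcongr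
      _ = ENNReal.ofReal W * (Q ^ (2⁻¹ : ℝ) *
          (ENNReal.ofReal s * halfEnergy a (mulOp k w)) ^ (2⁻¹ : ℝ)) := by
          have h0 : (0 : ℝ) ≤ 2⁻¹ := by norm_num
          rw [ENNReal.mul_rpow_of_nonneg (ENNReal.ofReal (W ^ 2)) _ h0,
            ENNReal.mul_rpow_of_nonneg (ENNReal.ofReal s) Q h0,
            ENNReal.mul_rpow_of_nonneg (ENNReal.ofReal s) (halfEnergy a (mulOp k w)) h0,
            ENNReal.ofReal_rpow_of_nonneg (sq_nonneg W) h0]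
          have : (W ^ 2) ^ (2⁻¹ : ℝ) = W := by
            rw [inv_eq_one_div, ← Real.sqrt_eq_rpow, Real.sqrt_sq hW]
          rw [this, mul_comm (ENNReal.ofReal s ^ _) (Q ^ _), mul_assoc, mul_assoc]
      _ ≤ ENNReal.ofReal W * (Q + ENNReal.ofReal s * halfEnergy a (mulOp k w)) := by
          gcongr; exact rpow_half_mul_rpow_half_le _ _
      _ ≤ _ := by
          gcongr; exact le_self_add
  have hII : ‖(inner ℂ F (mulOp (wkDeriv s a a) w) : ℂ)‖ₑ
      ≤ ENNReal.ofReal W * (smoothing s a z + smoothing s a w) := by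
    have n1 : ‖F‖ ≤ W * s * (s⁻¹ * ‖z‖) :=
      (norm_mulOp_le hbm hb1 _).trans (by gcongr; exact norm_mulOp_wk_le hs0 a z)
    have n2 : ‖mulOp (wkDeriv s a a) w‖ ≤ s⁻¹ ^ 2 * ‖w‖ :=
      norm_mulOp_le (memLp_wkDeriv hs0 a a) (Filter.Eventually.of_forall (norm_wkDeriv_le hs0 a a)) w
    have hi : s⁻¹ ≤ 1 := inv_le_one_of_one_le₀ hs
    have hi0 : 0 < s⁻¹ := inv_pos.2 hs0
    have n3 : ‖(inner ℂ F (mulOp (wkDeriv s a a) w) : ℂ)‖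
        ≤ W * (s⁻¹ * ‖z‖ ^ 2 + s⁻¹ * ‖w‖ ^ 2) := by
      calc ‖(inner ℂ F (mulOp (wkDeriv s a a) w) : ℂ)‖ ≤ ‖F‖ * ‖mulOp (wkDeriv s a a) w‖ :=
            norm_inner_le_norm _ _
        _ ≤ (W * s * (s⁻¹ * ‖z‖)) * (s⁻¹ ^ 2 * ‖w‖) := by gcongr
        _ = W * (s⁻¹ * (s⁻¹ * (‖z‖ * ‖w‖))) := by field_simp
        _ ≤ W * (s⁻¹ * (1 * (‖z‖ ^ 2 + ‖w‖ ^ 2))) := by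
            gcongr
            nlinarith [sq_nonneg (‖z‖ - ‖w‖), sq_nonneg ‖z‖, sq_nonneg ‖w‖]
        _ = _ := by ring
    rw [← ofReal_norm]
    refine (ENNReal.ofReal_le_ofReal n3).trans ?_
    rw [ENNReal.ofReal_mul hW, ENNReal.ofReal_add (by positivity) (by positivity)]
    gcongr
    · exact le_add_self
    · exact le_add_self
  rw [e1]
  refine (enorm_sub_le).trans ((add_le_add hI hII).trans ?_)
  have e6 : ENNReal.ofReal ((4 * K + 2) * W)
      = ENNReal.ofReal W * (ENNReal.ofReal (4 * K) + 1 + 1) := by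
    rw [mul_comm, ENNReal.ofReal_mul hW, show 4 * K + 2 = 4 * K + 1 + 1 by ring,
      ENNReal.ofReal_add (by positivity) (by norm_num), ENNReal.ofReal_add (by positivity)
      (by norm_num), ENNReal.ofReal_one]
  rw [e6, mul_assoc, ← mul_add]
  gcongr
  rw [hQ, add_mul, add_mul, one_mul, mul_add]
  calc ENNReal.ofReal (4 * K) * smoothing s a z + smoothing s a w
        + (smoothing s a z + smoothing s a w)
      ≤ (ENNReal.ofReal (4 * K) * smoothing s a z + ENNReal.ofReal (4 * K) * smoothing s a w)
        + (smoothing s a z + smoothing s a w) + (smoothing s a z + smoothing s a w) := by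
        gcongr ?_ + _
        rw [add_assoc]
        gcongr
        exact le_add_self.trans (le_add_self (a := smoothing s a z + smoothing s a w))
    _ = _ := by ring

/-- The self-adjoint escape operator `½ (θ sgn D_a + sgn D_a θ)`. -/
def escape (s : ℝ) (a : Fin 2) : H →L[ℂ] H :=
  (2⁻¹ : ℂ) • (mulOp (th s a) ∘L sgnOp a + sgnOp a ∘L mulOp (th s a))

theorem escape_apply (s : ℝ) (a : Fin 2) (u : H) :
    escape s a u = (2⁻¹ : ℂ) • (mulOp (th s a) (sgnOp a u) + sgnOp a (mulOp (th s a) u)) := rfl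

theorem inner_escape_left (s : ℝ) (a : Fin 2) (u v : H) :
    (inner ℂ (escape s a u) v : ℂ) = inner ℂ u (escape s a v) := by
  rw [escape_apply, escape_apply, inner_smul_left, inner_smul_right, inner_add_left,
    inner_add_right, inner_mulOp_th_left, inner_sgnOp_left, inner_sgnOp_left, inner_mulOp_th_left,
    map_inv₀, Complex.conj_ofNat, add_comm]

theorem norm_escape_le (s : ℝ) (a : Fin 2) (u : H) : ‖escape s a u‖ ≤ 2 * ‖u‖ := by
  rw [escape_apply, norm_smul]
  have h1 := (norm_mulOp_th_le s a (sgnOp a u)).trans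
    (mul_le_mul_of_nonneg_left (norm_sgnOp_le a u) (by norm_num))
  have h2 := (norm_sgnOp_le a (mulOp (th s a) u)).trans (norm_mulOp_th_le s a u)
  have h3 := norm_add_le (mulOp (th s a) (sgnOp a u)) (sgnOp a (mulOp (th s a) u))
  have h4 : ‖(2⁻¹ : ℂ)‖ = 2⁻¹ := by simp
  rw [h4]
  linarith

theorem exists_smoothing_escape_le : ∃ K : ℝ, 0 < K ∧ ∀ (s : ℝ) (a b : Fin 2) (u : H), 1 ≤ s →
    smoothing s a (escape s b u) ≤ ENNReal.ofReal K * smoothing s a u := by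
  obtain ⟨K, hK, h⟩ := exists_smoothing_th_le
  refine ⟨36 * K, by positivity, fun s a b u hs => ?_⟩
  have hs0 : 0 < s := by linarith
  have h1 : smoothing s a (mulOp (th s b) (sgnOp b u)) ≤
      ENNReal.ofReal (9 * K) * smoothing s a u := by
    refine (h s a b _ hs).trans ?_
    rw [mul_comm 9 K, ENNReal.ofReal_mul hK.le, mul_assoc]
    gcongr
    exact smoothing_sgnOp_le hs a b u
  have h2 : smoothing s a (sgnOp b (mulOp (th s b) u)) ≤
      ENNReal.ofReal (9 * K) * smoothing s a u := by
    refine (smoothing_sgnOp_le hs a b _).trans ?_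
    rw [ENNReal.ofReal_mul (by norm_num), mul_assoc]
    gcongr
    exact h s a b u hs
  have h3 : ENNReal.ofReal (‖(2⁻¹ : ℂ)‖ ^ 2) ≤ 1 := by
    rw [← ENNReal.ofReal_one]
    refine ENNReal.ofReal_le_ofReal ?_
    norm_num
  rw [escape_apply, smoothing_smul]
  calc _ ≤ 1 * (2 * smoothing s a (mulOp (th s b) (sgnOp b u))
        + 2 * smoothing s a (sgnOp b (mulOp (th s b) u))) := by
        gcongr; exact smoothing_add_le hs0 a _ _
    _ ≤ 1 * (2 * (ENNReal.ofReal (9 * K) * smoothing s a u)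
        + 2 * (ENNReal.ofReal (9 * K) * smoothing s a u)) := by gcongr
    _ = ENNReal.ofReal 4 * ENNReal.ofReal (9 * K) * smoothing s a u := by
        rw [ENNReal.ofReal_ofNat]; ring
    _ = _ := by
        rw [← ENNReal.ofReal_mul (by norm_num)]; congr 2; ring

theorem HasD.escape {s : ℝ} (hs : 0 < s) {a b : Fin 2} {u u' : H} (h : HasD b u u') :
    HasD b (escape s a u) (NLSEnergy.escape s a u' + (2⁻¹ : ℂ) •
      (mulOp (thDeriv s a b) (sgnOp a u) + sgnOp a (mulOp (thDeriv s a b) u))) := by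
  have h1 := (((h.sgn a).th_mul hs a b).add ((h.th_mul hs a b).sgn a)).const_smul (2⁻¹ : ℂ)
  rw [map_add] at h1
  rw [escape_apply, escape_apply, ← smul_add]
  convert h1 using 2
  abel

theorem im_inner_escape_self (s : ℝ) (a : Fin 2) (u : H) :
    (inner ℂ (escape s a u) u : ℂ).im = 0 := by
  have h := inner_conj_symm (𝕜 := ℂ) u (escape s a u)
  rw [← inner_escape_left] at h
  exact Complex.conj_eq_iff_im.1 h

theorem im_inner_escape_deriv {s : ℝ} (hs : 0 < s) {a b : Fin 2} {u u' u'' : H}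
    (h : HasD b u u') (h' : HasD b u' u'') :
    (inner ℂ (escape s a u) u'' : ℂ).im = -(2⁻¹ * ((inner ℂ (mulOp (thDeriv s a b) (sgnOp a u)) u' : ℂ)
      + inner ℂ (sgnOp a (mulOp (thDeriv s a b) u)) u').im) := by
  have h1 := (h.escape hs (a := a)).inner_left h'
  have h2 : (inner ℂ (escape s a u) u'' : ℂ) = - inner ℂ (escape s a u' + (2⁻¹ : ℂ) •
      (mulOp (thDeriv s a b) (sgnOp a u) + sgnOp a (mulOp (thDeriv s a b) u))) u' := by
    rw [h1, neg_neg]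
  rw [h2, inner_add_left, inner_smul_left, inner_add_left, Complex.neg_im, Complex.add_im,
    im_inner_escape_self, zero_add]
  congr 1
  have : (starRingEnd ℂ) (2⁻¹ : ℂ) = ((2⁻¹ : ℝ) : ℂ) := by
    rw [map_inv₀, Complex.conj_ofNat]; norm_num
  rw [this, Complex.im_ofReal_mul]

/-- The weight `θ` of the direction `e_a` does not see derivatives in the other direction. -/
theorem im_inner_escape_deriv_of_ne {s : ℝ} (hs : 0 < s) {a b : Fin 2} (hab : a ≠ b) {u u' u'' : H}
    (h : HasD b u u') (h' : HasD b u' u'') :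
    (inner ℂ (escape s a u) u'' : ℂ).im = 0 := by
  have h0 : ∀ f : H, mulOp (thDeriv s a b) f = 0 := by
    intro f
    have := norm_mulOp_le (memLp_thDeriv hs a b) (C := 0)
      (Filter.Eventually.of_forall fun x => by simp [thDeriv, hab]) f
    rw [zero_mul] at this
    exact norm_le_zero_iff.1 this
  rw [im_inner_escape_deriv hs h h', h0, h0]
  simp

/-- The positive commutator estimate for the escape operator. -/
theorem im_inner_escape_deriv_le {s : ℝ} (hs : 1 ≤ s) {a : Fin 2} {u u' u'' : H}
    (h : HasD a u u') (h' : HasD a u' u'') :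
    (inner ℂ (escape s a u) u'' : ℂ).im ≤ -(smoothing s a u).toReal + 4 * (s⁻¹ * ‖u‖ ^ 2) := by
  have hs0 : 0 < s := by linarith
  set k := wk s a with hk
  have hkm : MemLp k ∞ volume := memLp_wk hs0 a
  set k' := wkDeriv s a a with hk'
  have hkm' : MemLp k' ∞ volume := memLp_wkDeriv hs0 a a
  set S := sgnOp a
  set C : H := S (mulOp k u) - mulOp k (S u) with hC
  set p : H := mulOp k u' + mulOp k' u with hp
  have hup : HasD a (mulOp k u) p := h.wk_mul hs0 a a
  have hsp : HasD a (mulOp k (S u)) (mulOp k (S u') + mulOp k' (S u)) := (h.sgn a).wk_mul hs0 a a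
  set q := (halfEnergy a (mulOp k u)).toReal with hq
  have hw : ∀ f v : H, (inner ℂ (mulOp (thDeriv s a a) f) v : ℂ)
      = s * inner ℂ (mulOp k f) (mulOp k v) := by
    intro f v
    rw [inner_mulOp_left (memLp_thDeriv hs0 a a), inner_mulOp_left hkm,
      mulOp_mulOp (memLp_conj hkm) hkm, ← inner_smul_right,
      ← mulOp_const_mul _ (memLp_mul (memLp_conj hkm) hkm)]
    congr 2
    refine mulOp_congr (Filter.Eventually.of_forall fun x => ?_)
    have := conj_wk_mul_wk s a x
    simp only [hk]
    rw [this, thDeriv, if_pos rfl, Complex.conj_ofReal]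
    push_cast; ring
  -- Since `∂_a θ = s |k|²`, the main part is `⟨S k u, k ∂_a u⟩`, where `S = sgn D_a`; the commutators
  -- `C = [S, k]` and `k' = ∂_a k` contribute terms of size `s⁻¹ ‖u‖²`.
  have e1 : (inner ℂ (mulOp (thDeriv s a a) (S u)) u' : ℂ)
      = s * (Complex.I * q) - s * inner ℂ C p - s * inner ℂ (mulOp k (S u)) (mulOp k' u) := by
    have hkS : mulOp k (S u) = S (mulOp k u) - C := by rw [hC]; abel
    have hku : mulOp k u' = p - mulOp k' u := by rw [hp]; abel
    rw [hw, ← inner_sgnOp_deriv hup, hku, inner_sub_right]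
    conv_lhs => rw [hkS]
    rw [inner_sub_left, inner_sub_left, hkS, inner_sub_left]
    ring
  have e2 : (inner ℂ (S (mulOp (thDeriv s a a) u)) u' : ℂ)
      = s * (Complex.I * q) + s * inner ℂ p C - s * inner ℂ (mulOp k u) (mulOp k' (S u)) := by
    rw [inner_sgnOp_left, hw]
    have hkS : mulOp k (S u') = (mulOp k (S u') + mulOp k' (S u)) - mulOp k' (S u) := by abel
    have h3 := hup.inner_left hsp
    have h4 : (inner ℂ (mulOp k u) (mulOp k (S u') + mulOp k' (S u)) : ℂ)
        = - inner ℂ p (mulOp k (S u)) := by rw [h3, neg_neg]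
    have hkS2 : mulOp k (S u) = S (mulOp k u) - C := by rw [hC]; abel
    have h5 : (inner ℂ p (S (mulOp k u)) : ℂ) = -(Complex.I * q) := by
      rw [← inner_conj_symm, inner_sgnOp_deriv hup]; simp [hq]
    rw [hkS, inner_sub_right, h4, hkS2, inner_sub_right, h5]
    ring
  have hi : s⁻¹ ≤ 1 := inv_le_one_of_one_le₀ hs
  have hi0 : 0 < s⁻¹ := inv_pos.2 hs0
  have n0 : ‖mulOp k u‖ ≤ s⁻¹ * ‖u‖ := norm_mulOp_wk_le hs0 a u
  have n1 : ‖(inner ℂ p C : ℂ)‖ ≤ 2 * s⁻¹ ^ 3 * ‖u‖ ^ 2 := by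
    refine (norm_inner_deriv_comm_le hs0 a a hup u).trans ?_
    calc 2 * s⁻¹ ^ 2 * (‖mulOp k u‖ * ‖u‖) ≤ 2 * s⁻¹ ^ 2 * (s⁻¹ * ‖u‖ * ‖u‖) := by gcongr
      _ = _ := by ring
  have n1' : ‖(inner ℂ C p : ℂ)‖ ≤ 2 * s⁻¹ ^ 3 * ‖u‖ ^ 2 := by rwa [norm_inner_symm]
  have hk'n : ∀ f : H, ‖mulOp k' f‖ ≤ s⁻¹ ^ 2 * ‖f‖ := fun f =>
    norm_mulOp_le hkm' (Filter.Eventually.of_forall (norm_wkDeriv_le hs0 a a)) f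
  have n2 : ‖(inner ℂ (mulOp k (S u)) (mulOp k' u) : ℂ)‖ ≤ s⁻¹ ^ 3 * ‖u‖ ^ 2 := by
    calc _ ≤ ‖mulOp k (S u)‖ * ‖mulOp k' u‖ := norm_inner_le_norm _ _
      _ ≤ (s⁻¹ * ‖u‖) * (s⁻¹ ^ 2 * ‖u‖) := by
          gcongr
          · exact (norm_mulOp_wk_le hs0 a _).trans (by gcongr; exact norm_sgnOp_le a u)
          · exact hk'n u
      _ = _ := by ring
  have n3 : ‖(inner ℂ (mulOp k u) (mulOp k' (S u)) : ℂ)‖ ≤ s⁻¹ ^ 3 * ‖u‖ ^ 2 := by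
    calc _ ≤ ‖mulOp k u‖ * ‖mulOp k' (S u)‖ := norm_inner_le_norm _ _
      _ ≤ (s⁻¹ * ‖u‖) * (s⁻¹ ^ 2 * ‖u‖) := by
          gcongr
          exact (hk'n _).trans (by gcongr; exact norm_sgnOp_le a u)
      _ = _ := by ring
  have hfin : halfEnergy a (mulOp k u) ≠ ∞ := (halfEnergy_lt_top hup).ne
  have eY : (smoothing s a u).toReal = s * q + s⁻¹ * ‖u‖ ^ 2 := by
    rw [smoothing, ENNReal.toReal_add (ENNReal.mul_ne_top ENNReal.ofReal_ne_top hfin)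
      ENNReal.ofReal_ne_top, ENNReal.toReal_mul, ENNReal.toReal_ofReal hs0.le,
      ENNReal.toReal_ofReal (by positivity)]
  rw [im_inner_escape_deriv hs0 h h', e1, e2, eY]
  have i1 := (Complex.abs_im_le_norm _).trans n1
  have i1' := (Complex.abs_im_le_norm _).trans n1'
  have i2 := (Complex.abs_im_le_norm _).trans n2
  have i3 := (Complex.abs_im_le_norm _).trans n3
  rw [abs_le] at i1 i1' i2 i3
  simp only [Complex.add_im, Complex.sub_im, Complex.im_ofReal_mul, Complex.I_mul_im,
    Complex.ofReal_re]
  have hX : s * (s⁻¹ ^ 3 * ‖u‖ ^ 2) ≤ s⁻¹ * ‖u‖ ^ 2 := by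
    have : s * (s⁻¹ ^ 3 * ‖u‖ ^ 2) = s⁻¹ * (s⁻¹ * ‖u‖ ^ 2) := by field_simp
    rw [this]
    gcongr
    nlinarith [sq_nonneg ‖u‖]
  have m1 := mul_le_mul_of_nonneg_left i1.1 hs0.le
  have m1' := mul_le_mul_of_nonneg_left i1'.2 hs0.le
  have m2 := mul_le_mul_of_nonneg_left i2.2 hs0.le
  have m3 := mul_le_mul_of_nonneg_left i3.2 hs0.le
  nlinarith

/-! ### Pointwise bounds on the coefficients -/

/-- The space `L^∞(ℝ²)`. -/
abbrev Linf : Type := Lp ℂ ∞ (volume : Measure Plane)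

/-- A locally integrable function is determined by its pairings with Schwartz functions. -/
theorem ae_eq_of_integral_schwartz_eq {u v : Plane → ℂ} (hu : LocallyIntegrable u volume)
    (hv : LocallyIntegrable v volume) (h : ∀ φ : 𝓢(Plane, ℂ), ∫ x, φ x * u x = ∫ x, φ x * v x) :
    u =ᵐ[volume] v := by
  have := ae_eq_zero_of_integral_contDiff_smul_eq_zero (hu.sub hv) ?_
  · filter_upwards [this] with ξ hξ using sub_eq_zero.1 hξ
  · intro g hg hgc
    have h1 : HasCompactSupport (Complex.ofRealCLM ∘ g) := hgc.comp_left rfl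
    have h2 : ContDiff ℝ (⊤ : ℕ∞) (Complex.ofRealCLM ∘ g) := Complex.ofRealCLM.contDiff.comp hg
    have h3 := h (h1.toSchwartzMap h2)
    have hgl : ∀ {u : Plane → ℂ}, LocallyIntegrable u volume →
        Integrable (fun ξ => (g ξ : ℂ) * u ξ) volume := by
      intro u hu
      have := hu.integrable_smul_left_of_hasCompactSupport hg.continuous hgc
      simpa using this
    calc ∫ ξ, g ξ • (u ξ - v ξ)
        = ∫ ξ, ((g ξ : ℂ) * u ξ - (g ξ : ℂ) * v ξ) := by
          refine integral_congr_ae (Filter.Eventually.of_forall fun ξ => ?_)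
          simp [mul_sub]
      _ = 0 := by
          rw [integral_sub (hgl hu) (hgl hv), sub_eq_zero]
          simpa using h3

/-- Duality between `L^1` and `L^∞`, tested on Schwartz functions. -/
theorem ae_norm_le_of_integral_schwartz_le {f : Plane → ℂ} (hf : LocallyIntegrable f volume) {C : ℝ}
    (h : ∀ φ : 𝓢(Plane, ℂ), ‖∫ x, φ x * f x‖ ≤ C * ∫ x, ‖φ x‖) : ∀ᵐ x, ‖f x‖ ≤ C := by
  set β : ℕ → ContDiffBump (0 : Plane) := fun n =>
    ⟨1 / ((n : ℝ) + 1), 2 * (1 / ((n : ℝ) + 1)), by positivity, by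
      have : (0 : ℝ) < 1 / ((n : ℝ) + 1) := by positivity
      linarith⟩ with hβ
  have h1 : Filter.Tendsto (fun n => (β n).rOut) Filter.atTop (nhds 0) := by
    have := (tendsto_one_div_add_atTop_nhds_zero_nat (𝕜 := ℝ)).const_mul 2
    simpa [hβ] using this
  have h2 := ContDiffBump.ae_convolution_tendsto_right_of_locallyIntegrable (φ := β)
    (l := Filter.atTop) (K := 2) h1 (Filter.Eventually.of_forall fun n => le_rfl) hf
  filter_upwards [h2] with x hx
  refine le_of_tendsto hx.norm (Filter.Eventually.of_forall fun n => ?_)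
  set g : Plane → ℝ := fun y => (β n).normed volume (x - y) with hg
  have g1 : ContDiff ℝ (⊤ : ℕ∞) g := (β n).contDiff_normed.comp (contDiff_const.sub contDiff_id)
  have g2 : HasCompactSupport g :=
    (β n).hasCompactSupport_normed.comp_homeomorph (Homeomorph.subLeft x)
  have h3 : HasCompactSupport (Complex.ofRealCLM ∘ g) := g2.comp_left rfl
  have h4 : ContDiff ℝ (⊤ : ℕ∞) (Complex.ofRealCLM ∘ g) := Complex.ofRealCLM.contDiff.comp g1
  have h5 := h (h3.toSchwartzMap h4)
  have e1 : ∫ y, ‖(h3.toSchwartzMap h4) y‖ = 1 := by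
    have : ∀ y, ‖(h3.toSchwartzMap h4) y‖ = (β n).normed volume (x - y) := by
      intro y
      change ‖((g y : ℝ) : ℂ)‖ = _
      rw [Complex.norm_real, Real.norm_of_nonneg ((β n).nonneg_normed _)]
    simp only [this]
    rw [integral_sub_left_eq_self (fun y => (β n).normed volume y)]
    exact (β n).integral_normed
  have e2 : (MeasureTheory.convolution ((β n).normed volume) f (ContinuousLinearMap.lsmul ℝ ℝ) volume) x
      = ∫ y, (h3.toSchwartzMap h4) y * f y := by
    rw [convolution_eq_swap]
    refine integral_congr_ae (Filter.Eventually.of_forall fun y => ?_)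
    change (g y) • f y = ((g y : ℝ) : ℂ) * f y
    simp
  rw [e1, mul_one] at h5
  rw [e2]
  exact h5

theorem ae_norm_le_norm (g : Linf) : ∀ᵐ x, ‖g x‖ ≤ ‖g‖ := by
  have := ae_le_eLpNormEssSup (f := g) (μ := (volume : Measure Plane))
  have hfin := Lp.eLpNorm_ne_top g
  filter_upwards [this] with x hx
  rw [Lp.norm_def, ← toReal_enorm]
  refine ENNReal.toReal_mono hfin ?_
  rwa [eLpNorm_exponent_top]

theorem memLp_linf (g : Linf) : MemLp g ∞ volume := Lp.memLp g

theorem locallyIntegrable_linf (g : Linf) : LocallyIntegrable g volume :=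
  (Lp.memLp g).locallyIntegrable (by simp)

theorem integrable_schwartz_mul_linf (φ : 𝓢(Plane, ℂ)) (g : Linf) :
    Integrable (fun x => φ x * g x) volume :=
  φ.integrable.mul_bdd (c := ‖g‖) (Lp.aestronglyMeasurable g) (ae_norm_le_norm g)

theorem schwartz_sub_eq_integral (a : Fin 2) (φ : 𝓢(Plane, ℂ)) (x : Plane) (τ : ℝ) :
    φ (x + τ • stdVec a) - φ x = ∫ σ in (0 : ℝ)..τ, (∂_{stdVec a} φ) (x + σ • stdVec a) := by
  have h : ∀ σ : ℝ, HasDerivAt (fun σ : ℝ => φ (x + σ • stdVec a))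
      ((∂_{stdVec a} φ) (x + σ • stdVec a)) σ := by
    intro σ
    rw [SchwartzMap.lineDerivOp_apply_eq_fderiv]
    have h1 : HasDerivAt (fun σ : ℝ => x + σ • stdVec a) (stdVec a) σ := by
      simpa using ((hasDerivAt_id σ).smul_const (stdVec a)).const_add x
    exact (φ.differentiableAt (x := x + σ • stdVec a)).hasFDerivAt.comp_hasDerivAt σ h1
  rw [intervalIntegral.integral_eq_sub_of_hasDerivAt (fun σ _ => h σ)]
  · simp
  · refine Continuous.intervalIntegrable ?_ _ _
    exact (∂_{stdVec a} φ).continuous.comp (by fun_prop)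

theorem integral_lineDeriv_mul_linf {b : Fin 2} {g d : Linf}
    (h : Lp.toTemperedDistribution d = ∂_{stdVec b} (Lp.toTemperedDistribution g))
    (ψ : 𝓢(Plane, ℂ)) : ∫ x, (∂_{stdVec b} ψ) x * g x = -∫ x, ψ x * d x := by
  have h1 := temperedDistribution_ext_iff.1 h ψ
  rw [TemperedDistribution.lineDerivOp_apply_apply, Lp.toTemperedDistribution_apply, map_neg,
    Lp.toTemperedDistribution_apply] at h1
  simp only [smul_eq_mul] at h1
  rw [h1, neg_neg]

/-- A function with bounded weak derivative `∂_a g` is Lipschitz in the direction `e_a`. -/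
theorem ae_norm_shift_sub_le {a : Fin 2} {g d : Linf}
    (h : Lp.toTemperedDistribution d = ∂_{stdVec a} (Lp.toTemperedDistribution g)) (τ : ℝ) :
    ∀ᵐ x, ‖g (x + τ • stdVec a) - g x‖ ≤ ‖d‖ * |τ| := by
  have hmp := measurePreserving_add_right (volume : Measure Plane) (τ • stdVec a)
  have hgs : MemLp (fun x => g (x + τ • stdVec a)) ∞ volume :=
    (Lp.memLp g).comp_measurePreserving hmp
  refine ae_norm_le_of_integral_schwartz_le
    ((hgs.locallyIntegrable (by simp)).sub (locallyIntegrable_linf g)) fun φ => ?_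
  set D := ∂_{stdVec a} φ with hD
  have e0 : ∀ (ψ : 𝓢(Plane, ℂ)) (v : Plane), ∫ x, ‖ψ (x + v)‖ = ∫ x, ‖ψ x‖ := fun ψ v =>
    integral_add_right_eq_self (fun x => ‖ψ x‖) v
  -- the pairing with the difference is an average of pairings with translated derivatives
  have e1 : ∫ x, φ x * (g (x + τ • stdVec a) - g x)
      = ∫ x, (φ (x + (-τ) • stdVec a) - φ x) * g x := by
    have i1 : Integrable (fun x => φ x * g (x + τ • stdVec a)) volume := by
      have := hmp.integrable_comp_of_integrable
        (integrable_schwartz_mul_linf (shiftS ((-τ) • stdVec a) φ) g)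
      refine this.congr (Filter.Eventually.of_forall fun x => ?_)
      simp [shiftS_apply, add_assoc]
    have i2 := integrable_schwartz_mul_linf φ g
    have i3 := integrable_schwartz_mul_linf (shiftS ((-τ) • stdVec a) φ) g
    simp only [shiftS_apply] at i3
    simp only [mul_sub, sub_mul]
    rw [integral_sub i1 i2, integral_sub i3 i2]
    congr 1
    rw [← integral_add_right_eq_self (fun x => φ (x + (-τ) • stdVec a) * g x) (τ • stdVec a)]
    refine integral_congr_ae (Filter.Eventually.of_forall fun x => ?_)
    simp [add_assoc]
  have e2 : ∫ x, (φ (x + (-τ) • stdVec a) - φ x) * g x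
      = ∫ σ in (0 : ℝ)..(-τ), ∫ x, D (x + σ • stdVec a) * g x := by
    rw [intervalIntegral_integral_swap]
    · refine integral_congr_ae (Filter.Eventually.of_forall fun x => ?_)
      simp only [schwartz_sub_eq_integral, ← hD]
      rw [intervalIntegral.integral_mul_const]
    · have : IsFiniteMeasure (volume.restrict (uIoc 0 (-τ))) := by
        rw [uIoc]; infer_instance
      rw [integrable_prod_iff]
      · refine ⟨Filter.Eventually.of_forall fun σ =>
          integrable_schwartz_mul_linf (shiftS (σ • stdVec a) D) g, ?_⟩
        refine Integrable.mono' (g := fun _ => ‖g‖ * ∫ x, ‖D x‖) (integrable_const _) ?_ ?_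
        · refine AEStronglyMeasurable.norm ?_ |>.integral_prod_right'
          refine AEStronglyMeasurable.mul ?_ ?_
          · exact (D.continuous.comp (by fun_prop)).aestronglyMeasurable
          · exact (Lp.aestronglyMeasurable g).comp_snd
        · refine Filter.Eventually.of_forall fun σ => ?_
          rw [Real.norm_of_nonneg (by positivity), ← e0 D (σ • stdVec a), ← integral_const_mul]
          refine integral_mono_ae (integrable_schwartz_mul_linf (shiftS (σ • stdVec a) D) g).norm
            ((shiftS (σ • stdVec a) D).integrable.norm.const_mul _) ?_
          filter_upwards [ae_norm_le_norm g] with x hx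
          change ‖D (x + σ • stdVec a) * g x‖ ≤ _
          rw [norm_mul, mul_comm]
          exact mul_le_mul_of_nonneg_right hx (norm_nonneg _)
      · refine AEStronglyMeasurable.mul ?_ ?_
        · exact (D.continuous.comp (by fun_prop)).aestronglyMeasurable
        · exact (Lp.aestronglyMeasurable g).comp_snd
  change ‖∫ x, φ x * (g (x + τ • stdVec a) - g x)‖ ≤ _
  rw [e1, e2]
  have e3 : ∀ σ : ℝ, ‖∫ x, D (x + σ • stdVec a) * g x‖ ≤ ‖d‖ * ∫ x, ‖φ x‖ := by
    intro σ
    have h1 : ∫ x, D (x + σ • stdVec a) * g x = -∫ x, φ (x + σ • stdVec a) * d x := by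
      have h2 := integral_lineDeriv_mul_linf h (shiftS (σ • stdVec a) φ)
      simp only [shiftS_apply] at h2
      rw [← h2]
      refine integral_congr_ae (Filter.Eventually.of_forall fun x => ?_)
      beta_reduce
      congr 1
      rw [hD, SchwartzMap.lineDerivOp_apply_eq_fderiv, SchwartzMap.lineDerivOp_apply_eq_fderiv]
      have : (shiftS (σ • stdVec a) φ : Plane → ℂ) = fun x => φ (x + σ • stdVec a) := rfl
      rw [this, fderiv_comp_add_right]
    rw [h1, norm_neg, ← e0 φ (σ • stdVec a), ← integral_const_mul]
    refine norm_integral_le_of_norm_le ((shiftS (σ • stdVec a) φ).integrable.norm.const_mul _) ?_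
    filter_upwards [ae_norm_le_norm d] with x hx
    rw [norm_mul, mul_comm]
    exact mul_le_mul_of_nonneg_right hx (norm_nonneg _)
  refine (intervalIntegral.norm_integral_le_of_norm_le_const fun σ _ => e3 σ).trans (le_of_eq ?_)
  rw [sub_zero, abs_neg]; ring

/-- The distribution `T` is a function in `L^∞` with norm at most `C`. -/
def LinfBound (C : ℝ) (T : 𝓢'(Plane, ℂ)) : Prop :=
  ∃ h : Linf, Lp.toTemperedDistribution h = T ∧ ‖h‖ ≤ C

theorem toTemperedDistribution_linf_injective {g h : Linf}
    (e : Lp.toTemperedDistribution g = Lp.toTemperedDistribution h) : g = h := by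
  have := Lp.ker_toTemperedDistributionCLM_eq_bot (F := ℂ) (μ := (volume : Measure Plane)) (p := ∞)
  exact LinearMap.ker_eq_bot.1 this e

theorem linfBound_of_linftyNorm_le {C : ℝ} (hC : 0 ≤ C) {T : 𝓢'(Plane, ℂ)}
    (h : linftyNorm T ≤ ENNReal.ofReal C) : LinfBound C T := by
  have hlt : linftyNorm T < ∞ := h.trans_lt ENNReal.ofReal_lt_top
  obtain ⟨g, hg⟩ := iInf_lt_iff.1 hlt
  obtain ⟨hgT, -⟩ := iInf_lt_iff.1 hg
  refine ⟨g, hgT, ?_⟩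
  have : ‖g‖ₑ ≤ linftyNorm T := by
    refine le_iInf₂ fun g' hg' => ?_
    rw [toTemperedDistribution_linf_injective (hgT.trans hg'.symm)]
  have h2 := this.trans h
  rw [← ofReal_norm] at h2
  exact (ENNReal.ofReal_le_ofReal_iff hC).1 h2

theorem LinfBound.add {C C' : ℝ} {T U : 𝓢'(Plane, ℂ)} (hT : LinfBound C T) (hU : LinfBound C' U) :
    LinfBound (C + C') (T + U) := by
  obtain ⟨g, rfl, hg⟩ := hT
  obtain ⟨h, rfl, hh⟩ := hU
  exact ⟨g + h, (Lp.toTemperedDistributionCLM ℂ (volume : Measure Plane) ∞).map_add g h,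
    (norm_add_le _ _).trans (add_le_add hg hh)⟩

theorem LinfBound.const_smul {C : ℝ} {T : 𝓢'(Plane, ℂ)} (hT : LinfBound C T) (c : ℂ) :
    LinfBound (‖c‖ * C) (c • T) := by
  obtain ⟨g, rfl, hg⟩ := hT
  exact ⟨c • g, (Lp.toTemperedDistributionCLM ℂ (volume : Measure Plane) ∞).map_smul c g,
    (norm_smul_le _ _).trans (by gcongr)⟩

theorem LinfBound.mono {C C' : ℝ} {T : 𝓢'(Plane, ℂ)} (hT : LinfBound C T) (h : C ≤ C') :
    LinfBound C' T := by
  obtain ⟨g, hg, hg'⟩ := hT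
  exact ⟨g, hg, hg'.trans h⟩

/-- Multiplication by the coordinate `x_a` on tempered distributions. -/
def mulX (a : Fin 2) : 𝓢'(Plane, ℂ) →L[ℂ] 𝓢'(Plane, ℂ) :=
  TemperedDistribution.smulLeftCLM ℂ (fun x : Plane => ((x a : ℝ) : ℂ))

theorem opJ_eq (m t : ℝ) (a : Fin 2) (T : 𝓢'(Plane, ℂ)) :
    opJ m t a T = mulX a T + (Complex.I * (t : ℂ) / (m : ℂ)) • ∂_{stdVec a} T := rfl

/-- The commutator `[∂_a, x_a] = 1`. -/
theorem lineDeriv_mulX (a : Fin 2) (T : 𝓢'(Plane, ℂ)) :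
    ∂_{stdVec a} (mulX a T) = mulX a (∂_{stdVec a} T) + T := by
  rw [temperedDistribution_ext_iff]
  intro φ
  rw [_root_.add_apply, mulX, TemperedDistribution.smulLeftCLM_apply_apply,
    TemperedDistribution.lineDerivOp_apply_apply, TemperedDistribution.lineDerivOp_apply_apply,
    TemperedDistribution.smulLeftCLM_apply_apply]
  rw [← map_add]
  congr 1
  ext x
  have hx := hasTemperateGrowth_coord a
  have e : (SchwartzMap.smulLeftCLM ℂ (fun x : Plane => ((x a : ℝ) : ℂ)) φ : Plane → ℂ)
      = fun y => ((y a : ℝ) : ℂ) * φ y := by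
    ext y; rw [SchwartzMap.smulLeftCLM_apply_apply hx]; rfl
  simp only [SchwartzMap.smulLeftCLM_apply_apply hx, _root_.add_apply, _root_.neg_apply,
    SchwartzMap.lineDerivOp_apply_eq_fderiv, e]
  have h1 : HasFDerivAt (fun y : Plane => ((y a : ℝ) : ℂ))
      (Complex.ofRealCLM.comp (EuclideanSpace.proj a : Plane →L[ℝ] ℝ)) x :=
    (Complex.ofRealCLM.comp (EuclideanSpace.proj a : Plane →L[ℝ] ℝ)).hasFDerivAt
  have h2 : fderiv ℝ (fun y : Plane => ((y a : ℝ) : ℂ) * φ y) x = _ :=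
    (h1.mul (φ.differentiableAt (x := x)).hasFDerivAt).fderiv
  rw [h2]
  simp [stdVec_apply]

theorem coeFn_of_mulX {a : Fin 2} {g h : Linf}
    (e : Lp.toTemperedDistribution h = mulX a (Lp.toTemperedDistribution g)) :
    h =ᵐ[volume] fun x => ((x a : ℝ) : ℂ) * g x := by
  refine ae_eq_of_integral_schwartz_eq (locallyIntegrable_linf h)
    ((locallyIntegrable_linf g).continuous_mul (by fun_prop)) fun φ => ?_
  have h1 := temperedDistribution_ext_iff.1 e φ
  rw [mulX, TemperedDistribution.smulLeftCLM_apply_apply, Lp.toTemperedDistribution_apply,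
    Lp.toTemperedDistribution_apply] at h1
  simp only [smul_eq_mul, SchwartzMap.smulLeftCLM_apply_apply (hasTemperateGrowth_coord a)] at h1
  rw [h1]
  refine integral_congr_ae (Filter.Eventually.of_forall fun x => ?_)
  beta_reduce
  ring

/-- If `∂_a g ∈ L^∞`, then `weakPartial` takes its genuine branch. -/
theorem weakPartial_spec {C : ℝ} {a : Fin 2} {g : Linf}
    (h : LinfBound C (∂_{stdVec a} (Lp.toTemperedDistribution g))) :
    Lp.toTemperedDistribution (weakPartial a g) = ∂_{stdVec a} (Lp.toTemperedDistribution g) ∧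
      ‖weakPartial a g‖ ≤ C := by
  obtain ⟨d, hd, hdC⟩ := h
  have hex : ∃ d : Linf, Lp.toTemperedDistribution d =
    ∂_{stdVec a} (Lp.toTemperedDistribution g) := ⟨d, hd⟩
  have h1 : Lp.toTemperedDistribution (weakPartial a g)
      = ∂_{stdVec a} (Lp.toTemperedDistribution g) := by
    rw [weakPartial, dif_pos hex]; exact hex.choose_spec
  refine ⟨h1, ?_⟩
  rwa [toTemperedDistribution_linf_injective (h1.trans hd.symm)]

/-- The bounds on a coefficient at a fixed time `t`, with `s = ⟨t⟩`, that enter the energy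
estimate. -/
structure CoeffBound (s W : ℝ) (g : Linf) : Prop where
  norm_weakPartial : ∀ b, ‖weakPartial b g‖ ≤ W / s
  weakPartial_eq : ∀ b, Lp.toTemperedDistribution (weakPartial b g)
    = ∂_{stdVec b} (Lp.toTemperedDistribution g)
  norm_mul_le : ∀ a, ∀ᵐ x, ‖g x * ((s ^ 2 + x a ^ 2 : ℝ) : ℂ)‖ ≤ W * s
  norm_sub_le : ∀ a, ∀ τ : ℝ, ∀ᵐ x, ‖g (x + τ • stdVec a) *
    ((s ^ 2 + (x + τ • stdVec a) a ^ 2 : ℝ) : ℂ) - g x * ((s ^ 2 + x a ^ 2 : ℝ) : ℂ)‖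
      ≤ W * s * (1 + |x a| / s) * |τ|

theorem one_le_bracket (t : ℝ) : 1 ≤ bracket t := by
  rw [bracket, Real.one_le_sqrt]; nlinarith [sq_nonneg t]

theorem abs_le_bracket (t : ℝ) : |t| ≤ bracket t := by
  rw [bracket]; exact Real.abs_le_sqrt (by linarith)

/-- Since `x_a = J_a - (i t / m) ∂_a`, bounds on the derivatives of `J^β g` give pointwise bounds on
`x_a g`, on `∂_a (x_a g)` and on `x_a² g`. -/
theorem coeffBound_of_linfBound {m t ω : ℝ} {g : Linf} (hω : 0 ≤ ω)
    (h0 : LinfBound (ω / bracket t) (Lp.toTemperedDistribution g))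
    (h1 : ∀ b, LinfBound (ω / bracket t) (∂_{stdVec b} (Lp.toTemperedDistribution g)))
    (h2 : ∀ a, LinfBound (ω / bracket t) (∂_{stdVec a} (∂_{stdVec a} (Lp.toTemperedDistribution g))))
    (hJ : ∀ a, LinfBound ω (opJ m t a (Lp.toTemperedDistribution g)))
    (hdJ : ∀ a, LinfBound ω (∂_{stdVec a} (opJ m t a (Lp.toTemperedDistribution g))))
    (hJJ : ∀ a, LinfBound (ω * bracket t) (opJ m t a (opJ m t a (Lp.toTemperedDistribution g)))) :
    CoeffBound (bracket t) (4 * (1 + |m|⁻¹) ^ 2 * ω) g := by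
  set s := bracket t with hs
  have hs1 : 1 ≤ s := one_le_bracket t
  have hs0 : 0 < s := by linarith
  set c : ℂ := Complex.I * (t : ℂ) / (m : ℂ) with hc
  set n : ℝ := |m|⁻¹ with hn
  have hn0 : 0 ≤ n := by positivity
  have hcn : ‖c‖ ≤ s * n := by
    rw [hc, norm_div, norm_mul, Complex.norm_I, one_mul, Complex.norm_real, Complex.norm_real,
      div_eq_mul_inv]
    exact mul_le_mul_of_nonneg_right (abs_le_bracket t) hn0
  have hcn' : ‖-c‖ ≤ s * n := by rwa [norm_neg]
  set T := Lp.toTemperedDistribution g with hT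
  have hω' : ω / s ≤ ω := div_le_self hω hs1
  -- `x_a g` and its derivative
  have hX : ∀ a, LinfBound ((1 + n) * ω) (mulX a T) := by
    intro a
    have e : mulX a T = opJ m t a T + (-c) • ∂_{stdVec a} T := by
      rw [opJ_eq]; module
    rw [e]
    refine ((hJ a).add ((h1 a).const_smul (-c))).mono ?_
    calc ω + ‖-c‖ * (ω / s) ≤ ω + s * n * (ω / s) := by gcongr
      _ = _ := by field_simp
  have hdX : ∀ a, LinfBound ((1 + n) * ω) (∂_{stdVec a} (mulX a T)) := by
    intro a
    have e : ∂_{stdVec a} (mulX a T) = ∂_{stdVec a} (opJ m t a T)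
        + (-c) • ∂_{stdVec a} (∂_{stdVec a} T) := by
      rw [opJ_eq, LineDeriv.lineDerivOp_add, LineDeriv.lineDerivOp_smul]; module
    rw [e]
    refine ((hdJ a).add ((h2 a).const_smul (-c))).mono ?_
    calc ω + ‖-c‖ * (ω / s) ≤ ω + s * n * (ω / s) := by gcongr
      _ = _ := by field_simp
  -- `x_a² g`
  have hXX : ∀ a, LinfBound ((1 + n) * (1 + 2 * n) * ω * s) (mulX a (mulX a T)) := by
    intro a
    have e : mulX a (mulX a T) = opJ m t a (opJ m t a T) + (-c) • ∂_{stdVec a} (opJ m t a T)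
        + (-c) • (∂_{stdVec a} (mulX a T) + (-1 : ℂ) • T) := by
      rw [lineDeriv_mulX, opJ_eq m t a (opJ m t a T)]
      rw [opJ_eq m t a T, map_add, map_smul]
      module
    rw [e]
    refine (((hJJ a).add ((hdJ a).const_smul (-c))).add
      (((hdX a).add (h0.const_smul (-1))).const_smul (-c))).mono ?_
    have e1 : ‖(-1 : ℂ)‖ = 1 := by simp
    rw [e1, one_mul]
    calc ω * s + ‖-c‖ * ω + ‖-c‖ * ((1 + n) * ω + ω / s)
        ≤ ω * s + s * n * ω + s * n * ((1 + n) * ω + ω) := by gcongr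
      _ ≤ _ := by
        have : 0 ≤ n * n * (ω * s) := by positivity
        nlinarith
  choose X hXT hXn using hX
  choose DX hDXT hDXn using hdX
  choose XX hXXT hXXn using hXX
  have hw := fun b => weakPartial_spec (h1 b)
  have hn2 : 1 ≤ (1 + n) ^ 2 := by nlinarith
  have hW : ω ≤ 4 * (1 + n) ^ 2 * ω := by nlinarith
  have hg : ‖g‖ ≤ ω / s := by
    obtain ⟨g', hg', hn'⟩ := h0
    rwa [← toTemperedDistribution_linf_injective hg']
  have eX : ∀ a, X a =ᵐ[volume] fun x => ((x a : ℝ) : ℂ) * g x := fun a => coeFn_of_mulX (hXT a)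
  refine ⟨fun b => (hw b).2.trans (by gcongr), fun b => (hw b).1, fun a => ?_, fun a τ => ?_⟩
  · have eXX : XX a =ᵐ[volume] fun x => ((x a : ℝ) : ℂ) * X a x :=
      coeFn_of_mulX ((hXXT a).trans (by rw [hXT]))
    filter_upwards [eX a, eXX, ae_norm_le_norm (XX a), ae_norm_le_norm g] with x k1 k2 k3 k4
    have e : g x * ((s ^ 2 + x a ^ 2 : ℝ) : ℂ) = (s : ℂ) ^ 2 * g x + XX a x := by
      rw [k2, k1]; push_cast; ring
    rw [e]
    refine (norm_add_le _ _).trans ?_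
    rw [norm_mul, norm_pow, Complex.norm_real, Real.norm_of_nonneg hs0.le]
    calc s ^ 2 * ‖g x‖ + ‖XX a x‖ ≤ s ^ 2 * (ω / s) + (1 + n) * (1 + 2 * n) * ω * s := by
          gcongr
          · exact k4.trans hg
          · exact k3.trans (hXXn a)
      _ = (1 + (1 + n) * (1 + 2 * n)) * (ω * s) := by field_simp
      _ ≤ (4 * (1 + n) ^ 2) * (ω * s) := by gcongr; nlinarith
      _ = _ := by ring
  · have l1 := ae_norm_shift_sub_le (hw a).1 τ
    have l2 := ae_norm_shift_sub_le (g := X a) (d := DX a) (by rw [hDXT, hXT]) τ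
    have hq := (measurePreserving_add_right (volume : Measure Plane)
      (τ • stdVec a)).quasiMeasurePreserving
    filter_upwards [eX a, hq.ae_eq_comp (eX a), l1, l2,
      hq.ae (ae_norm_le_norm (X a))] with x k1 k2 k3 k4 k5
    simp only [Function.comp_def] at k2
    have hxa : (x + τ • stdVec a) a = x a + τ := by rw [coord_add, if_pos rfl]
    rw [hxa] at k2 ⊢
    have e : g (x + τ • stdVec a) * ((s ^ 2 + (x a + τ) ^ 2 : ℝ) : ℂ)
        - g x * ((s ^ 2 + x a ^ 2 : ℝ) : ℂ)
        = (s : ℂ) ^ 2 * (g (x + τ • stdVec a) - g x)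
          + (x a : ℂ) * (X a (x + τ • stdVec a) - X a x) + (τ : ℂ) * X a (x + τ • stdVec a) := by
      rw [k1, k2]; push_cast; ring
    rw [e]
    refine (norm_add₃_le).trans ?_
    rw [norm_mul, norm_mul, norm_mul, norm_pow, Complex.norm_real, Complex.norm_real,
      Complex.norm_real, Real.norm_of_nonneg hs0.le, Real.norm_eq_abs, Real.norm_eq_abs]
    calc s ^ 2 * ‖g (x + τ • stdVec a) - g x‖ + |x a| * ‖X a (x + τ • stdVec a) - X a x‖
          + |τ| * ‖X a (x + τ • stdVec a)‖
        ≤ s ^ 2 * (ω / s * |τ|) + |x a| * ((1 + n) * ω * |τ|) + |τ| * ((1 + n) * ω) := by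
          gcongr
          · exact k3.trans (by gcongr; exact (hw a).2)
          · exact k4.trans (by gcongr; exact hDXn a)
          · exact k5.trans (hXn a)
      _ = (s + (|x a| + 1) * (1 + n)) * (ω * |τ|) := by field_simp; ring
      _ ≤ (4 * (1 + n) ^ 2 * (s + |x a|)) * (ω * |τ|) := by
          gcongr
          have hx0 := abs_nonneg (x a)
          have : 1 + n ≤ (1 + n) ^ 2 := by nlinarith
          calc s + (|x a| + 1) * (1 + n) ≤ (1 + n) ^ 2 * s + (|x a| + s) * (1 + n) ^ 2 := by
                gcongr
                nlinarith
            _ ≤ _ := by nlinarith [mul_nonneg (sq_nonneg (1 + n)) hx0, mul_nonneg (sq_nonneg (1 + n)) hs0.le]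
      _ = _ := by field_simp

/-- Every term of the sum in `bigOmega` is bounded by `ω`; only the multi-indices that are multiples
of a unit vector are used. -/
theorem coeffBound_of_bigOmega_le {N : ℕ} (μ : Fin N ⊕ Fin N → ℝ) (g : Coeff N) {t₀ T ω : ℝ}
    (hω : 0 ≤ ω) (h : bigOmega μ g t₀ T ≤ ENNReal.ofReal ω) {t : ℝ} (ht : t ∈ Ico t₀ T)
    (j : Fin N) (k : Fin N ⊕ Fin N) (a : Fin 2) :
    CoeffBound (bracket t) (4 * (1 + |μ k|⁻¹) ^ 2 * ω) (g t j k a) := by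
  have hs0 : 0 < bracket t := by linarith [one_le_bracket t]
  set f := Lp.toTemperedDistribution (g t j k a) with hf
  have key : ∀ β ∈ multiIndices 2, ∀ α ∈ multiIndices (2 - (β.1 + β.2)),
      LinfBound (ω * (bracket t ^ (1 - ((β.1 + β.2 : ℕ) : ℤ)))⁻¹)
        (partialPow α (opJPow (μ k) t β f)) := by
    intro β hβ α hα
    have hz : 0 < bracket t ^ (1 - ((β.1 + β.2 : ℕ) : ℤ)) := zpow_pos hs0 _
    refine linfBound_of_linftyNorm_le (by positivity) ?_
    have h1 : ENNReal.ofReal (bracket t ^ (1 - ((β.1 + β.2 : ℕ) : ℤ))) *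
        linftyNorm (partialPow α (opJPow (μ k) t β f)) ≤ ENNReal.ofReal ω := by
      refine le_trans ?_ h
      rw [bigOmega]
      refine le_trans ?_ (le_iSup₂ (f := fun t (_ : t ∈ Ico t₀ T) =>
        ∑ β ∈ multiIndices 2, ∑ j, ∑ k, ∑ a,
          ENNReal.ofReal (bracket t ^ (1 - ((β.1 + β.2 : ℕ) : ℤ))) *
          sobolevNorm (2 - (β.1 + β.2))
            (opJPow (μ k) t β (Lp.toTemperedDistribution (g t j k a)))) t ht)
      have s1 : linftyNorm (partialPow α (opJPow (μ k) t β f))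
          ≤ sobolevNorm (2 - (β.1 + β.2)) (opJPow (μ k) t β f) :=
        Finset.single_le_sum (f := fun α => linftyNorm (partialPow α (opJPow (μ k) t β f)))
          (fun _ _ => zero_le) hα
      have s2 := Finset.single_le_sum (f := fun β : ℕ × ℕ => ∑ j, ∑ k, ∑ a,
          ENNReal.ofReal (bracket t ^ (1 - ((β.1 + β.2 : ℕ) : ℤ))) *
          sobolevNorm (2 - (β.1 + β.2))
            (opJPow (μ k) t β (Lp.toTemperedDistribution (g t j k a))))
          (fun _ _ => zero_le) hβ
      refine le_trans ?_ s2
      refine le_trans ?_ (Finset.single_le_sum (fun _ _ => zero_le) (Finset.mem_univ j))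
      refine le_trans ?_ (Finset.single_le_sum (fun _ _ => zero_le) (Finset.mem_univ k))
      refine le_trans ?_ (Finset.single_le_sum (fun _ _ => zero_le) (Finset.mem_univ a))
      gcongr
    have hne : ENNReal.ofReal (bracket t ^ (1 - ((β.1 + β.2 : ℕ) : ℤ))) ≠ 0 := by
      simpa using hz
    rw [ENNReal.ofReal_mul hω, ENNReal.ofReal_inv_of_pos hz, ← div_eq_mul_inv]
    rw [ENNReal.le_div_iff_mul_le (Or.inl hne) (Or.inl ENNReal.ofReal_ne_top), mul_comm]
    exact h1
  -- The weights `⟨t⟩^{1 - |β|}` for `|β| = 0, 1, 2`.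
  have m0 : ((0, 0) : ℕ × ℕ) ∈ multiIndices 2 := by decide
  have z0 : ω * (bracket t ^ (1 - ((0 + 0 : ℕ) : ℤ)))⁻¹ = ω / bracket t := by
    norm_num [div_eq_mul_inv]
  have z1 : ω * (bracket t ^ (0 : ℤ))⁻¹ = ω := by norm_num
  have z2 : ω * (bracket t ^ (-1 : ℤ))⁻¹ = ω * bracket t := by norm_num
  have k0 := key (0, 0) m0
  rw [z0] at k0
  have k1 := key (1, 0) (by decide)
  have k1' := key (0, 1) (by decide)
  have k2 := key (2, 0) (by decide)
  have k2' := key (0, 2) (by decide)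
  norm_num only at k1 k1' k2 k2'
  rw [z1] at k1 k1'
  rw [z2] at k2 k2'
  refine coeffBound_of_linfBound (m := μ k) hω (k0 (0, 0) (by decide)) ?_ ?_ ?_ ?_ ?_
  · intro b
    fin_cases b
    · exact k0 (1, 0) (by decide)
    · exact k0 (0, 1) (by decide)
  · intro b
    fin_cases b
    · exact k0 (2, 0) (by decide)
    · exact k0 (0, 2) (by decide)
  · intro b
    fin_cases b
    · exact k1 (0, 0) (by decide)
    · exact k1' (0, 0) (by decide)
  · intro b
    fin_cases b
    · exact k1 (1, 0) (by decide)
    · exact k1' (0, 1) (by decide)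
  · intro b
    fin_cases b
    · exact k2 (0, 0) (by decide)
    · exact k2' (0, 0) (by decide)

/-! ### Resolvents of the Laplacian -/

theorem HasD.unique {a : Fin 2} {f d d' : H} (h : HasD a f d) (h' : HasD a f d') : d = d' := by
  apply ft.injective
  refine Lp.ext ?_
  filter_upwards [hasD_iff_ft.1 h, hasD_iff_ft.1 h'] with ξ h1 h2
  rw [h1, h2]

/-- Pointwise bounded convergence of symbols implies strong convergence of the multipliers. -/
theorem tendsto_fourierMul {σ : ℕ → Plane → ℂ} {σ₀ : Plane → ℂ} {C : ℝ}
    (hσ : ∀ n, MemLp (σ n) ∞ volume) (hσ₀ : MemLp σ₀ ∞ volume)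
    (hC : ∀ n ξ, ‖σ n ξ - σ₀ ξ‖ ≤ C)
    (hlim : ∀ ξ, Filter.Tendsto (fun n => σ n ξ) Filter.atTop (nhds (σ₀ ξ))) (f : H) :
    Filter.Tendsto (fun n => fourierMul (σ n) f) Filter.atTop (nhds (fourierMul σ₀ f)) := by
  rw [tendsto_iff_norm_sub_tendsto_zero]
  have e : ∀ n, ‖fourierMul (σ n) f - fourierMul σ₀ f‖ ^ 2
      = (∫⁻ ξ, (‖σ n ξ - σ₀ ξ‖ₑ * ‖ft f ξ‖ₑ) ^ 2).toReal := by
    intro n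
    have h1 := lintegral_enorm_sq (ft (fourierMul (σ n) f - fourierMul σ₀ f))
    rw [norm_ft] at h1
    rw [← ENNReal.toReal_ofReal (sq_nonneg ‖fourierMul (σ n) f - fourierMul σ₀ f‖), ← h1]
    congr 1
    refine lintegral_congr_ae ?_
    rw [map_sub]
    filter_upwards [coeFn_ft_fourierMul (hσ n) f, coeFn_ft_fourierMul hσ₀ f,
      Lp.coeFn_sub (ft (fourierMul (σ n) f)) (ft (fourierMul σ₀ f))] with ξ h1 h2 h3
    rw [h3, Pi.sub_apply, h1, h2, ← sub_mul, enorm_mul]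
  have hlim2 : Filter.Tendsto (fun n => ∫⁻ ξ, (‖σ n ξ - σ₀ ξ‖ₑ * ‖ft f ξ‖ₑ) ^ 2) Filter.atTop
      (nhds (∫⁻ _ξ : Plane, 0)) := by
    refine tendsto_lintegral_of_dominated_convergence'
      (fun ξ => (ENNReal.ofReal C) ^ 2 * ‖ft f ξ‖ₑ ^ 2) (fun n => ?_) (fun n => ?_) ?_ ?_
    · exact ((((hσ n).aestronglyMeasurable.sub hσ₀.aestronglyMeasurable).enorm).mul
        (Lp.aestronglyMeasurable (ft f)).enorm).pow_const 2
    · refine Filter.Eventually.of_forall fun ξ => ?_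
      beta_reduce
      rw [← mul_pow]
      gcongr
      rw [← ofReal_norm]
      exact ENNReal.ofReal_le_ofReal (hC n ξ)
    · rw [lintegral_const_mul' _ _ (by simp), lintegral_enorm_sq]
      exact ENNReal.mul_ne_top (by simp) ENNReal.ofReal_ne_top
    · refine Filter.Eventually.of_forall fun ξ => ?_
      have h1 : Filter.Tendsto (fun n => ‖σ n ξ - σ₀ ξ‖ₑ) Filter.atTop (nhds 0) := by
        have := ((hlim ξ).sub_const (σ₀ ξ)).enorm
        simpa using this
      have h2 := ENNReal.Tendsto.mul_const h1 (b := ‖ft f ξ‖ₑ) (Or.inr (by simp))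
      have h3 := ENNReal.Tendsto.pow h2 (n := 2)
      simpa using h3
  rw [lintegral_zero] at hlim2
  have h2 := (ENNReal.tendsto_toReal ENNReal.zero_ne_top).comp hlim2
  have h3 : Filter.Tendsto (fun n => Real.sqrt (‖fourierMul (σ n) f - fourierMul σ₀ f‖ ^ 2))
      Filter.atTop (nhds (Real.sqrt 0)) := by
    refine (Real.continuous_sqrt.tendsto 0).comp ?_
    simp only [e]
    exact h2
  simpa [Real.sqrt_sq (norm_nonneg _)] using h3

/-- The symbol `(1 + ε² (2π|ξ|)²)⁻¹` of the resolvent `(1 - ε² Δ)⁻¹`. -/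
def rsym (ε : ℝ) (ξ : Plane) : ℂ := (((1 + ‖(2 * Real.pi * ε) • ξ‖ ^ 2)⁻¹ : ℝ) : ℂ)

theorem norm_rsym (ε : ℝ) (ξ : Plane) : ‖rsym ε ξ‖ = (1 + ‖(2 * Real.pi * ε) • ξ‖ ^ 2)⁻¹ := by
  rw [rsym, Complex.norm_real, Real.norm_of_nonneg (by positivity)]

theorem norm_dsym_le (ε : ℝ) (a : Fin 2) (ξ : Plane) :
    |ε| * ‖dsym a ξ‖ ≤ ‖(2 * Real.pi * ε) • ξ‖ := by
  have h := EuclideanSpace.norm_eq ξ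
  have h1 : |ξ a| ≤ ‖ξ‖ := by simpa using PiLp.norm_apply_le ξ a
  rw [norm_smul, norm_dsym, Real.norm_eq_abs, abs_mul, abs_of_pos (by positivity : 0 < 2 * Real.pi)]
  have := mul_le_mul_of_nonneg_left h1 (by positivity : 0 ≤ |ε| * (2 * Real.pi))
  linarith

theorem norm_rsym_le (ε : ℝ) (ξ : Plane) : ‖rsym ε ξ‖ ≤ 1 := by
  rw [norm_rsym]
  exact inv_le_one_of_one_le₀ (by nlinarith [sq_nonneg ‖(2 * Real.pi * ε) • ξ‖])

theorem abs_mul_norm_dsym_mul_rsym_le (ε : ℝ) (a : Fin 2) (ξ : Plane) :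
    |ε| * ‖dsym a ξ * rsym ε ξ‖ ≤ 1 := by
  rw [norm_mul, norm_rsym, ← mul_assoc, ← div_eq_mul_inv, div_le_one (by positivity)]
  nlinarith [norm_dsym_le ε a ξ, sq_nonneg (‖(2 * Real.pi * ε) • ξ‖ - 1),
    norm_nonneg ((2 * Real.pi * ε) • ξ)]

theorem sq_mul_norm_dsym_mul_dsym_mul_rsym_le (ε : ℝ) (a b : Fin 2) (ξ : Plane) :
    ε ^ 2 * ‖dsym b ξ * (dsym a ξ * rsym ε ξ)‖ ≤ 1 := by
  have h1 := norm_dsym_le ε a ξ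
  have h2 := norm_dsym_le ε b ξ
  have h3 := mul_le_mul h2 h1 (by positivity) (norm_nonneg _)
  rw [norm_mul, norm_mul, norm_rsym, ← mul_assoc, ← mul_assoc, ← div_eq_mul_inv,
    div_le_one (by positivity), ← sq_abs ε]
  nlinarith

theorem rsym_add_sum (ε : ℝ) (ξ : Plane) :
    rsym ε ξ - (ε : ℂ) ^ 2 * ∑ b, dsym b ξ * (dsym b ξ * rsym ε ξ) = 1 := by
  have h : (((1 + ‖(2 * Real.pi * ε) • ξ‖ ^ 2 : ℝ)) : ℂ) ≠ 0 := by
    have : (0 : ℝ) < 1 + ‖(2 * Real.pi * ε) • ξ‖ ^ 2 := by positivity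
    exact_mod_cast this.ne'
  have e1 : ‖(2 * Real.pi * ε) • ξ‖ ^ 2 = (2 * Real.pi * ε) ^ 2 * (ξ 0 ^ 2 + ξ 1 ^ 2) := by
    rw [norm_smul, mul_pow, Real.norm_eq_abs, sq_abs, EuclideanSpace.norm_sq_eq]
    simp
  have e2 : rsym ε ξ - (ε : ℂ) ^ 2 * ∑ b, dsym b ξ * (dsym b ξ * rsym ε ξ)
      = (((1 + ‖(2 * Real.pi * ε) • ξ‖ ^ 2 : ℝ)) : ℂ) * rsym ε ξ := by
    rw [e1, Fin.sum_univ_two]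
    simp only [dsym]
    push_cast
    linear_combination (-4 * (Real.pi : ℂ) ^ 2 * (ε : ℂ) ^ 2 * ((ξ 0 : ℂ) ^ 2 + (ξ 1 : ℂ) ^ 2) * rsym ε ξ) * Complex.I_sq
  rw [e2, rsym, Complex.ofReal_inv, mul_inv_cancel₀ h]

theorem continuous_rsym (ε : ℝ) : Continuous (rsym ε) := by
  unfold rsym
  refine Complex.continuous_ofReal.comp (Continuous.inv₀ (by fun_prop) fun x => ?_)
  positivity

theorem memLp_rsym (ε : ℝ) : MemLp (rsym ε) ∞ volume :=
  memLp_top_of_bound (continuous_rsym ε).aestronglyMeasurable 1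
    (Filter.Eventually.of_forall (norm_rsym_le ε))

theorem memLp_dsym_mul_rsym {ε : ℝ} (hε : 0 < ε) (a : Fin 2) :
    MemLp (fun ξ => dsym a ξ * rsym ε ξ) ∞ volume := by
  refine memLp_top_of_bound ((continuous_dsym a).mul (continuous_rsym ε)).aestronglyMeasurable ε⁻¹
    (Filter.Eventually.of_forall fun ξ => ?_)
  have := abs_mul_norm_dsym_mul_rsym_le ε a ξ
  rw [abs_of_pos hε] at this
  rwa [inv_eq_one_div, le_div_iff₀' hε]

theorem memLp_dsym_mul_dsym_mul_rsym {ε : ℝ} (hε : 0 < ε) (a b : Fin 2) :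
    MemLp (fun ξ => dsym b ξ * (dsym a ξ * rsym ε ξ)) ∞ volume := by
  refine memLp_top_of_bound ((continuous_dsym b).mul
    ((continuous_dsym a).mul (continuous_rsym ε))).aestronglyMeasurable (ε ^ 2)⁻¹
    (Filter.Eventually.of_forall fun ξ => ?_)
  have := sq_mul_norm_dsym_mul_dsym_mul_rsym_le ε a b ξ
  rwa [inv_eq_one_div, le_div_iff₀' (by positivity)]

theorem hasTemperateGrowth_rsym (ε : ℝ) : (rsym ε).HasTemperateGrowth := by
  have h1 := Function.hasTemperateGrowth_one_add_norm_sq_rpow Plane (-1)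
  have h2 : (fun ξ : Plane => (2 * Real.pi * ε) • ξ).HasTemperateGrowth := by
    have := ((2 * Real.pi * ε) • ContinuousLinearMap.id ℝ Plane).hasTemperateGrowth
    exact this
  have h3 := Complex.ofRealCLM.hasTemperateGrowth.comp (h1.comp h2)
  convert h3 using 1
  ext ξ
  simp [rsym, Real.rpow_neg_one]

/-- The resolvent `R = (1 - ε² Δ)⁻¹`. -/
def res (ε : ℝ) : H →L[ℂ] H := fourierMul (rsym ε)

/-- The operator `R ∂_a`. -/
def resD (ε : ℝ) (a : Fin 2) : H →L[ℂ] H := fourierMul fun ξ => dsym a ξ * rsym ε ξ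

/-- The operator `R ∂_a ∂_b`. -/
def resDD (ε : ℝ) (a b : Fin 2) : H →L[ℂ] H :=
  fourierMul fun ξ => dsym b ξ * (dsym a ξ * rsym ε ξ)

theorem hasD_res {ε : ℝ} (hε : 0 < ε) (a : Fin 2) (f : H) : HasD a (res ε f) (resD ε a f) :=
  hasD_fourierMul_of_symbol (memLp_rsym ε) (memLp_dsym_mul_rsym hε a) (fun _ => rfl) f

theorem hasD_resD {ε : ℝ} (hε : 0 < ε) (a b : Fin 2) (f : H) :
    HasD b (resD ε a f) (resDD ε a b f) :=
  hasD_fourierMul_of_symbol (memLp_dsym_mul_rsym hε a) (memLp_dsym_mul_dsym_mul_rsym hε a b)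
    (fun _ => rfl) f

theorem norm_res_le (ε : ℝ) (f : H) : ‖res ε f‖ ≤ ‖f‖ := by
  simpa [res] using norm_fourierMul_le (memLp_rsym ε)
    (Filter.Eventually.of_forall (norm_rsym_le ε)) f

theorem norm_resD_le {ε : ℝ} (hε : 0 < ε) (a : Fin 2) (f : H) : ‖(ε : ℂ) • resD ε a f‖ ≤ ‖f‖ := by
  have h := norm_fourierMul_le (memLp_dsym_mul_rsym hε a) (C := ε⁻¹)
    (Filter.Eventually.of_forall fun ξ => ?_) f
  · rw [norm_smul, Complex.norm_real, Real.norm_of_nonneg hε.le]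
    calc ε * ‖resD ε a f‖ ≤ ε * (ε⁻¹ * ‖f‖) := by gcongr; exact h
      _ = _ := by field_simp
  · have := abs_mul_norm_dsym_mul_rsym_le ε a ξ
    rw [abs_of_pos hε] at this
    rwa [inv_eq_one_div, le_div_iff₀' hε]

theorem norm_resDD_le {ε : ℝ} (hε : 0 < ε) (a b : Fin 2) (f : H) :
    ‖((ε ^ 2 : ℝ) : ℂ) • resDD ε a b f‖ ≤ ‖f‖ := by
  have h := norm_fourierMul_le (memLp_dsym_mul_dsym_mul_rsym hε a b) (C := (ε ^ 2)⁻¹)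
    (Filter.Eventually.of_forall fun ξ => ?_) f
  · rw [norm_smul, Complex.norm_real, Real.norm_of_nonneg (by positivity)]
    calc ε ^ 2 * ‖resDD ε a b f‖ ≤ ε ^ 2 * ((ε ^ 2)⁻¹ * ‖f‖) := by gcongr; exact h
      _ = _ := by field_simp
  · have := sq_mul_norm_dsym_mul_dsym_mul_rsym_le ε a b ξ
    rwa [inv_eq_one_div, le_div_iff₀' (by positivity)]

theorem res_sub_sum {ε : ℝ} (hε : 0 < ε) (f : H) :
    res ε f - ((ε ^ 2 : ℝ) : ℂ) • ∑ b, resDD ε b b f = f := by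
  apply ft.injective
  refine Lp.ext ?_
  rw [map_sub, map_smul, Fin.sum_univ_two, map_add]
  filter_upwards [coeFn_ft_fourierMul (memLp_rsym ε) f,
    coeFn_ft_fourierMul (memLp_dsym_mul_dsym_mul_rsym hε 0 0) f,
    coeFn_ft_fourierMul (memLp_dsym_mul_dsym_mul_rsym hε 1 1) f,
    Lp.coeFn_sub (ft (res ε f)) (((ε ^ 2 : ℝ) : ℂ) • (ft (resDD ε 0 0 f) + ft (resDD ε 1 1 f))),
    Lp.coeFn_smul (((ε ^ 2 : ℝ) : ℂ)) (ft (resDD ε 0 0 f) + ft (resDD ε 1 1 f)),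
    Lp.coeFn_add (ft (resDD ε 0 0 f)) (ft (resDD ε 1 1 f))] with ξ h1 h2 h3 h4 h5 h6
  rw [h4, Pi.sub_apply, h5, Pi.smul_apply, h6, Pi.add_apply, res, resDD, resDD, h1, h2, h3]
  have := rsym_add_sum ε ξ
  rw [Fin.sum_univ_two] at this
  rw [smul_eq_mul]
  push_cast
  linear_combination (ft f ξ) * this

theorem HasD.res_comm {ε : ℝ} (hε : 0 < ε) {a : Fin 2} {f d : H} (h : HasD a f d) :
    res ε d = resD ε a f :=
  (h.multiplier (memLp_rsym ε)).unique (hasD_res hε a f)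

theorem HasD.resD_comm {ε : ℝ} (hε : 0 < ε) {a b : Fin 2} {f d : H} (h : HasD b f d) :
    resD ε a d = resDD ε a b f :=
  (h.multiplier (memLp_dsym_mul_rsym hε a)).unique (hasD_resD hε a b f)

theorem res_star {ε : ℝ} (hε : 0 < ε) (f : H) : res ε (star f) = star (res ε f) := by
  have h1 : ∀ b, HasD b (star (res ε f)) (star (resD ε b f)) := fun b => (hasD_res hε b f).conj
  have h2 : ∀ b, HasD b (star (resD ε b f)) (star (resDD ε b b f)) :=
    fun b => (hasD_resD hε b b f).conj
  have e1 : star f = star (res ε f) - ((ε ^ 2 : ℝ) : ℂ) • ∑ b, star (resDD ε b b f) := by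
    conv_lhs => rw [← res_sub_sum hε f]
    rw [Fin.sum_univ_two, Fin.sum_univ_two]
    refine Lp.ext ?_
    filter_upwards [coeFn_star_eq (res ε f - ((ε ^ 2 : ℝ) : ℂ) • (resDD ε 0 0 f + resDD ε 1 1 f)),
      Lp.coeFn_sub (res ε f) (((ε ^ 2 : ℝ) : ℂ) • (resDD ε 0 0 f + resDD ε 1 1 f)),
      Lp.coeFn_smul ((ε ^ 2 : ℝ) : ℂ) (resDD ε 0 0 f + resDD ε 1 1 f),
      Lp.coeFn_add (resDD ε 0 0 f) (resDD ε 1 1 f), coeFn_star_eq (res ε f),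
      coeFn_star_eq (resDD ε 0 0 f), coeFn_star_eq (resDD ε 1 1 f),
      Lp.coeFn_sub (star (res ε f))
        (((ε ^ 2 : ℝ) : ℂ) • (star (resDD ε 0 0 f) + star (resDD ε 1 1 f))),
      Lp.coeFn_smul ((ε ^ 2 : ℝ) : ℂ) (star (resDD ε 0 0 f) + star (resDD ε 1 1 f)),
      Lp.coeFn_add (star (resDD ε 0 0 f)) (star (resDD ε 1 1 f))]
      with x h1 h2 h3 h4 h5 h6 h7 h8 h9 h10
    rw [h1, h2, h8, Pi.sub_apply, Pi.sub_apply, h3, h9, Pi.smul_apply, Pi.smul_apply, h4, h10,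
      Pi.add_apply, Pi.add_apply, h5, h6, h7, smul_eq_mul, smul_eq_mul, map_sub, map_mul, map_add,
      Complex.conj_ofReal]
  have e2 : ∀ b, res ε (star (resDD ε b b f)) = resDD ε b b (star (res ε f)) := by
    intro b
    rw [(h2 b).res_comm hε, (h1 b).resD_comm hε]
  rw [e1, map_sub, map_smul, map_sum]
  simp only [e2]
  exact res_sub_sum hε _

theorem resD_star {ε : ℝ} (hε : 0 < ε) (a : Fin 2) (f : H) :
    resD ε a (star f) = star (resD ε a f) := by
  refine (hasD_res hε a (star f)).unique ?_
  rw [res_star hε]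
  exact (hasD_res hε a f).conj

theorem tendsto_rsym {ε : ℕ → ℝ} (h : Filter.Tendsto ε Filter.atTop (nhds 0)) (ξ : Plane) :
    Filter.Tendsto (fun n => rsym (ε n) ξ) Filter.atTop (nhds 1) := by
  have h1 : Continuous fun e : ℝ => rsym e ξ := by
    unfold rsym
    refine Complex.continuous_ofReal.comp (Continuous.inv₀ (by fun_prop) fun x => ?_)
    positivity
  have h2 := (h1.tendsto 0).comp h
  simpa [rsym, Function.comp_def] using h2

theorem tendsto_res {ε : ℕ → ℝ} (h : Filter.Tendsto ε Filter.atTop (nhds 0)) (f : H) :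
    Filter.Tendsto (fun n => res (ε n) f) Filter.atTop (nhds f) := by
  have h1 := tendsto_fourierMul (fun n => memLp_rsym (ε n)) (σ₀ := fun _ => 1) (memLp_top_const 1)
    (C := 2) (fun n ξ => ?_) (tendsto_rsym h) f
  · have e : fourierMul (fun _ => 1) f = f := by
      apply ft.injective
      refine Lp.ext ?_
      filter_upwards [coeFn_ft_fourierMul (σ := fun _ => 1) (memLp_top_const 1) f] with ξ hξ
      rw [hξ, one_mul]
    rwa [e] at h1
  · refine (norm_sub_le _ _).trans ?_
    have := norm_rsym_le (ε n) ξ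
    rw [norm_one]; linarith

theorem fourierMul_zero (f : H) : fourierMul (fun _ => 0) f = 0 := by
  apply ft.injective
  refine Lp.ext ?_
  rw [map_zero]
  filter_upwards [coeFn_ft_fourierMul (σ := fun _ => 0) (memLp_top_const 0) f,
    Lp.coeFn_zero ℂ 2 (volume : Measure Plane)] with ξ hξ h0
  rw [hξ, zero_mul, h0]; rfl

theorem fourierMul_const_mul (c : ℂ) {σ : Plane → ℂ} (hσ : MemLp σ ∞ volume) (f : H) :
    fourierMul (fun ξ => c * σ ξ) f = c • fourierMul σ f := by
  apply ft.injective
  rw [ft_fourierMul, map_smul, ft_fourierMul, mulOp_const_mul c hσ]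

theorem tendsto_resD {ε : ℕ → ℝ} (hε : ∀ n, 0 < ε n)
    (h : Filter.Tendsto ε Filter.atTop (nhds 0)) (a : Fin 2) (f : H) :
    Filter.Tendsto (fun n => (ε n : ℂ) • resD (ε n) a f) Filter.atTop (nhds 0) := by
  have hm := fun n => (memLp_dsym_mul_rsym (hε n) a).const_mul (ε n : ℂ)
  have h1 := tendsto_fourierMul hm (σ₀ := fun _ => 0) (memLp_top_const 0) (C := 1)
    (fun n ξ => ?_) (fun ξ => ?_) f
  · rw [fourierMul_zero] at h1
    refine h1.congr fun n => ?_
    rw [fourierMul_const_mul _ (memLp_dsym_mul_rsym (hε n) a)]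
    rfl
  · rw [sub_zero, norm_mul, Complex.norm_real, Real.norm_eq_abs]
    exact abs_mul_norm_dsym_mul_rsym_le _ a ξ
  · have h2 := (Complex.continuous_ofReal.tendsto 0).comp h
    have h3 := h2.mul ((tendsto_rsym h ξ).const_mul (dsym a ξ))
    simpa using h3

theorem tendsto_resDD {ε : ℕ → ℝ} (hε : ∀ n, 0 < ε n)
    (h : Filter.Tendsto ε Filter.atTop (nhds 0)) (a b : Fin 2) (f : H) :
    Filter.Tendsto (fun n => ((ε n ^ 2 : ℝ) : ℂ) • resDD (ε n) a b f) Filter.atTop (nhds 0) := by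
  have hm := fun n => (memLp_dsym_mul_dsym_mul_rsym (hε n) a b).const_mul ((ε n ^ 2 : ℝ) : ℂ)
  have h1 := tendsto_fourierMul hm (σ₀ := fun _ => 0) (memLp_top_const 0) (C := 1)
    (fun n ξ => ?_) (fun ξ => ?_) f
  · rw [fourierMul_zero] at h1
    refine h1.congr fun n => ?_
    rw [fourierMul_const_mul _ (memLp_dsym_mul_dsym_mul_rsym (hε n) a b)]
    rfl
  · rw [sub_zero, norm_mul, Complex.norm_real, Real.norm_of_nonneg (by positivity)]
    exact sq_mul_norm_dsym_mul_dsym_mul_rsym_le _ a b ξ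
  · have h2 := (Complex.continuous_ofReal.tendsto _).comp (h.pow 2)
    have h3 := h2.mul (((tendsto_rsym h ξ).const_mul (dsym a ξ)).const_mul (dsym b ξ))
    simpa using h3

/-! ### Friedrichs' commutator -/

/-- The product of two Schwartz functions. -/
def mulS (φ ψ : 𝓢(Plane, ℂ)) : 𝓢(Plane, ℂ) := SchwartzMap.smulLeftCLM ℂ φ ψ

theorem mulS_apply (φ ψ : 𝓢(Plane, ℂ)) (x : Plane) : mulS φ ψ x = φ x * ψ x :=
  SchwartzMap.smulLeftCLM_apply_apply φ.hasTemperateGrowth ψ x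

theorem lineDeriv_mulS (v : Plane) (φ ψ : 𝓢(Plane, ℂ)) (x : Plane) :
    (∂_{v} (mulS φ ψ)) x = φ x * (∂_{v} ψ) x + (∂_{v} φ) x * ψ x := by
  have e : (mulS φ ψ : Plane → ℂ) = fun y => φ y * ψ y := by
    ext y; exact mulS_apply φ ψ y
  simp only [SchwartzMap.lineDerivOp_apply_eq_fderiv, e]
  have h2 : fderiv ℝ (fun y : Plane => φ y * ψ y) x = _ :=
    ((φ.differentiableAt (x := x)).hasFDerivAt.mul (ψ.differentiableAt (x := x)).hasFDerivAt).fderiv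
  rw [h2]
  simp [mul_comm]

/-- The Leibniz rule for a `W^{1,∞}` coefficient and a Schwartz function. -/
theorem hasD_mulOp_linf {b : Fin 2} {g d : Linf}
    (h : Lp.toTemperedDistribution d = ∂_{stdVec b} (Lp.toTemperedDistribution g))
    (u : 𝓢(Plane, ℂ)) : HasD b (mulOp g (u.toLp 2))
      (mulOp g ((∂_{stdVec b} u).toLp 2) + mulOp d (u.toLp 2)) := by
  rw [hasD_iff_integral]
  intro φ
  have h1 := integral_lineDeriv_mul_linf h (mulS φ u)
  have e1 : ∫ x, (∂_{stdVec b} (mulS φ u)) x * g x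
      = (∫ x, mulS φ (∂_{stdVec b} u) x * g x) + ∫ x, mulS (∂_{stdVec b} φ) u x * g x := by
    rw [← integral_add (integrable_schwartz_mul_linf _ g) (integrable_schwartz_mul_linf _ g)]
    refine integral_congr_ae (Filter.Eventually.of_forall fun x => ?_)
    beta_reduce
    rw [lineDeriv_mulS, mulS_apply, mulS_apply, add_mul]
  have e2 : ∫ x, φ x * (mulOp g ((∂_{stdVec b} u).toLp 2) + mulOp d (u.toLp 2) : H) x
      = (∫ x, mulS φ (∂_{stdVec b} u) x * g x) + ∫ x, mulS φ u x * d x := by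
    rw [← integral_add (integrable_schwartz_mul_linf _ g) (integrable_schwartz_mul_linf _ d)]
    refine integral_congr_ae ?_
    filter_upwards [Lp.coeFn_add (mulOp g ((∂_{stdVec b} u).toLp 2)) (mulOp d (u.toLp 2)),
      coeFn_mulOp (memLp_linf g) ((∂_{stdVec b} u).toLp 2), coeFn_mulOp (memLp_linf d) (u.toLp 2),
      u.coeFn_toLp 2 volume, (∂_{stdVec b} u).coeFn_toLp 2 volume] with x k1 k2 k3 k4 k5
    rw [k1, Pi.add_apply, k2, k3, k4, k5, mulS_apply, mulS_apply]; ring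
  have e3 : ∫ x, (∂_{stdVec b} φ) x * (mulOp g (u.toLp 2)) x
      = ∫ x, mulS (∂_{stdVec b} φ) u x * g x := by
    refine integral_congr_ae ?_
    filter_upwards [coeFn_mulOp (memLp_linf g) (u.toLp 2), u.coeFn_toLp 2 volume] with x k1 k2
    rw [k1, k2, mulS_apply]; ring
  rw [e2, e3]
  rw [e1] at h1
  linear_combination h1

/-- The regularization `R (∂_a (g w) - (∂_a g) w)` of the first order term `g ∂_a w`, which makes
sense for `w ∈ L²`. -/
def firstOrder (ε : ℝ) (a : Fin 2) (g : Linf) (w : H) : H :=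
  resD ε a (mulOp g w) - res ε (mulOp (weakPartial a g) w)

/-- Friedrichs' commutator identity for the resolvent and the operator `g ∂_a`. -/
theorem firstOrder_sub_eq {ε : ℝ} (hε : 0 < ε) (a : Fin 2) {g : Linf}
    (hg : ∀ b, Lp.toTemperedDistribution (weakPartial b g)
      = ∂_{stdVec b} (Lp.toTemperedDistribution g)) (w : H) :
    firstOrder ε a g w - mulOp g (resD ε a w) = ((ε ^ 2 : ℝ) : ℂ) • ∑ b,
      (resD ε b (mulOp (weakPartial b g) (resD ε a w))
        + res ε (mulOp (weakPartial b g) (resDD ε a b w))) := by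
  refine eq_of_eq_on_schwartz (A := fun w => firstOrder ε a g w - mulOp g (resD ε a w))
    (B := fun w => ((ε ^ 2 : ℝ) : ℂ) • ∑ b, (resD ε b (mulOp (weakPartial b g) (resD ε a w))
        + res ε (mulOp (weakPartial b g) (resDD ε a b w)))) ?_ ?_ (fun w => ?_) w
  · unfold firstOrder
    fun_prop
  · fun_prop
  beta_reduce
  obtain ⟨u, hu⟩ : ∃ u : 𝓢(Plane, ℂ), u = SchwartzMap.fourierMultiplierCLM ℂ (rsym ε) w := ⟨_, rfl⟩
  have eU : res ε (w.toLp 2) = u.toLp 2 := by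
    rw [hu]; exact fourierMul_toLp (memLp_rsym ε) (hasTemperateGrowth_rsym ε) w
  have pr : ∀ (b : Fin 2) (φ : 𝓢(Plane, ℂ)) (F F' : H), F = φ.toLp 2 →
      F' = (∂_{stdVec b} φ).toLp 2 → HasD b (mulOp g F) (mulOp g F' + mulOp (weakPartial b g) F) := by
    rintro b φ F F' rfl rfl
    exact hasD_mulOp_linf (hg b) φ
  obtain ⟨W, hW⟩ : ∃ W : H, W = w.toLp 2 := ⟨_, rfl⟩
  obtain ⟨w', hw'⟩ : ∃ W : H, W = (∂_{stdVec a} w).toLp 2 := ⟨_, rfl⟩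
  obtain ⟨ua, hua⟩ : ∃ v : 𝓢(Plane, ℂ), v = ∂_{stdVec a} u := ⟨_, rfl⟩
  obtain ⟨Ua, hUa⟩ : ∃ F : H, F = ua.toLp 2 := ⟨_, rfl⟩
  have hdw : HasD a W w' := by rw [hW, hw']; exact hasD_toLp a w
  rw [← hW] at eU ⊢
  have eUa : resD ε a W = Ua := (hasD_res hε a W).unique (by rw [eU, hUa, hua]; exact hasD_toLp a u)
  have eUab : ∀ b, resDD ε a b W = (∂_{stdVec b} ua).toLp 2 := fun b =>
    (hasD_resD hε a b W).unique (by rw [eUa, hUa]; exact hasD_toLp b ua)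
  have e1 : res ε w' = Ua := by
    rw [← eUa]; exact hdw.res_comm hε
  have e2 : ∀ b, resD ε b w' = (∂_{stdVec b} ua).toLp 2 := fun b =>
    (hasD_res hε b w').unique (by rw [e1, hUa]; exact hasD_toLp b ua)
  have e3 : ∀ b, resDD ε b b w' = (∂_{stdVec b} (∂_{stdVec b} ua)).toLp 2 := fun b =>
    (hasD_resD hε b b w').unique (by rw [e2]; exact hasD_toLp b _)
  have e4 : firstOrder ε a g W = res ε (mulOp g w') := by
    rw [firstOrder, ← (pr a w W w' hW hw').res_comm hε, map_add, add_sub_cancel_right]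
  have e5 : ∀ b, res ε (mulOp g (resDD ε b b w')) = resDD ε b b (mulOp g Ua)
      - resD ε b (mulOp (weakPartial b g) Ua) - res ε (mulOp (weakPartial b g) (resDD ε a b W)) := by
    intro b
    have h1 := (pr b _ _ _ (eUab b) (e3 b)).res_comm hε
    have h2 := (pr b ua Ua _ hUa (eUab b)).resD_comm hε (a := b)
    rw [map_add] at h1 h2
    rw [← h2, add_sub_cancel_right, ← h1, add_sub_cancel_right]
  -- Insert `1 = R - ε² Δ R` to the right of `g`, and again to the left in `e7`.
  have e6 : res ε (mulOp g w') = res ε (mulOp g (res ε w')) - ((ε ^ 2 : ℝ) : ℂ) •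
      (res ε (mulOp g (resDD ε 0 0 w')) + res ε (mulOp g (resDD ε 1 1 w'))) := by
    have k := res_sub_sum hε w'
    rw [Fin.sum_univ_two] at k
    conv_lhs => rw [← k]
    rw [(mulOp g).map_sub, (res ε).map_sub, (mulOp g).map_smul, (res ε).map_smul,
      (mulOp g).map_add, (res ε).map_add]
  have e7 := res_sub_sum hε (mulOp g Ua)
  rw [Fin.sum_univ_two, sub_eq_iff_eq_add] at e7
  rw [e4, e6, e5, e5, e1, eUa, e7, Fin.sum_univ_two]
  module

theorem norm_mulOp_linf_le (g : Linf) (f : H) : ‖mulOp g f‖ ≤ ‖g‖ * ‖f‖ :=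
  norm_mulOp_le (memLp_linf g) (ae_norm_le_norm g) f

/-- The commutator error in `firstOrder_sub_eq`. -/
def commErr (ε : ℝ) (a : Fin 2) (g : Linf) (w : H) : H :=
  firstOrder ε a g w - mulOp g (resD ε a w)

theorem norm_commErr_le {ε : ℝ} (hε : 0 < ε) (a : Fin 2) {g : Linf}
    (hg : ∀ b, Lp.toTemperedDistribution (weakPartial b g)
      = ∂_{stdVec b} (Lp.toTemperedDistribution g)) {C : ℝ} (hC : ∀ b, ‖weakPartial b g‖ ≤ C)
    (w : H) : ‖commErr ε a g w‖ ≤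
      C * ∑ b, (‖(ε : ℂ) • resD ε a w‖ + ‖((ε ^ 2 : ℝ) : ℂ) • resDD ε a b w‖) := by
  rw [commErr, firstOrder_sub_eq hε a hg, Finset.smul_sum, Finset.mul_sum]
  refine (norm_sum_le _ _).trans (Finset.sum_le_sum fun b _ => ?_)
  have e : ((ε ^ 2 : ℝ) : ℂ) • (resD ε b (mulOp (weakPartial b g) (resD ε a w))
        + res ε (mulOp (weakPartial b g) (resDD ε a b w)))
      = (ε : ℂ) • resD ε b (mulOp (weakPartial b g) ((ε : ℂ) • resD ε a w))
        + res ε (mulOp (weakPartial b g) (((ε ^ 2 : ℝ) : ℂ) • resDD ε a b w)) := by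
    simp only [map_smul, smul_add, smul_smul]
    push_cast
    rw [sq]
  rw [e, mul_add]
  refine (norm_add_le _ _).trans (add_le_add ?_ ?_)
  · refine (norm_resD_le hε b _).trans ((norm_mulOp_linf_le _ _).trans ?_)
    gcongr; exact hC b
  · refine (norm_res_le ε _).trans ((norm_mulOp_linf_le _ _).trans ?_)
    gcongr; exact hC b

theorem norm_commErr_le_norm {ε : ℝ} (hε : 0 < ε) (a : Fin 2) {g : Linf}
    (hg : ∀ b, Lp.toTemperedDistribution (weakPartial b g)
      = ∂_{stdVec b} (Lp.toTemperedDistribution g)) {C : ℝ} (hC : ∀ b, ‖weakPartial b g‖ ≤ C)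
    (w : H) : ‖commErr ε a g w‖ ≤ 4 * C * ‖w‖ := by
  refine (norm_commErr_le hε a hg hC w).trans ?_
  have hC0 : 0 ≤ C := (norm_nonneg _).trans (hC 0)
  calc C * ∑ b, (‖(ε : ℂ) • resD ε a w‖ + ‖((ε ^ 2 : ℝ) : ℂ) • resDD ε a b w‖)
      ≤ C * ∑ _b : Fin 2, (‖w‖ + ‖w‖) := by
        gcongr
        · exact norm_resD_le hε a w
        · exact norm_resDD_le hε a _ w
    _ = _ := by rw [Fin.sum_univ_two]; ring

/-- The commutator errors vanish as `ε → 0`: `ε ∂_a R` and `ε² ∂_a ∂_b R` tend to zero strongly. -/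
theorem tendsto_commErr {ε : ℕ → ℝ} (hε : ∀ n, 0 < ε n)
    (h : Filter.Tendsto ε Filter.atTop (nhds 0)) (a : Fin 2) {g : Linf}
    (hg : ∀ b, Lp.toTemperedDistribution (weakPartial b g)
      = ∂_{stdVec b} (Lp.toTemperedDistribution g)) (w : H) :
    Filter.Tendsto (fun n => ‖commErr (ε n) a g w‖) Filter.atTop (nhds 0) := by
  set C := ‖weakPartial 0 g‖ + ‖weakPartial 1 g‖ with hCdef
  have hC : ∀ b, ‖weakPartial b g‖ ≤ C := by
    intro b
    fin_cases b
    · exact le_add_of_nonneg_right (norm_nonneg _)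
    · exact le_add_of_nonneg_left (norm_nonneg _)
  have h2 : Filter.Tendsto (fun n => C * ∑ b, (‖(ε n : ℂ) • resD (ε n) a w‖
      + ‖((ε n ^ 2 : ℝ) : ℂ) • resDD (ε n) a b w‖)) Filter.atTop
        (nhds (C * ∑ _b : Fin 2, (‖(0 : H)‖ + ‖(0 : H)‖))) :=
    (tendsto_finsetSum _ fun b _ => (tendsto_resD hε h a w).norm.add
      (tendsto_resDD hε h a b w).norm).const_mul C
  simp only [norm_zero, add_zero, Finset.sum_const_zero, mul_zero] at h2
  exact squeeze_zero (fun n => norm_nonneg _) (fun n => norm_commErr_le (hε n) a hg hC w) h2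

/-! ### The energy inequality at a fixed time -/

/-- The operator `1 + κ σ ∑_a A_a` defining the energy of a component with mass `m`, with
`σ = -sign m`. -/
def energyOp (κ m s : ℝ) : H →L[ℂ] H :=
  ContinuousLinearMap.id ℂ H + ((-(κ * (|m| / m)) : ℝ) : ℂ) • ∑ a, escape s a

theorem energyOp_apply (κ m s : ℝ) (u : H) :
    energyOp κ m s u = u + ((-(κ * (|m| / m)) : ℝ) : ℂ) • (escape s 0 u + escape s 1 u) := by
  rw [energyOp, Fin.sum_univ_two]; rfl

theorem abs_energyOp_coeff {κ m : ℝ} (hκ : 0 ≤ κ) (hm : m ≠ 0) : |-(κ * (|m| / m))| = κ := by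
  rw [abs_neg, abs_mul, abs_div, abs_abs, div_self (abs_ne_zero.2 hm), mul_one, abs_of_nonneg hκ]

theorem inner_energyOp_left (κ m s : ℝ) (u v : H) :
    (inner ℂ (energyOp κ m s u) v : ℂ) = inner ℂ u (energyOp κ m s v) := by
  rw [energyOp_apply, energyOp_apply, inner_add_left, inner_add_right, inner_smul_left,
    inner_smul_right, inner_add_left, inner_add_right, inner_escape_left, inner_escape_left,
    Complex.conj_ofReal]

theorem norm_energyOp_sub_le {κ m : ℝ} (hκ : 0 ≤ κ) (hm : m ≠ 0) (s : ℝ) (u : H) :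
    ‖energyOp κ m s u - u‖ ≤ 4 * κ * ‖u‖ := by
  rw [energyOp_apply, add_sub_cancel_left, norm_smul, Complex.norm_real, Real.norm_eq_abs,
    abs_energyOp_coeff hκ hm]
  have := (norm_add_le (escape s 0 u) (escape s 1 u)).trans
    (add_le_add (norm_escape_le s 0 u) (norm_escape_le s 1 u))
  nlinarith [mul_le_mul_of_nonneg_left this hκ]

theorem norm_energyOp_le {κ m : ℝ} (hκ : 0 ≤ κ) (hκ' : κ ≤ 1 / 8) (hm : m ≠ 0) (s : ℝ) (u : H) :
    ‖energyOp κ m s u‖ ≤ 2 * ‖u‖ := by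
  have h := norm_energyOp_sub_le hκ hm s u
  have h2 := norm_add_le (energyOp κ m s u - u) u
  rw [sub_add_cancel] at h2
  nlinarith [norm_nonneg u]

/-- The energy is equivalent to the square of the `L²` norm. -/
theorem re_inner_energyOp_self {κ m : ℝ} (hκ : 0 ≤ κ) (hκ' : κ ≤ 1 / 8) (hm : m ≠ 0) (s : ℝ)
    (u : H) : ‖u‖ ^ 2 / 2 ≤ (inner ℂ (energyOp κ m s u) u : ℂ).re ∧
      (inner ℂ (energyOp κ m s u) u : ℂ).re ≤ 2 * ‖u‖ ^ 2 := by
  have e : (inner ℂ (energyOp κ m s u) u : ℂ) = inner ℂ (energyOp κ m s u - u) u + inner ℂ u u := by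
    rw [← inner_add_left, sub_add_cancel]
  have h1 := norm_energyOp_sub_le hκ hm s u
  have h2 := (Complex.abs_re_le_norm _).trans (norm_inner_le_norm (𝕜 := ℂ) (energyOp κ m s u - u) u)
  have h3 : (inner ℂ u u : ℂ).re = ‖u‖ ^ 2 := inner_self_eq_norm_sq (𝕜 := ℂ) u
  rw [e, Complex.add_re, h3]
  have h4 : ‖energyOp κ m s u - u‖ * ‖u‖ ≤ ‖u‖ ^ 2 / 2 := by
    calc ‖energyOp κ m s u - u‖ * ‖u‖ ≤ (4 * κ * ‖u‖) * ‖u‖ := by gcongr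
      _ = (4 * κ) * ‖u‖ ^ 2 := by ring
      _ ≤ (1 / 2) * ‖u‖ ^ 2 := by gcongr; linarith
      _ = _ := by ring
  rw [abs_le] at h2
  constructor <;> nlinarith [sq_nonneg ‖u‖]

theorem exists_smoothing_energyOp_le : ∃ K : ℝ, 0 < K ∧ ∀ (κ m s : ℝ) (a : Fin 2) (u : H),
    0 ≤ κ → κ ≤ 1 / 8 → m ≠ 0 → 1 ≤ s →
    smoothing s a (energyOp κ m s u) ≤ ENNReal.ofReal K * smoothing s a u := by
  obtain ⟨K, hK, h⟩ := exists_smoothing_escape_le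
  refine ⟨2 + 8 * K, by positivity, fun κ m s a u hκ hκ' hm hs => ?_⟩
  have hs0 : 0 < s := by linarith
  have h3 : ENNReal.ofReal (‖((-(κ * (|m| / m)) : ℝ) : ℂ)‖ ^ 2) ≤ 1 := by
    rw [← ENNReal.ofReal_one]
    refine ENNReal.ofReal_le_ofReal ?_
    rw [Complex.norm_real, Real.norm_eq_abs, abs_energyOp_coeff hκ hm]
    nlinarith
  rw [energyOp_apply]
  refine (smoothing_add_le hs0 a _ _).trans ?_
  rw [smoothing_smul]
  calc 2 * smoothing s a u + 2 * (ENNReal.ofReal (‖((-(κ * (|m| / m)) : ℝ) : ℂ)‖ ^ 2) *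
        smoothing s a (escape s 0 u + escape s 1 u))
      ≤ 2 * smoothing s a u + 2 * (1 * (2 * (ENNReal.ofReal K * smoothing s a u)
        + 2 * (ENNReal.ofReal K * smoothing s a u))) := by
        gcongr
        refine (smoothing_add_le hs0 a _ _).trans ?_
        gcongr
        · exact h s a 0 u hs
        · exact h s a 1 u hs
    _ = (ENNReal.ofReal 2 + ENNReal.ofReal 8 * ENNReal.ofReal K) * smoothing s a u := by
        rw [ENNReal.ofReal_ofNat, ENNReal.ofReal_ofNat]; ring
    _ = _ := by
        rw [← ENNReal.ofReal_mul (by norm_num), ← ENNReal.ofReal_add (by norm_num) (by positivity)]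

theorem norm_th_sub_le {s s' : ℝ} (hs : 0 < s) (h : s ≤ s') (a : Fin 2) (x : Plane) :
    ‖th s' a x - th s a x‖ ≤ (s' - s) / s := by
  rw [th, th, ← Complex.ofReal_sub, Complex.norm_real]
  have hd : ∀ r ∈ Icc s s', HasDerivWithinAt (fun r => Real.arctan (x a / r))
      (1 / (1 + (x a / r) ^ 2) * (x a * (-(r ^ 2)⁻¹))) (Icc s s') r := by
    intro r hr
    have hr0 : 0 < r := hs.trans_le hr.1
    have h1 := ((hasDerivAt_inv hr0.ne').const_mul (x a)).arctan
    simp only [← div_eq_mul_inv] at h1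
    exact h1.hasDerivWithinAt
  have hb : ∀ r ∈ Icc s s', ‖1 / (1 + (x a / r) ^ 2) * (x a * (-(r ^ 2)⁻¹))‖ ≤ 1 / s := by
    intro r hr
    have hr0 : 0 < r := hs.trans_le hr.1
    have e : 1 / (1 + (x a / r) ^ 2) * (x a * (-(r ^ 2)⁻¹)) = -(x a / (r ^ 2 + x a ^ 2)) := by
      have : r ^ 2 + x a ^ 2 ≠ 0 := by positivity
      have : 1 + (x a / r) ^ 2 ≠ 0 := by positivity
      field_simp
    rw [e, norm_neg, norm_div, Real.norm_eq_abs, Real.norm_of_nonneg (by positivity)]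
    calc |x a| / (r ^ 2 + x a ^ 2) ≤ 1 / r := by
          rw [div_le_div_iff₀ (by positivity) hr0]
          nlinarith [sq_abs (x a), abs_nonneg (x a), sq_nonneg (|x a| - r)]
      _ ≤ 1 / s := one_div_le_one_div_of_le hs hr.1
  have := (convex_Icc s s').norm_image_sub_le_of_norm_hasDerivWithin_le hd hb
    (left_mem_Icc.2 h) (right_mem_Icc.2 h)
  rw [Real.norm_of_nonneg (sub_nonneg.2 h)] at this
  calc _ ≤ 1 / s * (s' - s) := this
    _ = _ := by ring

/-- The time dependence of the energy, through `s = ⟨t⟩`, is as small as `κ / s`. -/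
theorem norm_energyOp_sub_energyOp_le {κ m : ℝ} (hκ : 0 ≤ κ) (hm : m ≠ 0) {s s' : ℝ} (hs : 0 < s)
    (h : s ≤ s') : ‖energyOp κ m s' - energyOp κ m s‖ ≤ 2 * κ * ((s' - s) / s) := by
  have hd : 0 ≤ (s' - s) / s := div_nonneg (sub_nonneg.2 h) hs.le
  have hE : ∀ a (u : H), ‖escape s' a u - escape s a u‖ ≤ (s' - s) / s * ‖u‖ := by
    intro a u
    have ht : ∀ f : H, ‖mulOp (th s' a) f - mulOp (th s a) f‖ ≤ (s' - s) / s * ‖f‖ := by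
      intro f
      refine Lp.norm_le_mul_norm_of_ae_le_mul ?_
      filter_upwards [Lp.coeFn_sub (mulOp (th s' a) f) (mulOp (th s a) f),
        coeFn_mulOp (memLp_th s' a) f, coeFn_mulOp (memLp_th s a) f] with x h1 h2 h3
      rw [h1, Pi.sub_apply, h2, h3, ← sub_mul, norm_mul]
      gcongr
      exact norm_th_sub_le hs h a x
    have e : escape s' a u - escape s a u = (2⁻¹ : ℂ) •
        ((mulOp (th s' a) (sgnOp a u) - mulOp (th s a) (sgnOp a u))
          + sgnOp a (mulOp (th s' a) u - mulOp (th s a) u)) := by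
      rw [escape_apply, escape_apply, map_sub]; module
    have h1 := (ht (sgnOp a u)).trans (mul_le_mul_of_nonneg_left (norm_sgnOp_le a u) hd)
    have h2 := (norm_sgnOp_le a _).trans (ht u)
    have h3 := norm_add_le (mulOp (th s' a) (sgnOp a u) - mulOp (th s a) (sgnOp a u))
      (sgnOp a (mulOp (th s' a) u - mulOp (th s a) u))
    have h4 : ‖(2⁻¹ : ℂ)‖ = 2⁻¹ := by simp
    rw [e, norm_smul, h4]
    linarith
  refine ContinuousLinearMap.opNorm_le_bound _ (by positivity) fun u => ?_
  have e : (energyOp κ m s' - energyOp κ m s) u = ((-(κ * (|m| / m)) : ℝ) : ℂ) •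
      ((escape s' 0 u - escape s 0 u) + (escape s' 1 u - escape s 1 u)) := by
    rw [_root_.sub_apply, energyOp_apply, energyOp_apply]; module
  rw [e, norm_smul, Complex.norm_real, Real.norm_eq_abs, abs_energyOp_coeff hκ hm]
  have := (norm_add_le _ _).trans (add_le_add (hE 0 u) (hE 1 u))
  calc _ ≤ κ * ((s' - s) / s * ‖u‖ + (s' - s) / s * ‖u‖) := by gcongr
    _ = _ := by ring

/-- The contribution of `(i / 2m) Δ` to the energy identity. -/
theorem re_inner_energyOp_laplacian_le {κ m s : ℝ} (hκ : 0 ≤ κ) (hm : m ≠ 0) (hs : 1 ≤ s) {u : H}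
    {u' u'' : Fin 2 → H} (h1 : ∀ a, HasD a u (u' a)) (h2 : ∀ a, HasD a (u' a) (u'' a)) :
    2 * (inner ℂ (energyOp κ m s u) ((Complex.I * (1 / (2 * (m : ℂ)))) • ∑ a, u'' a) : ℂ).re
      ≤ κ / |m| * (-(∑ a, (smoothing s a u).toReal) + 8 * (s⁻¹ * ‖u‖ ^ 2)) := by
  have hs0 : 0 < s := by linarith
  have e0 : ∀ b, (inner ℂ u (u'' b) : ℂ).im = 0 := by
    intro b
    have h3 := (h1 b).inner_left (h2 b)
    have h4 : (inner ℂ u (u'' b) : ℂ) = -inner ℂ (u' b) (u' b) := by rw [h3, neg_neg]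
    have h5 : (inner ℂ (u' b) (u' b) : ℂ).im = 0 := inner_self_im (𝕜 := ℂ) (u' b)
    rw [h4, Complex.neg_im, h5, neg_zero]
  have e1 : ∀ b, (inner ℂ (energyOp κ m s u) (u'' b) : ℂ).im
      = -(κ * (|m| / m)) * (inner ℂ (escape s b u) (u'' b) : ℂ).im := by
    intro b
    rw [energyOp_apply, inner_add_left, inner_smul_left, inner_add_left, Complex.conj_ofReal,
      Complex.add_im, e0, zero_add, Complex.im_ofReal_mul, Complex.add_im]
    congr 1
    fin_cases b
    · change (inner ℂ (escape s 0 u) (u'' 0) : ℂ).im + (inner ℂ (escape s 1 u) (u'' 0) : ℂ).im = _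
      rw [im_inner_escape_deriv_of_ne hs0 (a := 1) (b := 0) (by decide) (h1 0) (h2 0), add_zero]; rfl
    · change (inner ℂ (escape s 0 u) (u'' 1) : ℂ).im + (inner ℂ (escape s 1 u) (u'' 1) : ℂ).im = _
      rw [im_inner_escape_deriv_of_ne hs0 (a := 0) (b := 1) (by decide) (h1 1) (h2 1), zero_add]; rfl
  have e2 : 2 * (inner ℂ (energyOp κ m s u)
      ((Complex.I * (1 / (2 * (m : ℂ)))) • ∑ a, u'' a) : ℂ).re
      = κ / |m| * ∑ a, (inner ℂ (escape s a u) (u'' a) : ℂ).im := by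
    have e3 : (Complex.I * (1 / (2 * (m : ℂ)))) = ((1 / (2 * m) : ℝ) : ℂ) * Complex.I := by
      push_cast; ring
    rw [inner_smul_right, inner_sum, e3, mul_assoc, Complex.re_ofReal_mul, Complex.I_mul_re,
      Complex.im_sum]
    simp only [e1]
    rw [← Finset.mul_sum]
    have hmm : |m| ≠ 0 := abs_ne_zero.2 hm
    field_simp
    rw [sq_abs, mul_comm κ]
  rw [e2]
  refine mul_le_mul_of_nonneg_left ?_ (by positivity)
  rw [Fin.sum_univ_two, Fin.sum_univ_two]
  have i0 := im_inner_escape_deriv_le hs (h1 0) (h2 0)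
  have i1 := im_inner_escape_deriv_le hs (h1 1) (h2 1)
  linarith

/-- The tuple `(u_1, …, u_N, conj u_1, …, conj u_N)`. -/
def sharpH {N : ℕ} (u : Fin N → H) : Fin N ⊕ Fin N → H :=
  Sum.elim u fun j => star (u j)

theorem HasD.sharpH {N : ℕ} {a : Fin 2} {u u' : Fin N → H} (h : ∀ j, HasD a (u j) (u' j))
    (k : Fin N ⊕ Fin N) : HasD a (sharpH u k) (NLSEnergy.sharpH u' k) := by
  rcases k with j | j
  · exact h j
  · exact (h j).conj

theorem CoeffBound.mono {s W W' : ℝ} {g : Linf} (hs : 0 < s) (h : CoeffBound s W g) (hW : W ≤ W') :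
    CoeffBound s W' g := by
  refine ⟨fun b => (h.norm_weakPartial b).trans (by gcongr), h.weakPartial_eq, fun a => ?_,
    fun a τ => ?_⟩
  · filter_upwards [h.norm_mul_le a] with x hx
    exact hx.trans (by gcongr)
  · filter_upwards [h.norm_sub_le a τ] with x hx
    refine hx.trans ?_
    gcongr

/-- The contribution of a first order term to the energy identity. -/
theorem exists_re_inner_energyOp_mulOp_le (N : ℕ) : ∃ K : ℝ, 0 < K ∧
    ∀ (κ m s W : ℝ) (a : Fin 2) (g : Linf), 0 ≤ κ → κ ≤ 1 / 8 → m ≠ 0 → 1 ≤ s → 0 ≤ W →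
    CoeffBound s W g → ∀ (z z' : H) (u u' : Fin N → H) (k : Fin N ⊕ Fin N), HasD a z z' →
    (∀ j, HasD a (u j) (u' j)) →
    2 * (inner ℂ (energyOp κ m s z) (-(Complex.I • mulOp g (sharpH u' k))) : ℂ).re
      ≤ K * W * ((smoothing s a z).toReal + (smoothing s a (Sum.elim u u k)).toReal) := by
  obtain ⟨K, hK, hT⟩ := exists_enorm_inner_mulOp_deriv_le
  obtain ⟨L, hL, hE⟩ := exists_smoothing_energyOp_le
  obtain ⟨P, hP, hS⟩ := exists_smoothing_star_le
  refine ⟨2 * (K * (L + P + 1)), by positivity,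
    fun κ m s W a g hκ hκ' hm hs hW hg z z' u u' k hz hu => ?_⟩
  have hs0 : 0 < s := by linarith
  have hzf := (smoothing_lt_top hs0 hz).ne
  have huf : ∀ j, smoothing s a (u j) ≠ ∞ := fun j => (smoothing_lt_top hs0 (hu j)).ne
  have hwf : smoothing s a (Sum.elim u u k) ≠ ∞ := by
    rcases k with j | j <;> exact huf j
  have h1 : ‖(inner ℂ (energyOp κ m s z) (mulOp g (sharpH u' k)) : ℂ)‖ₑ ≤ ENNReal.ofReal (K * W) *
      (ENNReal.ofReal (L + P + 1) * (smoothing s a z + smoothing s a (Sum.elim u u k))) := by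
    refine (hT s a g W hs (memLp_linf g) hW (hg.norm_mul_le a) (hg.norm_sub_le a) _ _ _
      (HasD.sharpH hu k)).trans ?_
    gcongr
    rw [mul_add]
    gcongr
    · refine (hE κ m s a z hκ hκ' hm hs).trans ?_
      gcongr; linarith
    · rcases k with j | j
      · change smoothing s a (u j) ≤ _ * smoothing s a (u j)
        conv_lhs => rw [← one_mul (smoothing s a (u j))]
        gcongr
        rw [← ENNReal.ofReal_one]
        exact ENNReal.ofReal_le_ofReal (by linarith)
      · change smoothing s a (star (u j)) ≤ _ * smoothing s a (u j)
        refine (hS s a (u j) hs).trans ?_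
        gcongr; linarith
  rw [← mul_assoc, ← ENNReal.ofReal_mul (by positivity)] at h1
  have h2 := ENNReal.toReal_mono (ENNReal.mul_ne_top ENNReal.ofReal_ne_top
    (ENNReal.add_ne_top.2 ⟨hzf, hwf⟩)) h1
  rw [ENNReal.toReal_mul, ENNReal.toReal_ofReal (by positivity), ENNReal.toReal_add hzf hwf,
    toReal_enorm] at h2
  have h3 := Complex.re_le_norm (inner ℂ (energyOp κ m s z) (-(Complex.I • mulOp g (sharpH u' k))))
  rw [inner_neg_right, norm_neg, inner_smul_right, norm_mul, Complex.norm_I, one_mul,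
    ← inner_smul_right, ← inner_neg_right] at h3
  calc _ ≤ 2 * (K * W * (L + P + 1) * ((smoothing s a z).toReal
        + (smoothing s a (Sum.elim u u k)).toReal)) := by linarith
    _ = _ := by ring

theorem sum_sum_sum_add_eq {N : ℕ} (Y : Fin N → Fin 2 → ℝ) :
    ∑ j, ∑ k : Fin N ⊕ Fin N, ∑ a, (Y j a + Sum.elim Y Y k a) = 4 * N * ∑ j, ∑ a, Y j a := by
  set S := ∑ j, ∑ a, Y j a with hS
  have h1 : ∑ j, ∑ _k : Fin N ⊕ Fin N, ∑ a, Y j a = 2 * N * S := by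
    simp only [Finset.sum_const, Finset.card_univ, Fintype.card_sum, Fintype.card_fin, nsmul_eq_mul,
      ← Finset.mul_sum]
    rw [← hS]; push_cast; ring
  have h2 : ∑ _j : Fin N, ∑ k : Fin N ⊕ Fin N, ∑ a, Sum.elim Y Y k a = 2 * N * S := by
    simp only [Fintype.sum_sum_type, Sum.elim_inl, Sum.elim_inr, Finset.sum_const,
      Finset.card_univ, Fintype.card_fin, nsmul_eq_mul]
    rw [← hS]; ring
  simp only [Finset.sum_add_distrib]
  rw [h1, h2]; ring

/-- The bound, at a time with `⟨t⟩ = s`, on the derivative of the energy `∑_j ⟨B_j u_j, u_j⟩`, with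
`κ = M Ω`, along the system with coefficients of size `Ω` and error terms `E_j`. The derivatives of
`u_j` are passed as `u' a j = ∂_a u_j` and `u'' a j = ∂_a² u_j`. -/
def EnergyInequality {N : ℕ} (m : Fin N → ℝ) (M C c : ℝ) : Prop :=
  ∀ (s Ω : ℝ), 1 ≤ s → 0 ≤ Ω → M * Ω ≤ 1 / 8 →
    ∀ g : Fin N → Fin N ⊕ Fin N → Fin 2 → Linf, (∀ j k a, CoeffBound s (c * Ω) (g j k a)) →
    ∀ (u : Fin N → H) (u' u'' : Fin 2 → Fin N → H), (∀ a j, HasD a (u j) (u' a j)) →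
    (∀ a j, HasD a (u' a j) (u'' a j)) → ∀ E : Fin N → H,
    ∑ j, 2 * (inner ℂ (energyOp (M * Ω) (m j) s (u j))
      ((Complex.I * (1 / (2 * (m j : ℂ)))) • ∑ a, u'' a j
        + ∑ k, ∑ a, -(Complex.I • mulOp (g j k a) (sharpH (u' a) k)) + E j) : ℂ).re
      ≤ C * (Ω / s) * ∑ j, ‖u j‖ ^ 2 + 4 * ∑ j, ‖u j‖ * ‖E j‖

/-- The smoothing effect of the energy absorbs the first order terms: the former has size
`κ / |m_j|` and the latter have size `Ω`, so `κ` has to be a large multiple of `Ω`. -/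
theorem exists_energyInequality (N : ℕ) (m : Fin N → ℝ) (hm : ∀ j, m j ≠ 0) {c : ℝ} (hc : 0 ≤ c) :
    ∃ M : ℝ, 0 ≤ M ∧ ∃ C : ℝ, 0 ≤ C ∧ EnergyInequality m M C c := by
  obtain ⟨K, hK, hT⟩ := exists_re_inner_energyOp_mulOp_le N
  set mm : ℝ := ∑ j, |m j| with hmm
  have hmj : ∀ j, |m j| ≤ mm := fun j =>
    Finset.single_le_sum (f := fun j => |m j|) (fun _ _ => abs_nonneg _) (Finset.mem_univ j)
  have hmm0 : 0 ≤ mm := Finset.sum_nonneg fun _ _ => abs_nonneg _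
  set C1 : ℝ := 4 * N * (K * c) with hC1
  have hC10 : 0 ≤ C1 := by positivity
  set M := C1 * mm with hM
  set ii : ℝ := ∑ j, |m j|⁻¹ with hii
  have hij : ∀ j, |m j|⁻¹ ≤ ii := fun j =>
    Finset.single_le_sum (f := fun j => |m j|⁻¹) (fun _ _ => by positivity) (Finset.mem_univ j)
  have hii0 : 0 ≤ ii := Finset.sum_nonneg fun _ _ => by positivity
  refine ⟨M, by positivity, 8 * (M * ii), by positivity,
    fun s Ω hs hΩ hMΩ g hg u u' u'' h1 h2 E => ?_⟩
  have hs0 : 0 < s := by linarith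
  set κ := M * Ω with hκdef
  have hκ : 0 ≤ κ := by positivity
  set Y : Fin N → Fin 2 → ℝ := fun j a => (smoothing s a (u j)).toReal with hY
  have hY0 : ∀ j, 0 ≤ ∑ a, Y j a := fun j => Finset.sum_nonneg fun _ _ => ENNReal.toReal_nonneg
  have hj : ∀ j, 2 * (inner ℂ (energyOp κ (m j) s (u j))
      ((Complex.I * (1 / (2 * (m j : ℂ)))) • ∑ a, u'' a j
        + ∑ k, ∑ a, -(Complex.I • mulOp (g j k a) (sharpH (u' a) k)) + E j) : ℂ).re
      ≤ -(C1 * Ω * ∑ a, Y j a) + 8 * (M * ii) * (Ω / s) * ‖u j‖ ^ 2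
        + ∑ k : Fin N ⊕ Fin N, ∑ a, K * (c * Ω) * (Y j a + Sum.elim Y Y k a)
        + 4 * (‖u j‖ * ‖E j‖) := by
    intro j
    have hmpos : 0 < |m j| := abs_pos.2 (hm j)
    rw [inner_add_right, inner_add_right, Complex.add_re, Complex.add_re, mul_add, mul_add]
    refine add_le_add (add_le_add ?_ ?_) ?_
    -- With `M = C1 ∑ |m_j|`, the gain `κ / |m_j|` is at least `C1 Ω`.
    · refine (re_inner_energyOp_laplacian_le hκ (hm j) hs (fun a => h1 a j) fun a => h2 a j).trans ?_
      rw [mul_add, mul_neg]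
      refine add_le_add (neg_le_neg ?_) ?_
      · refine mul_le_mul_of_nonneg_right ?_ (hY0 j)
        rw [le_div_iff₀ hmpos, hκdef, hM]
        calc C1 * Ω * |m j| ≤ C1 * Ω * mm := by gcongr; exact hmj j
          _ = _ := by ring
      · calc κ / |m j| * (8 * (s⁻¹ * ‖u j‖ ^ 2)) = M * |m j|⁻¹ * Ω * (8 * (s⁻¹ * ‖u j‖ ^ 2)) := by
              rw [hκdef]; ring
          _ ≤ M * ii * Ω * (8 * (s⁻¹ * ‖u j‖ ^ 2)) := by gcongr; exact hij j
          _ = _ := by ring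
    · rw [inner_sum, Complex.re_sum, Finset.mul_sum]
      refine Finset.sum_le_sum fun k _ => ?_
      rw [inner_sum, Complex.re_sum, Finset.mul_sum]
      refine Finset.sum_le_sum fun a _ => ?_
      refine (hT κ (m j) s (c * Ω) a (g j k a) hκ hMΩ (hm j) hs (by positivity) (hg j k a) (u j)
        (u' a j) u (u' a) k (h1 a j) (h1 a)).trans (le_of_eq ?_)
      rcases k with k | k <;> rfl
    · have h3 := (Complex.re_le_norm _).trans
        (norm_inner_le_norm (𝕜 := ℂ) (energyOp κ (m j) s (u j)) (E j))
      have h4 := mul_le_mul_of_nonneg_right (norm_energyOp_le hκ hMΩ (hm j) s (u j))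
        (norm_nonneg (E j))
      linarith
  refine (Finset.sum_le_sum fun j _ => hj j).trans (le_of_eq ?_)
  have e := sum_sum_sum_add_eq Y
  simp only [← Finset.mul_sum, Finset.sum_add_distrib, Finset.sum_neg_distrib] at e ⊢
  rw [hC1]
  linear_combination (K * (c * Ω)) * e

/-! ### Integration in time -/

/-- A function that decreases at small scales decreases. -/
theorem sub_le_of_forall_local {a b δ : ℝ} (hab : a ≤ b) (hδ : 0 < δ) {g : ℝ → ℝ}
    (h : ∀ t ∈ Icc a b, ∀ t' ∈ Icc a b, t ≤ t' → t' - t < δ → g t' ≤ g t) : g b ≤ g a := by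
  obtain ⟨n, hn⟩ := exists_nat_gt ((b - a) / δ)
  have hn0 : (0 : ℝ) < n := lt_of_le_of_lt (div_nonneg (sub_nonneg.2 hab) hδ.le) hn
  have hd0 : 0 ≤ (b - a) / n := div_nonneg (sub_nonneg.2 hab) hn0.le
  have hd : (b - a) / n < δ := by
    rw [div_lt_iff₀ hn0]
    rw [div_lt_iff₀ hδ] at hn
    linarith
  have hend : a + n * ((b - a) / n) = b := by field_simp; ring
  have key : ∀ i : ℕ, i ≤ n → g (a + i * ((b - a) / n)) ≤ g a := by
    intro i
    induction i with
    | zero => intro _; simp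
    | succ i ih =>
      intro hi
      have hi' : ((i : ℝ) + 1) ≤ n := by exact_mod_cast hi
      refine (h _ ⟨?_, ?_⟩ _ ⟨?_, ?_⟩ ?_ ?_).trans (ih (by omega))
      · have : 0 ≤ (i : ℝ) * ((b - a) / n) := by positivity
        linarith
      · have := mul_le_mul_of_nonneg_right (show (i : ℝ) ≤ n by linarith) hd0
        linarith
      · have : 0 ≤ ((i + 1 : ℕ) : ℝ) * ((b - a) / n) := by positivity
        linarith
      · have := mul_le_mul_of_nonneg_right hi' hd0
        push_cast
        linarith
      · push_cast; linarith
      · push_cast; linarith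
  have := key n le_rfl
  rwa [hend] at this

theorem intervalIntegrable_re_inner {E : Type*} [NormedAddCommGroup E] [InnerProductSpace ℂ E]
    {a b : ℝ} (hab : a ≤ b) {p Φ : ℝ → E} (hp : ContinuousOn p (Icc a b))
    (hΦ : IntervalIntegrable Φ volume a b) :
    IntervalIntegrable (fun τ => (inner ℂ (p τ) (Φ τ) : ℂ).re) volume a b := by
  rw [intervalIntegrable_iff_integrableOn_Icc_of_le hab] at hΦ ⊢
  obtain ⟨K, hK⟩ := isCompact_Icc.exists_bound_of_continuousOn hp
  refine Integrable.mono' (hΦ.norm.const_mul K) ?_ ?_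
  · exact Complex.continuous_re.comp_aestronglyMeasurable
      ((hp.aestronglyMeasurable measurableSet_Icc).inner hΦ.aestronglyMeasurable)
  · refine (ae_restrict_iff' measurableSet_Icc).2 (Filter.Eventually.of_forall fun τ hτ => ?_)
    refine (Complex.abs_re_le_norm _).trans ((norm_inner_le_norm (𝕜 := ℂ) _ _).trans ?_)
    gcongr
    exact hK τ hτ

/-- The energy inequality for `u = u(a) + ∫ Φ` and a self-adjoint family `B(t)` that is
one-sidedly Lipschitz in time. -/
theorem re_inner_sub_le_integral {E : Type*} [NormedAddCommGroup E] [InnerProductSpace ℂ E]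
    [CompleteSpace E] {a b : ℝ} (hab : a ≤ b) {u Φ : ℝ → E} {B : ℝ → E →L[ℂ] E} {l : ℝ → ℝ}
    (hu : ContinuousOn u (Icc a b)) (hΦ : IntervalIntegrable Φ volume a b)
    (hint : ∀ t ∈ Icc a b, u t = u a + ∫ τ in a..t, Φ τ)
    (hB : ContinuousOn B (Icc a b)) (hBs : ∀ t x y, (inner ℂ (B t x) y : ℂ) = inner ℂ x (B t y))
    (hl : ContinuousOn l (Icc a b))
    (hL : ∀ t ∈ Icc a b, ∀ t' ∈ Icc a b, t ≤ t' → ‖B t' - B t‖ ≤ l t * (t' - t)) :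
    (inner ℂ (B b (u b)) (u b) : ℂ).re - (inner ℂ (B a (u a)) (u a) : ℂ).re
      ≤ ∫ τ in a..b, (2 * (inner ℂ (B τ (u τ)) (Φ τ) : ℂ).re + l τ * ‖u τ‖ ^ 2) := by
  have hBu : ContinuousOn (fun τ => B τ (u τ)) (Icc a b) := hB.clm_apply hu
  have hlu : ContinuousOn (fun τ => l τ * ‖u τ‖ ^ 2) (Icc a b) := hl.mul (hu.norm.pow 2)
  have sub : ∀ {t t'}, t ∈ Icc a b → t' ∈ Icc a b → t ≤ t' → uIcc t t' ⊆ uIcc a b := by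
    intro t t' ht ht' h
    rw [uIcc_of_le h, uIcc_of_le hab]
    exact Icc_subset_Icc ht.1 ht'.2
  have hI : IntervalIntegrable (fun τ => 2 * (inner ℂ (B τ (u τ)) (Φ τ) : ℂ).re
      + l τ * ‖u τ‖ ^ 2) volume a b :=
    ((intervalIntegrable_re_inner hab hBu hΦ).const_mul 2).add
      (ContinuousOn.intervalIntegrable (by rwa [uIcc_of_le hab]))
  have hH : IntervalIntegrable (fun τ => 1 + ‖Φ τ‖) volume a b :=
    (intervalIntegrable_const).add hΦ.norm
  have hcomp : IsCompact (Icc a b ×ˢ Icc a b) := isCompact_Icc.prod isCompact_Icc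
  have hr : ContinuousOn (fun p : ℝ × ℝ => B p.1 (u p.2)) (Icc a b ×ˢ Icc a b) :=
    (hB.comp continuousOn_fst fun p hp => hp.1).clm_apply
      (hu.comp continuousOn_snd fun p hp => hp.2)
  have hq : ContinuousOn (fun p : ℝ × ℝ => l p.1 * ‖u p.2‖ ^ 2) (Icc a b ×ˢ Icc a b) :=
    (hl.comp continuousOn_fst fun p hp => hp.1).mul
      ((hu.comp continuousOn_snd fun p hp => hp.2).norm.pow 2)
  set e : ℝ → ℝ := fun t => (inner ℂ (B t (u t)) (u t) : ℂ).re with he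
  set h : ℝ → ℝ := fun t => ∫ τ in a..t, (1 + ‖Φ τ‖) with hh
  set f : ℝ → ℝ := fun t => e t - ∫ τ in a..t, (2 * (inner ℂ (B τ (u τ)) (Φ τ) : ℂ).re
      + l τ * ‖u τ‖ ^ 2) with hf
  -- The function `f - ε h` decreases at small scales by uniform continuity; no derivative of `B` in
  -- time is needed.
  have main : ∀ ε > 0, f b - ε * h b ≤ f a - ε * h a := by
    intro ε hε
    obtain ⟨δ₁, hδ₁, hr'⟩ := Metric.uniformContinuousOn_iff.1
      (hcomp.uniformContinuousOn_of_continuous hr) (ε / 2) (by positivity)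
    obtain ⟨δ₂, hδ₂, hq'⟩ := Metric.uniformContinuousOn_iff.1
      (hcomp.uniformContinuousOn_of_continuous hq) ε hε
    refine sub_le_of_forall_local (g := fun t => f t - ε * h t) hab (lt_min hδ₁ hδ₂)
      fun t ht t' ht' htt hd => ?_
    have iI := hI.mono_set (sub ht ht' htt)
    have iH := hH.mono_set (sub ht ht' htt)
    have iΦ := hΦ.mono_set (sub ht ht' htt)
    have ha : a ∈ Icc a b := left_mem_Icc.2 hab
    have d1 : f t' - f t = e t' - e t - ∫ τ in t..t', (2 * (inner ℂ (B τ (u τ)) (Φ τ) : ℂ).re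
        + l τ * ‖u τ‖ ^ 2) := by
      rw [← intervalIntegral.integral_interval_sub_left (hI.mono_set (sub ha ht' ht'.1))
        (hI.mono_set (sub ha ht ht.1))]
      simp only [hf]; ring
    have d2 : h t' - h t = ∫ τ in t..t', (1 + ‖Φ τ‖) := by
      rw [← intervalIntegral.integral_interval_sub_left (hH.mono_set (sub ha ht' ht'.1))
        (hH.mono_set (sub ha ht ht.1))]
    have d3 : u t' - u t = ∫ τ in t..t', Φ τ := by
      rw [← intervalIntegral.integral_interval_sub_left (hΦ.mono_set (sub ha ht' ht'.1))
        (hΦ.mono_set (sub ha ht ht.1)), hint t' ht', hint t ht]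
      abel
    have d4 : e t' - e t = (inner ℂ ((B t' - B t) (u t')) (u t') : ℂ).re
        + ∫ τ in t..t', (inner ℂ (B t (u t') + B t (u t)) (Φ τ) : ℂ).re := by
      have c1 : ∫ τ in t..t', (inner ℂ (B t (u t') + B t (u t)) (Φ τ) : ℂ).re
          = (inner ℂ (B t (u t') + B t (u t)) (u t' - u t) : ℂ).re := by
        rw [d3]
        exact (Complex.reCLM.comp ((innerSL ℂ (B t (u t') + B t (u t))).restrictScalars
          ℝ)).intervalIntegral_comp_comm iΦ
      have c4 : (inner ℂ (B t (u t)) (u t') : ℂ).re = (inner ℂ (B t (u t')) (u t) : ℂ).re := by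
        rw [hBs, ← inner_conj_symm, Complex.conj_re]
      rw [c1, _root_.sub_apply, inner_sub_left, inner_sub_right, inner_add_left, inner_add_left]
      simp only [he, Complex.add_re, Complex.sub_re]
      rw [c4]; ring
    have d5 : (inner ℂ ((B t' - B t) (u t')) (u t') : ℂ).re
        ≤ ∫ _τ in t..t', l t * ‖u t'‖ ^ 2 := by
      rw [intervalIntegral.integral_const, smul_eq_mul]
      calc _ ≤ ‖(B t' - B t) (u t')‖ * ‖u t'‖ :=
            (Complex.re_le_norm _).trans (norm_inner_le_norm (𝕜 := ℂ) _ _)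
        _ ≤ (l t * (t' - t) * ‖u t'‖) * ‖u t'‖ := by
            gcongr
            exact ((B t' - B t).le_opNorm _).trans (by gcongr; exact hL t ht t' ht' htt)
        _ = _ := by ring
    have iR := intervalIntegrable_re_inner htt
      (p := fun _ => B t (u t') + B t (u t)) continuousOn_const iΦ
    have d6 : f t' - f t ≤ ∫ τ in t..t', ε * (1 + ‖Φ τ‖) := by
      rw [d1, d4]
      have i1 : IntervalIntegrable (fun _ : ℝ => l t * ‖u t'‖ ^ 2) volume t t' :=
        intervalIntegrable_const
      calc _ ≤ (∫ _τ in t..t', l t * ‖u t'‖ ^ 2)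
            + (∫ τ in t..t', (inner ℂ (B t (u t') + B t (u t)) (Φ τ) : ℂ).re)
            - ∫ τ in t..t', (2 * (inner ℂ (B τ (u τ)) (Φ τ) : ℂ).re + l τ * ‖u τ‖ ^ 2) := by
            linarith
        _ = ∫ τ in t..t', (l t * ‖u t'‖ ^ 2 + (inner ℂ (B t (u t') + B t (u t)) (Φ τ) : ℂ).re
            - (2 * (inner ℂ (B τ (u τ)) (Φ τ) : ℂ).re + l τ * ‖u τ‖ ^ 2)) := by
            rw [intervalIntegral.integral_sub (i1.add iR) iI, intervalIntegral.integral_add i1 iR]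
        _ ≤ _ := by
            refine intervalIntegral.integral_mono_on htt ((i1.add iR).sub iI) (iH.const_mul ε)
              fun τ hτ => ?_
            have hτ' : τ ∈ Icc a b := ⟨ht.1.trans hτ.1, hτ.2.trans ht'.2⟩
            have dd : dist (t, t') (τ, τ) < min δ₁ δ₂ := by
              rw [Prod.dist_eq, Real.dist_eq, Real.dist_eq]
              refine max_lt ?_ ?_
              · rw [abs_lt]; constructor <;> linarith [hτ.1, hτ.2]
              · rw [abs_lt]; constructor <;> linarith [hτ.1, hτ.2]
            have dd' : dist (t, t) (τ, τ) < min δ₁ δ₂ := by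
              rw [Prod.dist_eq, Real.dist_eq]
              refine max_lt ?_ ?_ <;>
              · rw [abs_lt]; constructor <;> linarith [hτ.1, hτ.2]
            have q1 := hq' (t, t') ⟨ht, ht'⟩ (τ, τ) ⟨hτ', hτ'⟩ (dd.trans_le (min_le_right _ _))
            have r1 := hr' (t, t') ⟨ht, ht'⟩ (τ, τ) ⟨hτ', hτ'⟩ (dd.trans_le (min_le_left _ _))
            have r2 := hr' (t, t) ⟨ht, ht⟩ (τ, τ) ⟨hτ', hτ'⟩ (dd'.trans_le (min_le_left _ _))
            rw [Real.dist_eq] at q1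
            rw [dist_eq_norm] at r1 r2
            simp only at q1 r1 r2
            have e1 : (inner ℂ (B t (u t') + B t (u t)) (Φ τ) : ℂ).re
                - 2 * (inner ℂ (B τ (u τ)) (Φ τ) : ℂ).re
                = (inner ℂ ((B t (u t') - B τ (u τ)) + (B t (u t) - B τ (u τ))) (Φ τ) : ℂ).re := by
              simp only [inner_add_left, inner_sub_left, Complex.add_re, Complex.sub_re]; ring
            have e2 : (inner ℂ ((B t (u t') - B τ (u τ)) + (B t (u t) - B τ (u τ))) (Φ τ) : ℂ).re
                ≤ ε * ‖Φ τ‖ := by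
              refine (Complex.re_le_norm _).trans ((norm_inner_le_norm (𝕜 := ℂ) _ _).trans ?_)
              gcongr
              exact (norm_add_le _ _).trans (by linarith)
            have q2 := (abs_lt.1 q1).2
            linarith
    rw [intervalIntegral.integral_const_mul, ← d2] at d6
    change f t' - ε * h t' ≤ f t - ε * h t
    linarith
  have ha0 : h a = 0 := by simp [hh]
  have hfa : f a = e a := by simp [hf]
  have hb0 : 0 ≤ h b := intervalIntegral.integral_nonneg hab fun τ _ => by positivity
  have hle : f b ≤ f a := by
    by_contra hcon
    push Not at hcon
    have h1 := main ((f b - f a) / (2 * (h b + 1))) (by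
      have : 0 < f b - f a := by linarith
      positivity)
    rw [ha0, mul_zero, sub_zero] at h1
    have h2 : (f b - f a) / (2 * (h b + 1)) * h b ≤ (f b - f a) / 2 := by
      rw [div_mul_eq_mul_div, div_le_div_iff₀ (by positivity) (by norm_num)]
      nlinarith
    linarith
  rw [hfa] at hle
  simp only [hf] at hle
  change e b - e a ≤ _
  linarith

/-! ### Measurability in time and components of vector functions -/

theorem second_countable_H : SecondCountableTopology H :=
  haveI : Fact ((2 : ℝ≥0∞) ≠ ∞) := ⟨by simp⟩
  inferInstance

/-- Pettis' theorem in `L²`, tested on Schwartz functions. -/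
theorem aestronglyMeasurable_of_inner_schwartz {ν : Measure ℝ} {F : ℝ → H}
    (h : ∀ ψ : 𝓢(Plane, ℂ), AEStronglyMeasurable (fun τ => (inner ℂ (ψ.toLp 2) (F τ) : ℂ)) ν) :
    AEStronglyMeasurable F ν := by
  have h1 : ∀ x : H, AEStronglyMeasurable (fun τ => (inner ℂ x (F τ) : ℂ)) ν := by
    intro x
    obtain ⟨φ, hφ⟩ := exists_schwartz_tendsto x
    exact aestronglyMeasurable_of_tendsto_ae Filter.atTop (fun n => h (φ n))
      (Filter.Eventually.of_forall fun τ => hφ.inner tendsto_const_nhds)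
  have := second_countable_H
  -- Approximate by projections onto the spans of finitely many members of a dense sequence.
  set d := TopologicalSpace.denseSeq H with hd
  set U : ℕ → Submodule ℂ H := fun n => Submodule.span ℂ (d '' Iio n) with hU
  have hfin : ∀ n, FiniteDimensional ℂ (U n) := fun n =>
    FiniteDimensional.span_of_finite ℂ ((finite_Iio n).image d)
  have hmono : Monotone U := fun i j hij => Submodule.span_mono (image_mono (Iio_subset_Iio hij))
  have hdense : ⊤ ≤ (⨆ n, U n).topologicalClosure := by
    have h2 : Set.range d ⊆ (⨆ n, U n : Submodule ℂ H) := by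
      rintro _ ⟨n, rfl⟩
      exact (le_iSup U (n + 1)) (Submodule.subset_span ⟨n, by simp, rfl⟩)
    intro x _
    exact closure_mono h2 (TopologicalSpace.denseRange_denseSeq H x)
  refine aestronglyMeasurable_of_tendsto_ae Filter.atTop
    (f := fun n τ => (U n).starProjection (F τ)) (fun n => ?_)
    (Filter.Eventually.of_forall fun τ => Submodule.starProjection_tendsto_self U hmono (F τ) hdense)
  set b := stdOrthonormalBasis ℂ (U n)
  have e : (fun τ => (U n).starProjection (F τ))
      = fun τ => ∑ i, (inner ℂ (b i : H) (F τ) : ℂ) • (b i : H) := by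
    ext1 τ
    rw [b.starProjection_eq_sum_rankOne]
    simp [InnerProductSpace.rankOne_apply]
  rw [e]
  exact Finset.aestronglyMeasurable_fun_sum _ fun i _ => (h1 (b i)).smul_const _

theorem inner_toLp_eq_integral (φ : 𝓢(Plane, ℂ)) (f : H) :
    (inner ℂ (φ.toLp 2) f : ℂ) = ∫ x, f x * conjS φ x := by
  rw [inner_eq_integral]
  refine integral_congr_ae ?_
  filter_upwards [φ.coeFn_toLp 2 volume] with x hx
  rw [hx, conjS_apply, mul_comm]

theorem aestronglyMeasurable_mulOp {ν : Measure ℝ} {g : ℝ → Linf}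
    (hg : ∀ φ : 𝓢(Plane, ℂ), AEStronglyMeasurable (fun t => ∫ x, g t x * φ x) ν) {w : ℝ → H}
    (hw : AEStronglyMeasurable w ν) : AEStronglyMeasurable (fun t => mulOp (g t) (w t)) ν := by
  refine aestronglyMeasurable_of_inner_schwartz fun ψ => ?_
  have h1 : AEStronglyMeasurable (fun t => mulOp (fun x => starRingEnd ℂ (g t x)) (ψ.toLp 2)) ν := by
    refine aestronglyMeasurable_of_inner_schwartz fun χ => ?_
    have h2 := Complex.continuous_conj.comp_aestronglyMeasurable (hg (mulS χ (conjS ψ)))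
    refine h2.congr (Filter.Eventually.of_forall fun t => ?_)
    beta_reduce
    rw [inner_toLp_eq_integral, ← integral_conj]
    refine integral_congr_ae ?_
    filter_upwards [coeFn_mulOp (memLp_conj (memLp_linf (g t))) (ψ.toLp 2),
      ψ.coeFn_toLp 2 volume] with x k1 k2
    rw [k1, k2, mulS_apply, conjS_apply, conjS_apply]
    simp only [map_mul, Complex.conj_conj]
    ring
  refine (h1.inner hw).congr (Filter.Eventually.of_forall fun t => ?_)
  beta_reduce
  rw [inner_mulOp_right (memLp_linf (g t))]

theorem aestronglyMeasurable_weakPartial {ν : Measure ℝ} {g : ℝ → Linf} {a : Fin 2}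
    (hg : ∀ φ : 𝓢(Plane, ℂ), AEStronglyMeasurable (fun t => ∫ x, g t x * φ x) ν)
    (h : ∀ᵐ t ∂ν, Lp.toTemperedDistribution (weakPartial a (g t))
      = ∂_{stdVec a} (Lp.toTemperedDistribution (g t))) (φ : 𝓢(Plane, ℂ)) :
    AEStronglyMeasurable (fun t => ∫ x, weakPartial a (g t) x * φ x) ν := by
  refine (hg (∂_{stdVec a} φ)).neg.congr ?_
  filter_upwards [h] with t ht
  have := integral_lineDeriv_mul_linf ht φ
  simp only [Pi.neg_apply, mul_comm _ (φ _), mul_comm _ ((∂_{stdVec a} φ) _)]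
  rw [this, neg_neg]

/-- The `j`-th component of an element of `L²(ℝ²; ℂ^N)`. -/
def comp {N : ℕ} (j : Fin N) : L2 N →L[ℂ] H :=
  (EuclideanSpace.proj j : EuclideanSpace ℂ (Fin N) →L[ℂ] ℂ).compLpL 2 volume

theorem coeFn_comp {N : ℕ} (j : Fin N) (v : L2 N) : comp j v =ᵐ[volume] fun x => v x j :=
  ContinuousLinearMap.coeFn_compLpL _ v

theorem norm_sq_eq_integral {E : Type*} [NormedAddCommGroup E] [InnerProductSpace ℂ E]
    (f : Lp E 2 (volume : Measure Plane)) : ‖f‖ ^ 2 = ∫ x, ‖f x‖ ^ 2 := by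
  have h1 := L2.inner_def (𝕜 := ℂ) f f
  rw [inner_self_eq_norm_sq_to_K] at h1
  have h2 : ((‖f‖ ^ 2 : ℝ) : ℂ) = ((∫ x, ‖f x‖ ^ 2 : ℝ) : ℂ) := by
    rw [← integral_complex_ofReal]
    push_cast
    refine h1.trans (integral_congr_ae (Filter.Eventually.of_forall fun x => ?_))
    exact inner_self_eq_norm_sq_to_K _
  exact_mod_cast h2

theorem norm_sq_eq_sum_comp {N : ℕ} (v : L2 N) : ‖v‖ ^ 2 = ∑ j, ‖comp j v‖ ^ 2 := by
  have hi : ∀ f : H, Integrable (fun x => ‖f x‖ ^ 2) volume := fun f =>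
    (Lp.memLp f).integrable_norm_pow (by norm_num)
  simp only [norm_sq_eq_integral]
  rw [← integral_finsetSum _ fun j _ => hi (comp j v)]
  refine integral_congr_ae ?_
  filter_upwards [ae_all_iff.2 fun j => coeFn_comp j v] with x hx
  rw [EuclideanSpace.norm_sq_eq]
  exact Finset.sum_congr rfl fun j _ => by rw [hx j]

theorem norm_comp_le {N : ℕ} (j : Fin N) (v : L2 N) : ‖comp j v‖ ≤ ‖v‖ := by
  refine abs_le_of_sq_le_sq' ?_ (norm_nonneg v) |>.2
  rw [norm_sq_eq_sum_comp]
  exact Finset.single_le_sum (f := fun j => ‖comp j v‖ ^ 2) (fun _ _ => by positivity)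
    (Finset.mem_univ j)

theorem norm_sharpH_comp_le {N : ℕ} (k : Fin N ⊕ Fin N) (v : L2 N) :
    ‖sharpH (fun j => comp j v) k‖ ≤ ‖v‖ := by
  rcases k with j | j
  · exact norm_comp_le j v
  · exact (norm_star_eq _).trans_le (norm_comp_le j v)

theorem coeFn_sharpH_comp {N : ℕ} (k : Fin N ⊕ Fin N) (v : L2 N) :
    sharpH (fun j => comp j v) k =ᵐ[volume] fun x => sharp (v x) k := by
  rcases k with j | j
  · exact coeFn_comp j v
  · filter_upwards [coeFn_comp j v, coeFn_star_eq (comp j v)] with x h1 h2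
    exact h2.trans (by rw [h1]; rfl)

theorem dist_star_eq (f g : H) : dist (star f) (star g) = dist f g := by
  rw [dist_eq_norm, dist_eq_norm, ← norm_star_eq (f - g)]
  congr 1
  refine Lp.ext ?_
  filter_upwards [coeFn_star_eq f, coeFn_star_eq g, coeFn_star_eq (f - g),
    Lp.coeFn_sub (star f) (star g), Lp.coeFn_sub f g] with x h1 h2 h3 h4 h5
  rw [h3, h4, h5, Pi.sub_apply, Pi.sub_apply, h1, h2, map_sub]

theorem continuous_sharpH_comp {N : ℕ} (k : Fin N ⊕ Fin N) :
    Continuous fun v : L2 N => sharpH (fun j => comp j v) k := by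
  rcases k with j | j
  · exact (comp j).continuous
  · exact (Isometry.of_dist_eq dist_star_eq).continuous.comp (comp j).continuous

/-! ### The regularized equation -/

theorem conj_rsym (ε : ℝ) (ξ : Plane) : starRingEnd ℂ (rsym ε ξ) = rsym ε ξ := Complex.conj_ofReal _

theorem inner_res_left (ε : ℝ) (f g : H) : (inner ℂ (res ε f) g : ℂ) = inner ℂ f (res ε g) := by
  rw [res, inner_fourierMul_left (memLp_rsym ε)]
  simp only [conj_rsym]

theorem inner_resD_left {ε : ℝ} (hε : 0 < ε) (a : Fin 2) (f g : H) :
    (inner ℂ (resD ε a f) g : ℂ) = -inner ℂ f (resD ε a g) := by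
  rw [resD, inner_fourierMul_left (memLp_dsym_mul_rsym hε a), ← inner_neg_right, ← neg_one_smul ℂ,
    ← fourierMul_const_mul _ (memLp_dsym_mul_rsym hε a)]
  congr 3
  ext ξ
  rw [map_mul, conj_rsym, conj_dsym]; ring

theorem inner_resDD_left {ε : ℝ} (hε : 0 < ε) (a b : Fin 2) (f g : H) :
    (inner ℂ (resDD ε a b f) g : ℂ) = inner ℂ f (resDD ε a b g) := by
  rw [resDD, inner_fourierMul_left (memLp_dsym_mul_dsym_mul_rsym hε a b)]
  congr 3
  ext ξ
  rw [map_mul, map_mul, conj_rsym, conj_dsym, conj_dsym]; ring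

theorem laplacian_eq_sum_stdVec (φ : 𝓢(Plane, ℂ)) :
    Δ φ = ∑ b, ∂_{stdVec b} (∂_{stdVec b} φ) := by
  rw [SchwartzMap.laplacian_eq_sum (EuclideanSpace.basisFun (Fin 2) ℝ)]
  simp only [EuclideanSpace.basisFun_apply, stdVec]

theorem CoeffBound.norm_mulOp_le {s W : ℝ} {g : Linf} (hs : 1 ≤ s)
    (h : CoeffBound s W g) (f : H) : ‖mulOp g f‖ ≤ W * ‖f‖ := by
  refine NLSEnergy.norm_mulOp_le (memLp_linf g) ?_ f
  filter_upwards [h.norm_mul_le 0] with x hx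
  have hs0 : 0 < s := by linarith
  rw [norm_mul, Complex.norm_real, Real.norm_of_nonneg (by positivity)] at hx
  have h1 : s ≤ s ^ 2 + x 0 ^ 2 := by nlinarith [sq_nonneg (x 0)]
  have h2 : ‖g x‖ * s ≤ W * s := (mul_le_mul_of_nonneg_left h1 (norm_nonneg _)).trans hx
  exact le_of_mul_le_mul_right h2 hs0

theorem CoeffBound.norm_commErr_le {s W ε : ℝ} {g : Linf} (hε : 0 < ε) (h : CoeffBound s W g)
    (a : Fin 2) (f : H) : ‖commErr ε a g f‖ ≤ 4 * (W / s) * ‖f‖ :=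
  norm_commErr_le_norm hε a h.weakPartial_eq h.norm_weakPartial f

theorem sharpH_resD {N : ℕ} {ε : ℝ} (hε : 0 < ε) (a : Fin 2) (f : Fin N → H) (k : Fin N ⊕ Fin N) :
    sharpH (fun j => resD ε a (f j)) k = resD ε a (sharpH f k) := by
  rcases k with j | j
  · rfl
  · exact (resD_star hε a (f j)).symm

section Equation

variable {N : ℕ} {m : Fin N → ℝ} {g : Coeff N} {G v : ℝ → L2 N} {t₀ T : ℝ}

theorem IsSolution.continuousOn_sharpH (h : IsSolution m g G v t₀ T) (k : Fin N ⊕ Fin N) {t : ℝ}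
    (ht : t < T) : ContinuousOn (fun τ => sharpH (fun j => comp j (v τ)) k) (Icc t₀ t) :=
  (continuous_sharpH_comp k).comp_continuousOn
    (h.continuousOn.mono fun _ hx => ⟨hx.1, hx.2.trans_lt ht⟩)

/-- Weak measurability of the coefficients is enough for the strong measurability of the first order
terms in `L²`, because `L²` is separable. -/
theorem IsSolution.aestronglyMeasurable_commErr (h : IsSolution m g G v t₀ T) {W ε : ℝ}
    (hW : ∀ t ∈ Ico t₀ T, ∀ j k a, CoeffBound (bracket t) W (g t j k a)) (j : Fin N)
    (k : Fin N ⊕ Fin N) (a : Fin 2) {t : ℝ} (ht : t < T) :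
    AEStronglyMeasurable (fun τ => mulOp (g τ j k a) (resD ε a (sharpH (fun j => comp j (v τ)) k)))
      (volume.restrict (Icc t₀ t)) ∧
    AEStronglyMeasurable (fun τ => commErr ε a (g τ j k a) (sharpH (fun j => comp j (v τ)) k))
      (volume.restrict (Icc t₀ t)) := by
  have hsub : Icc t₀ t ⊆ Ico t₀ T := fun _ hx => ⟨hx.1, hx.2.trans_lt ht⟩
  have hg : ∀ φ : 𝓢(Plane, ℂ), AEStronglyMeasurable (fun τ => ∫ x, g τ j k a x * φ x)
      (volume.restrict (Icc t₀ t)) := fun φ => (h.coeff_measurable j k a φ).mono_set hsub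
  have hd := aestronglyMeasurable_weakPartial (a := a) hg
    ((ae_restrict_iff' measurableSet_Icc).2 (Filter.Eventually.of_forall fun τ hτ =>
      (hW τ (hsub hτ) j k a).weakPartial_eq a))
  have hw := (h.continuousOn_sharpH k ht).aestronglyMeasurable measurableSet_Icc (μ := volume)
  have h1 := aestronglyMeasurable_mulOp hg
    ((resD ε a).continuous.comp_aestronglyMeasurable hw)
  have h2 := (resD ε a).continuous.comp_aestronglyMeasurable (aestronglyMeasurable_mulOp hg hw)
  have h3 := (res ε).continuous.comp_aestronglyMeasurable (aestronglyMeasurable_mulOp hd hw)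
  exact ⟨h1, (h2.sub h3).sub h1⟩

theorem IsSolution.integrableOn_commErr (h : IsSolution m g G v t₀ T) {W ε : ℝ} (hε : 0 < ε)
    (hW0 : 0 ≤ W)
    (hW : ∀ t ∈ Ico t₀ T, ∀ j k a, CoeffBound (bracket t) W (g t j k a)) (j : Fin N)
    (k : Fin N ⊕ Fin N) (a : Fin 2) {t : ℝ} (ht : t < T) :
    IntegrableOn (fun τ => mulOp (g τ j k a) (resD ε a (sharpH (fun j => comp j (v τ)) k)))
      (Icc t₀ t) ∧
    IntegrableOn (fun τ => commErr ε a (g τ j k a) (sharpH (fun j => comp j (v τ)) k))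
      (Icc t₀ t) := by
  obtain ⟨h1, h2⟩ := h.aestronglyMeasurable_commErr (ε := ε) hW j k a ht
  have hc := h.continuousOn_sharpH k ht
  obtain ⟨K, hK⟩ := isCompact_Icc.exists_bound_of_continuousOn hc
  obtain ⟨L, hL⟩ := isCompact_Icc.exists_bound_of_continuousOn
    ((resD ε a).continuous.comp_continuousOn hc)
  constructor
  · refine Integrable.mono' (integrable_const (W * L)) h1
      ((ae_restrict_iff' measurableSet_Icc).2 (Filter.Eventually.of_forall fun τ hτ => ?_))
    refine ((hW τ ⟨hτ.1, hτ.2.trans_lt ht⟩ j k a).norm_mulOp_le (one_le_bracket τ) _).trans ?_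
    gcongr
    exact hL τ hτ
  · refine Integrable.mono' (integrable_const (4 * W * K)) h2
      ((ae_restrict_iff' measurableSet_Icc).2 (Filter.Eventually.of_forall fun τ hτ => ?_))
    refine ((hW τ ⟨hτ.1, hτ.2.trans_lt ht⟩ j k a).norm_commErr_le hε a _).trans ?_
    have := hK τ hτ
    gcongr
    exact div_le_self hW0 (one_le_bracket τ)

/-- The regularized first order terms and source, with `R = (1 - ε² Δ)⁻¹`. -/
def forcing (g : Coeff N) (G v : ℝ → L2 N) (ε : ℝ) (j : Fin N) (τ : ℝ) : H :=
  ∑ k, ∑ a, firstOrder ε a (g τ j k a) (sharpH (fun j => comp j (v τ)) k) + res ε (comp j (G τ))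

theorem IsSolution.integrableOn_source (h : IsSolution m g G v t₀ T) {t : ℝ}
    (ht : t ∈ Ico t₀ T) : IntegrableOn G (Icc t₀ t) :=
  (intervalIntegrable_iff_integrableOn_Icc_of_le ht.1).1 (h.source_integrable t ht)

theorem IsSolution.integrableOn_forcing (h : IsSolution m g G v t₀ T) {W ε : ℝ} (hε : 0 < ε)
    (hW0 : 0 ≤ W)
    (hW : ∀ t ∈ Ico t₀ T, ∀ j k a, CoeffBound (bracket t) W (g t j k a)) (j : Fin N) {t : ℝ}
    (ht : t ∈ Ico t₀ T) : IntegrableOn (forcing g G v ε j) (Icc t₀ t) := by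
  refine Integrable.add (integrable_finsetSum _ fun k _ => integrable_finsetSum _ fun a _ => ?_) ?_
  · obtain ⟨h1, h2⟩ := h.integrableOn_commErr hε hW0 hW j k a ht.2
    refine (h1.add h2).congr (Filter.Eventually.of_forall fun τ => ?_)
    simp only [Pi.add_apply, commErr]
    abel
  · exact ((res ε).comp (comp j)).integrable_comp (h.integrableOn_source ht)

theorem coeffPairing_eq_inner {ε : ℝ} (hε : 0 < ε) (a : Fin 2) (g : Linf) (k : Fin N ⊕ Fin N)
    (v : L2 N) (ψ φ : 𝓢(Plane, ℂ)) (hφ : res ε (ψ.toLp 2) = φ.toLp 2) :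
    coeffPairing a g (fun x => sharp (v x) k) (conjS φ)
      = inner ℂ (ψ.toLp 2) (firstOrder ε a g (sharpH (fun j => comp j v) k)) := by
  set w := sharpH (fun j => comp j v) k with hw
  have hD : resD ε a (ψ.toLp 2) = (∂_{stdVec a} φ).toLp 2 :=
    (hasD_res hε a _).unique (hφ ▸ hasD_toLp a φ)
  rw [firstOrder, inner_sub_right, ← inner_res_left, hφ]
  have h1 : (inner ℂ (ψ.toLp 2) (resD ε a (mulOp g w)) : ℂ)
      = -inner ℂ ((∂_{stdVec a} φ).toLp 2) (mulOp g w) := by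
    rw [← hD, inner_resD_left hε, neg_neg]
  have e1 : (inner ℂ ((∂_{stdVec a} φ).toLp 2) (mulOp g w) : ℂ)
      = ∫ x, g x * sharp (v x) k * (∂_{stdVec a} (conjS φ)) x := by
    rw [inner_toLp_eq_integral, lineDeriv_conjS]
    refine integral_congr_ae ?_
    filter_upwards [coeFn_mulOp (memLp_linf g) w, coeFn_sharpH_comp k v] with x k1 k2
    rw [k1, hw, k2]
  have e2 : (inner ℂ (φ.toLp 2) (mulOp (weakPartial a g) w) : ℂ)
      = ∫ x, weakPartial a g x * sharp (v x) k * conjS φ x := by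
    rw [inner_toLp_eq_integral]
    refine integral_congr_ae ?_
    filter_upwards [coeFn_mulOp (memLp_linf (weakPartial a g)) w, coeFn_sharpH_comp k v]
      with x k1 k2
    rw [k1, hw, k2]
  have i1 : Integrable (fun x => g x * sharp (v x) k * (∂_{stdVec a} (conjS φ)) x) := by
    refine (integrable_conj_mul ((∂_{stdVec a} φ).toLp 2) (mulOp g w)).congr ?_
    filter_upwards [coeFn_mulOp (memLp_linf g) w, coeFn_sharpH_comp k v,
      (∂_{stdVec a} φ).coeFn_toLp 2 volume] with x k1 k2 k3
    rw [k1, hw, k2, k3, lineDeriv_conjS, conjS_apply]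
    ring
  have i2 : Integrable (fun x => weakPartial a g x * sharp (v x) k * conjS φ x) := by
    refine (integrable_conj_mul (φ.toLp 2) (mulOp (weakPartial a g) w)).congr ?_
    filter_upwards [coeFn_mulOp (memLp_linf (weakPartial a g)) w, coeFn_sharpH_comp k v,
      φ.coeFn_toLp 2 volume] with x k1 k2 k3
    rw [k1, hw, k2, k3, conjS_apply]
    ring
  rw [h1, coeffPairing, integral_add i1 i2, e1, e2]
  ring

theorem integral_comp_mul_conjS (j : Fin N) (v : L2 N) (φ : 𝓢(Plane, ℂ)) :
    ∫ x, v x j * conjS φ x = inner ℂ (φ.toLp 2) (comp j v) := by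
  rw [inner_toLp_eq_integral]
  refine integral_congr_ae ?_
  filter_upwards [coeFn_comp j v] with x k1
  rw [k1]

theorem integral_comp_mul_laplacian {ε : ℝ} (hε : 0 < ε) (j : Fin N) (v : L2 N)
    (ψ φ : 𝓢(Plane, ℂ)) (hφ : res ε (ψ.toLp 2) = φ.toLp 2) :
    ∫ x, v x j * (Δ (conjS φ)) x
      = inner ℂ (ψ.toLp 2) (∑ b, resDD ε b b (comp j v)) := by
  have hD : ∀ b, resD ε b (ψ.toLp 2) = (∂_{stdVec b} φ).toLp 2 := fun b =>
    (hasD_res hε b _).unique (hφ ▸ hasD_toLp b φ)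
  have hDD : ∀ b, resDD ε b b (ψ.toLp 2) = (∂_{stdVec b} (∂_{stdVec b} φ)).toLp 2 := fun b =>
    (hasD_resD hε b b _).unique (hD b ▸ hasD_toLp b (∂_{stdVec b} φ))
  have e : ∀ x, v x j * (Δ (conjS φ)) x
      = ∑ b, v x j * conjS (∂_{stdVec b} (∂_{stdVec b} φ)) x := by
    intro x
    rw [laplacian_eq_sum_stdVec, ← Finset.mul_sum, sum_apply]
    simp only [lineDeriv_conjS]
  simp only [e]
  rw [integral_finsetSum, inner_sum]
  · refine Finset.sum_congr rfl fun b _ => ?_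
    rw [integral_comp_mul_conjS, ← hDD, inner_resDD_left hε]
  · intro b _
    refine (integrable_conj_mul ((∂_{stdVec b} (∂_{stdVec b} φ)).toLp 2) (comp j v)).congr ?_
    filter_upwards [coeFn_comp j v, (∂_{stdVec b} (∂_{stdVec b} φ)).coeFn_toLp 2 volume]
      with x k1 k2
    rw [k1, k2, conjS_apply, mul_comm]

/-- The time derivative of the regularized component `R v_j`. -/
def regRHS (m : Fin N → ℝ) (g : Coeff N) (G v : ℝ → L2 N) (ε : ℝ) (j : Fin N) (τ : ℝ) : H :=
  (Complex.I * (1 / (2 * (m j : ℂ)))) • ∑ b, resDD ε b b (comp j (v τ))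
    + -(Complex.I • forcing g G v ε j τ)

theorem continuous_sum_resDD (ε : ℝ) (j : Fin N) :
    Continuous fun w : L2 N => ∑ b, resDD ε b b (comp j w) :=
  continuous_finsetSum _ fun b _ => (resDD ε b b).continuous.comp (comp j).continuous

theorem IsSolution.integrableOn_sum_resDD (h : IsSolution m g G v t₀ T) (ε : ℝ) (j : Fin N) {t : ℝ}
    (ht : t ∈ Ico t₀ T) :
    IntegrableOn (fun τ => ∑ b, resDD ε b b (comp j (v τ))) (Icc t₀ t) :=
  ((continuous_sum_resDD ε j).comp_continuousOn
    (h.continuousOn.mono fun _ hx => ⟨hx.1, hx.2.trans_lt ht.2⟩)).integrableOn_Icc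

theorem IsSolution.intervalIntegrable_regRHS (h : IsSolution m g G v t₀ T) {W ε : ℝ} (hε : 0 < ε)
    (hW0 : 0 ≤ W)
    (hW : ∀ t ∈ Ico t₀ T, ∀ j k a, CoeffBound (bracket t) W (g t j k a)) (j : Fin N) {t : ℝ}
    (ht : t ∈ Ico t₀ T) : IntervalIntegrable (regRHS m g G v ε j) volume t₀ t := by
  have iD := (intervalIntegrable_iff_integrableOn_Icc_of_le ht.1).2
    (h.integrableOn_sum_resDD ε j ht)
  have iF := (intervalIntegrable_iff_integrableOn_Icc_of_le ht.1).2
    (h.integrableOn_forcing hε hW0 hW j ht)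
  exact (iD.smul (Complex.I * (1 / (2 * (m j : ℂ))))).add (iF.smul Complex.I).neg

theorem eq_of_inner_schwartz {x y : H}
    (h : ∀ ψ : 𝓢(Plane, ℂ), (inner ℂ (ψ.toLp 2) x : ℂ) = inner ℂ (ψ.toLp 2) y) : x = y := by
  refine ext_inner_left ℂ fun z => ?_
  obtain ⟨φ, hφ⟩ := exists_schwartz_tendsto z
  refine tendsto_nhds_unique (hφ.inner tendsto_const_nhds) ?_
  simp only [h]
  exact hφ.inner tendsto_const_nhds

/-- The weak equation, tested on `R ψ`, is the integral form of the regularized equation. -/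
theorem IsSolution.res_comp_eq (h : IsSolution m g G v t₀ T) {W ε : ℝ} (hε : 0 < ε)
    (hW0 : 0 ≤ W)
    (hW : ∀ t ∈ Ico t₀ T, ∀ j k a, CoeffBound (bracket t) W (g t j k a)) (j : Fin N) {t : ℝ}
    (ht : t ∈ Ico t₀ T) :
    res ε (comp j (v t)) = res ε (comp j (v t₀)) + ∫ τ in t₀..t, regRHS m g G v ε j τ := by
  refine eq_of_inner_schwartz fun ψ => ?_
  obtain ⟨φ, hφ⟩ : ∃ φ : 𝓢(Plane, ℂ), res ε (ψ.toLp 2) = φ.toLp 2 :=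
    ⟨_, fourierMul_toLp (memLp_rsym ε) (hasTemperateGrowth_rsym ε) ψ⟩
  have iD := (intervalIntegrable_iff_integrableOn_Icc_of_le ht.1).2
    (h.integrableOn_sum_resDD ε j ht)
  have iF := (intervalIntegrable_iff_integrableOn_Icc_of_le ht.1).2
    (h.integrableOn_forcing hε hW0 hW j ht)
  have key := h.equation j (conjS φ) t ht
  have eF : ∀ τ, (∑ k, ∑ a, coeffPairing a (g τ j k a) (fun x => sharp (v τ x) k) (conjS φ))
      + ∫ x, G τ x j * conjS φ x = inner ℂ (ψ.toLp 2) (forcing g G v ε j τ) := by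
    intro τ
    simp only [forcing, inner_add_right, inner_sum, coeffPairing_eq_inner hε _ _ _ _ ψ φ hφ,
      integral_comp_mul_conjS, ← inner_res_left, hφ]
  simp only [eF] at key
  simp only [integral_comp_mul_conjS, integral_comp_mul_laplacian hε j _ ψ φ hφ] at key
  rw [← hφ, inner_res_left, inner_res_left] at key
  have c1 := (innerSL ℂ (ψ.toLp 2)).intervalIntegral_comp_comm iD
  have c2 := (innerSL ℂ (ψ.toLp 2)).intervalIntegral_comp_comm iF
  simp only [innerSL_apply_apply] at c1 c2
  rw [c1, c2] at key
  have hI : ∫ τ in t₀..t, regRHS m g G v ε j τ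
      = (Complex.I * (1 / (2 * (m j : ℂ)))) • (∫ τ in t₀..t, ∑ b, resDD ε b b (comp j (v τ)))
        + -(Complex.I • ∫ τ in t₀..t, forcing g G v ε j τ) := by
    have i1 : IntervalIntegrable (fun τ => (Complex.I * (1 / (2 * (m j : ℂ)))) •
        ∑ b, resDD ε b b (comp j (v τ))) volume t₀ t :=
      iD.smul (Complex.I * (1 / (2 * (m j : ℂ))))
    have i2 : IntervalIntegrable (fun τ => Complex.I • forcing g G v ε j τ) volume t₀ t :=
      iF.smul Complex.I
    simp only [regRHS, ← sub_eq_add_neg]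
    rw [intervalIntegral.integral_sub i1 i2,
      intervalIntegral.integral_smul, intervalIntegral.integral_smul]
  rw [hI, inner_add_right, inner_add_right, inner_neg_right, inner_smul_right, inner_smul_right,
    ← key]
  linear_combination (inner ℂ (ψ.toLp 2) (res ε (comp j (v t)))
    - inner ℂ (ψ.toLp 2) (res ε (comp j (v t₀)))) * Complex.I_sq

/-- The perturbation in the regularized equation: the commutator errors and the source. -/
def regErr (g : Coeff N) (G v : ℝ → L2 N) (ε : ℝ) (j : Fin N) (τ : ℝ) : H :=
  ∑ k, ∑ a, -(Complex.I • commErr ε a (g τ j k a) (sharpH (fun j => comp j (v τ)) k))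
    + -(Complex.I • res ε (comp j (G τ)))

/-- The right-hand side in the form to which the energy inequality applies. -/
theorem regRHS_eq {ε : ℝ} (hε : 0 < ε) (m : Fin N → ℝ) (g : Coeff N) (G v : ℝ → L2 N) (j : Fin N)
    (τ : ℝ) : regRHS m g G v ε j τ
      = (Complex.I * (1 / (2 * (m j : ℂ)))) • ∑ a, resDD ε a a (comp j (v τ))
        + ∑ k, ∑ a, -(Complex.I • mulOp (g τ j k a)
          (sharpH (fun j => resD ε a (comp j (v τ))) k)) + regErr g G v ε j τ := by
  simp only [regRHS, forcing, regErr, commErr, sharpH_resD hε, smul_add, Finset.smul_sum, smul_sub,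
    Finset.sum_neg_distrib, Finset.sum_sub_distrib]
  abel

end Equation

/-! ### The estimate for the regularized solution and its limit -/

theorem bracket_mono {t t' : ℝ} (ht : 0 ≤ t) (h : t ≤ t') : bracket t ≤ bracket t' :=
  Real.sqrt_le_sqrt (by nlinarith)

theorem bracket_sub_le {t t' : ℝ} (h : t ≤ t') : bracket t' - bracket t ≤ t' - t := by
  have h1 : |t| ≤ bracket t := abs_le_bracket t
  have h2 := (le_abs_self t).trans h1
  have h3 : bracket t ^ 2 = 1 + t ^ 2 := Real.sq_sqrt (by positivity)
  have h4 : 0 ≤ bracket t := Real.sqrt_nonneg _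
  have h5 : bracket t' ≤ bracket t + (t' - t) :=
    Real.sqrt_le_iff.2 ⟨by linarith, by nlinarith [mul_le_mul_of_nonneg_right h2 (sub_nonneg.2 h)]⟩
  linarith

theorem continuous_bracket : Continuous bracket := by
  unfold bracket
  fun_prop

/-- A quadratic integral inequality gives a linear bound: compare with the maximum of `n`. -/
theorem le_of_sq_le_add_integral {a b : ℝ} (hab : a ≤ b) {n F : ℝ → ℝ}
    (hn : ContinuousOn n (Icc a b)) (hn0 : ∀ t, 0 ≤ n t) (hF : IntervalIntegrable F volume a b)
    (hF0 : ∀ t, 0 ≤ F t)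
    (h : ∀ t ∈ Icc a b, n t ^ 2 / 2 ≤ 2 * n a ^ 2 + ∫ τ in a..t, n τ * F τ) :
    n b ≤ 4 * n a + 2 * ∫ τ in a..b, F τ := by
  obtain ⟨t₁, ht₁, hmax⟩ := isCompact_Icc.exists_isMaxOn (nonempty_Icc.2 hab) hn
  have hX : ∀ t ∈ Icc a b, n t ≤ n t₁ := fun t ht => hmax ht
  have hsub : uIcc a t₁ ⊆ uIcc a b := by
    rw [uIcc_of_le ht₁.1, uIcc_of_le hab]
    exact Icc_subset_Icc le_rfl ht₁.2
  have iF := hF.mono_set hsub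
  have h1 : ∫ τ in a..t₁, n τ * F τ ≤ n t₁ * ∫ τ in a..b, F τ := by
    calc ∫ τ in a..t₁, n τ * F τ ≤ ∫ τ in a..t₁, n t₁ * F τ := by
          refine intervalIntegral.integral_mono_on ht₁.1 ?_ (iF.const_mul _) fun τ hτ => ?_
          · refine iF.continuousOn_mul ?_
            rw [uIcc_of_le ht₁.1]
            exact hn.mono (Icc_subset_Icc le_rfl ht₁.2)
          · exact mul_le_mul_of_nonneg_right (hX τ ⟨hτ.1, hτ.2.trans ht₁.2⟩) (hF0 τ)
      _ = n t₁ * ∫ τ in a..t₁, F τ := intervalIntegral.integral_const_mul _ _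
      _ ≤ _ := by
          refine mul_le_mul_of_nonneg_left ?_ (hn0 t₁)
          exact intervalIntegral.integral_mono_interval le_rfl ht₁.1 ht₁.2
            (Filter.Eventually.of_forall hF0) hF
  have h2 := h t₁ ht₁
  have h3 := hX a (left_mem_Icc.2 hab)
  have h4 : 0 ≤ ∫ τ in a..b, F τ := intervalIntegral.integral_nonneg hab fun τ _ => hF0 τ
  refine (hX b (right_mem_Icc.2 hab)).trans ?_
  rcases (hn0 t₁).eq_or_lt with h0 | h0
  · rw [← h0]
    have := hn0 a
    positivity
  · refine le_of_mul_le_mul_left ?_ h0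
    nlinarith [mul_le_mul_of_nonneg_right h3 (hn0 a)]

section Regularized

variable {N : ℕ} {m : Fin N → ℝ} {g : Coeff N} {G v : ℝ → L2 N} {t₀ T : ℝ}

/-- The `L²` norm of the regularized solution. -/
def regNorm (v : ℝ → L2 N) (ε : ℝ) (τ : ℝ) : ℝ := √(∑ j, ‖res ε (comp j (v τ))‖ ^ 2)

/-- The total size of the commutator errors. -/
def errNorm (g : Coeff N) (v : ℝ → L2 N) (ε : ℝ) (τ : ℝ) : ℝ :=
  ∑ j, ∑ k, ∑ a, ‖commErr ε a (g τ j k a) (sharpH (fun j => comp j (v τ)) k)‖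

theorem regNorm_sq (v : ℝ → L2 N) (ε : ℝ) (τ : ℝ) :
    regNorm v ε τ ^ 2 = ∑ j, ‖res ε (comp j (v τ))‖ ^ 2 :=
  Real.sq_sqrt (Finset.sum_nonneg fun _ _ => by positivity)

theorem regNorm_nonneg (v : ℝ → L2 N) (ε : ℝ) (τ : ℝ) : 0 ≤ regNorm v ε τ := Real.sqrt_nonneg _

theorem errNorm_nonneg (g : Coeff N) (v : ℝ → L2 N) (ε : ℝ) (τ : ℝ) : 0 ≤ errNorm g v ε τ :=
  Finset.sum_nonneg fun _ _ => Finset.sum_nonneg fun _ _ => Finset.sum_nonneg fun _ _ =>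
    norm_nonneg _

theorem regNorm_le (v : ℝ → L2 N) (ε : ℝ) (τ : ℝ) : regNorm v ε τ ≤ ‖v τ‖ := by
  refine Real.sqrt_le_iff.2 ⟨norm_nonneg _, ?_⟩
  rw [norm_sq_eq_sum_comp]
  gcongr
  exact norm_res_le ε _

theorem norm_res_comp_le_regNorm (v : ℝ → L2 N) (ε : ℝ) (τ : ℝ) (j : Fin N) :
    ‖res ε (comp j (v τ))‖ ≤ regNorm v ε τ :=
  Real.le_sqrt_of_sq_le (Finset.single_le_sum (f := fun j => ‖res ε (comp j (v τ))‖ ^ 2)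
    (fun _ _ => by positivity) (Finset.mem_univ j))

theorem tendsto_regNorm {ε : ℕ → ℝ} (hε : Filter.Tendsto ε Filter.atTop (nhds 0)) (v : ℝ → L2 N)
    (τ : ℝ) : Filter.Tendsto (fun n => regNorm v (ε n) τ) Filter.atTop (nhds ‖v τ‖) := by
  have h1 : ‖v τ‖ = √(∑ j, ‖comp j (v τ)‖ ^ 2) := by
    rw [← norm_sq_eq_sum_comp, Real.sqrt_sq (norm_nonneg _)]
  rw [h1]
  exact (Real.continuous_sqrt.tendsto _).comp
    (tendsto_finsetSum _ fun j _ => ((tendsto_res hε _).norm).pow 2)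

theorem norm_regErr_le (g : Coeff N) (G v : ℝ → L2 N) (ε : ℝ) (j : Fin N) (τ : ℝ) :
    ‖regErr g G v ε j τ‖
      ≤ ∑ k, ∑ a, ‖commErr ε a (g τ j k a) (sharpH (fun j => comp j (v τ)) k)‖ + ‖G τ‖ := by
  refine (norm_add_le _ _).trans (add_le_add ?_ ?_)
  · refine (norm_sum_le _ _).trans (Finset.sum_le_sum fun k _ => (norm_sum_le _ _).trans
      (Finset.sum_le_sum fun a _ => ?_))
    rw [norm_neg, norm_smul, Complex.norm_I, one_mul]
  · rw [norm_neg, norm_smul, Complex.norm_I, one_mul]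
    exact (norm_res_le ε _).trans (norm_comp_le j _)

theorem sum_norm_regErr_le (g : Coeff N) (G v : ℝ → L2 N) (ε : ℝ) (τ : ℝ) :
    ∑ j, ‖regErr g G v ε j τ‖ ≤ errNorm g v ε τ + N * ‖G τ‖ := by
  refine (Finset.sum_le_sum fun j _ => norm_regErr_le g G v ε j τ).trans ?_
  rw [Finset.sum_add_distrib, Finset.sum_const, Finset.card_univ, Fintype.card_fin, nsmul_eq_mul,
    errNorm]

theorem IsSolution.integrableOn_errNorm (h : IsSolution m g G v t₀ T) {W ε : ℝ} (hε : 0 < ε)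
    (hW0 : 0 ≤ W)
    (hW : ∀ t ∈ Ico t₀ T, ∀ j k a, CoeffBound (bracket t) W (g t j k a)) {t : ℝ}
    (ht : t ∈ Ico t₀ T) : IntegrableOn (errNorm g v ε) (Icc t₀ t) :=
  integrable_finsetSum _ fun j _ => integrable_finsetSum _ fun k _ => integrable_finsetSum _
    fun a _ => (h.integrableOn_commErr hε hW0 hW j k a ht.2).2.norm

theorem IsSolution.continuousOn_res_comp (h : IsSolution m g G v t₀ T) (ε : ℝ) (j : Fin N) {t : ℝ}
    (ht : t < T) : ContinuousOn (fun τ => res ε (comp j (v τ))) (Icc t₀ t) :=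
  ((res ε).continuous.comp (comp j).continuous).comp_continuousOn
    (h.continuousOn.mono fun _ hx => ⟨hx.1, hx.2.trans_lt ht⟩)

theorem IsSolution.continuousOn_regNorm (h : IsSolution m g G v t₀ T) (ε : ℝ) {t : ℝ}
    (ht : t < T) : ContinuousOn (regNorm v ε) (Icc t₀ t) :=
  Real.continuous_sqrt.comp_continuousOn
    (continuousOn_finsetSum _ fun j _ => (h.continuousOn_res_comp ε j ht).norm.pow 2)

theorem norm_energyOp_bracket_sub_le {κ m : ℝ} (hκ : 0 ≤ κ) (hm : m ≠ 0) {t t' : ℝ} (ht : 0 ≤ t)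
    (h : t ≤ t') : ‖energyOp κ m (bracket t') - energyOp κ m (bracket t)‖
      ≤ 2 * κ / bracket t * (t' - t) := by
  have hb : 0 < bracket t := zero_lt_one.trans_le (one_le_bracket t)
  refine (norm_energyOp_sub_energyOp_le hκ hm hb (bracket_mono ht h)).trans ?_
  rw [mul_div_assoc', div_mul_eq_mul_div]
  exact div_le_div_of_nonneg_right
    (mul_le_mul_of_nonneg_left (bracket_sub_le h) (by positivity)) hb.le

theorem continuousOn_energyOp_bracket {κ m : ℝ} (hκ : 0 ≤ κ) (hm : m ≠ 0) {a b : ℝ} (ha : 0 ≤ a) :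
    ContinuousOn (fun t => energyOp κ m (bracket t)) (Icc a b) := by
  have key : ∀ t ∈ Icc a b, ∀ t' ∈ Icc a b, t ≤ t' →
      dist (energyOp κ m (bracket t')) (energyOp κ m (bracket t)) ≤ 2 * κ * dist t' t := by
    intro t ht t' _ h
    rw [dist_eq_norm, Real.dist_eq, abs_of_nonneg (sub_nonneg.2 h)]
    refine (norm_energyOp_bracket_sub_le hκ hm (ha.trans ht.1) h).trans ?_
    have := sub_nonneg.2 h
    gcongr
    exact div_le_self (by positivity) (one_le_bracket t)
  refine (LipschitzOnWith.of_dist_le_mul (K := ⟨2 * κ, by positivity⟩)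
    fun t ht t' ht' => ?_).continuousOn
  rcases le_total t t' with h | h
  · rw [dist_comm, dist_comm t]; exact key t ht t' ht' h
  · exact key t' ht' t ht h

/-- The integrated energy inequality for the regularized solution. -/
theorem IsSolution.regNorm_sq_le (h : IsSolution m g G v t₀ T) (ht₀ : 0 ≤ t₀) (hm : ∀ j, m j ≠ 0)
    {M C c ω ε : ℝ} (hε : 0 < ε) (hM : 0 ≤ M) (hc : 0 ≤ c) (hω : 0 ≤ ω)
    (hMω : M * ω ≤ 1 / 8)
    (hEn : EnergyInequality m M C c)
    (hW : ∀ t ∈ Ico t₀ T, ∀ j k a, CoeffBound (bracket t) (c * ω) (g t j k a))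
    {t : ℝ} (ht : t ∈ Ico t₀ T) :
    regNorm v ε t ^ 2 / 2 ≤ 2 * regNorm v ε t₀ ^ 2 + ∫ τ in t₀..t, regNorm v ε τ *
      ((C + 2 * M) * (ω / bracket τ) * regNorm v ε τ + 4 * (errNorm g v ε τ + N * ‖G τ‖)) := by
  have hW0 : 0 ≤ c * ω := by positivity
  have hκ : 0 ≤ M * ω := by positivity
  have hb : ∀ τ, 0 < bracket τ := fun τ => zero_lt_one.trans_le (one_le_bracket τ)
  set u : Fin N → ℝ → H := fun j τ => res ε (comp j (v τ)) with hu
  set B : Fin N → ℝ → H →L[ℂ] H := fun j τ => energyOp (M * ω) (m j) (bracket τ) with hB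
  -- The Lipschitz constant of the energy operator at time `τ`.
  set l : ℝ → ℝ := fun τ => 2 * (M * ω) / bracket τ with hl
  have huc : ∀ j, ContinuousOn (u j) (Icc t₀ t) := fun j => h.continuousOn_res_comp ε j ht.2
  have hBc : ∀ j, ContinuousOn (B j) (Icc t₀ t) := fun j =>
    continuousOn_energyOp_bracket hκ (hm j) ht₀
  have hlc : Continuous l := continuous_const.div continuous_bracket fun τ => (hb τ).ne'
  have hΦ : ∀ j, IntervalIntegrable (regRHS m g G v ε j) volume t₀ t := fun j =>
    h.intervalIntegrable_regRHS hε hW0 hW j ht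
  have h1 : ∀ j, (inner ℂ (B j t (u j t)) (u j t) : ℂ).re
      - (inner ℂ (B j t₀ (u j t₀)) (u j t₀) : ℂ).re
      ≤ ∫ τ in t₀..t, (2 * (inner ℂ (B j τ (u j τ)) (regRHS m g G v ε j τ) : ℂ).re
        + l τ * ‖u j τ‖ ^ 2) := fun j =>
    re_inner_sub_le_integral ht.1 (huc j) (hΦ j)
      (fun τ hτ => h.res_comp_eq hε hW0 hW j ⟨hτ.1, hτ.2.trans_lt ht.2⟩) (hBc j)
      (fun _ x y => inner_energyOp_left _ _ _ x y) hlc.continuousOn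
      fun τ hτ τ' _ hle => norm_energyOp_bracket_sub_le hκ (hm j) (ht₀.trans hτ.1) hle
  have hi : ∀ j, IntervalIntegrable (fun τ => 2 * (inner ℂ (B j τ (u j τ))
      (regRHS m g G v ε j τ) : ℂ).re + l τ * ‖u j τ‖ ^ 2) volume t₀ t := fun j => by
    refine ((intervalIntegrable_re_inner ht.1 ((hBc j).clm_apply (huc j)) (hΦ j)).const_mul 2).add
      (ContinuousOn.intervalIntegrable ?_)
    rw [uIcc_of_le ht.1]
    exact hlc.continuousOn.mul ((huc j).norm.pow 2)
  have hn := h.continuousOn_regNorm ε ht.2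
  have h2 : ∑ j, ((inner ℂ (B j t (u j t)) (u j t) : ℂ).re
      - (inner ℂ (B j t₀ (u j t₀)) (u j t₀) : ℂ).re) ≤ ∫ τ in t₀..t, regNorm v ε τ *
      ((C + 2 * M) * (ω / bracket τ) * regNorm v ε τ + 4 * (errNorm g v ε τ + N * ‖G τ‖)) := by
    refine (Finset.sum_le_sum fun j _ => h1 j).trans ?_
    rw [← intervalIntegral.integral_finsetSum fun j _ => hi j]
    have his := IntervalIntegrable.sum Finset.univ fun j _ => hi j
    rw [Finset.sum_fn] at his
    refine intervalIntegral.integral_mono_on ht.1 his ?_ fun τ hτ => ?_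
    · refine IntervalIntegrable.continuousOn_mul ?_ (by rwa [uIcc_of_le ht.1])
      refine IntervalIntegrable.add (ContinuousOn.intervalIntegrable ?_) ?_
      · rw [uIcc_of_le ht.1]
        exact (continuous_const.mul (continuous_const.div continuous_bracket
          fun τ => (hb τ).ne')).continuousOn.mul hn
      · rw [intervalIntegrable_iff_integrableOn_Icc_of_le ht.1]
        exact ((h.integrableOn_errNorm hε hW0 hW ht).add
          ((h.integrableOn_source ht).norm.const_mul _)).const_mul _
    · have e := hEn (bracket τ) ω (one_le_bracket τ) hω hMω (g τ)
        (hW τ ⟨hτ.1, hτ.2.trans_lt ht.2⟩) (fun j => u j τ)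
        (fun a j => resD ε a (comp j (v τ))) (fun a j => resDD ε a a (comp j (v τ)))
        (fun a j => hasD_res hε a _) (fun a j => hasD_resD hε a a _)
        (fun j => regErr g G v ε j τ)
      simp only [← regRHS_eq hε] at e
      rw [Finset.sum_add_distrib, ← Finset.mul_sum _ _ (l τ)]
      refine (add_le_add_left e _).trans ?_
      have hs : ∑ j, ‖u j τ‖ ^ 2 = regNorm v ε τ ^ 2 := (regNorm_sq v ε τ).symm
      have hs2 : ∑ j, ‖u j τ‖ * ‖regErr g G v ε j τ‖
          ≤ regNorm v ε τ * (errNorm g v ε τ + N * ‖G τ‖) := by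
        refine (Finset.sum_le_sum fun j _ => mul_le_mul_of_nonneg_right
          (norm_res_comp_le_regNorm v ε τ j) (norm_nonneg _)).trans ?_
        rw [← Finset.mul_sum]
        exact mul_le_mul_of_nonneg_left (sum_norm_regErr_le g G v ε τ) (regNorm_nonneg v ε τ)
      rw [hs]
      have e2 : l τ = 2 * M * (ω / bracket τ) := by simp only [hl]; ring
      rw [e2]
      nlinarith
  rw [Finset.sum_sub_distrib] at h2
  have h3 : regNorm v ε t ^ 2 / 2 ≤ ∑ j, (inner ℂ (B j t (u j t)) (u j t) : ℂ).re := by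
    rw [regNorm_sq, Finset.sum_div]
    exact Finset.sum_le_sum fun j _ => (re_inner_energyOp_self hκ hMω (hm j) _ _).1
  have h4 : ∑ j, (inner ℂ (B j t₀ (u j t₀)) (u j t₀) : ℂ).re ≤ 2 * regNorm v ε t₀ ^ 2 := by
    rw [regNorm_sq, Finset.mul_sum]
    exact Finset.sum_le_sum fun j _ => (re_inner_energyOp_self hκ hMω (hm j) _ _).2
  linarith

/-- The total commutator error vanishes in the limit, by dominated convergence. -/
theorem IsSolution.tendsto_integral_errNorm (h : IsSolution m g G v t₀ T) {W : ℝ} (hW0 : 0 ≤ W)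
    (hW : ∀ t ∈ Ico t₀ T, ∀ j k a, CoeffBound (bracket t) W (g t j k a)) {ε : ℕ → ℝ}
    (hε : ∀ n, 0 < ε n) (hlim : Filter.Tendsto ε Filter.atTop (nhds 0)) {t : ℝ}
    (ht : t ∈ Ico t₀ T) :
    Filter.Tendsto (fun n => ∫ τ in t₀..t, errNorm g v (ε n) τ) Filter.atTop (nhds 0) := by
  have h0 : (∫ _τ in t₀..t, (0 : ℝ)) = 0 := intervalIntegral.integral_zero
  rw [← h0]
  have hv : ContinuousOn v (Icc t₀ t) :=
    h.continuousOn.mono fun _ hx => ⟨hx.1, hx.2.trans_lt ht.2⟩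
  refine intervalIntegral.tendsto_integral_filter_of_dominated_convergence
    (fun τ => ∑ _j : Fin N, ∑ _k : Fin N ⊕ Fin N, ∑ _a : Fin 2, 4 * W * ‖v τ‖) ?_ ?_ ?_ ?_
  · refine Filter.Eventually.of_forall fun n => ?_
    rw [uIoc_of_le ht.1]
    exact (h.integrableOn_errNorm (hε n) hW0 hW ht).aestronglyMeasurable.mono_set
      Ioc_subset_Icc_self
  · refine Filter.Eventually.of_forall fun n => Filter.Eventually.of_forall fun τ hτ => ?_
    rw [uIoc_of_le ht.1] at hτ
    rw [Real.norm_of_nonneg (errNorm_nonneg _ _ _ _)]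
    refine Finset.sum_le_sum fun j _ => Finset.sum_le_sum fun k _ => Finset.sum_le_sum
      fun a _ => ?_
    refine ((hW τ ⟨hτ.1.le, hτ.2.trans_lt ht.2⟩ j k a).norm_commErr_le (hε n) a _).trans ?_
    have h1 := norm_sharpH_comp_le k (v τ)
    have h2 := div_le_self hW0 (one_le_bracket τ)
    gcongr
  · refine ContinuousOn.intervalIntegrable ?_
    rw [uIcc_of_le ht.1]
    exact continuousOn_finsetSum _ fun _ _ => continuousOn_finsetSum _ fun _ _ =>
      continuousOn_finsetSum _ fun _ _ => continuousOn_const.mul hv.norm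
  · refine Filter.Eventually.of_forall fun τ hτ => ?_
    rw [uIoc_of_le ht.1] at hτ
    have e0 : (0 : ℝ) = ∑ _j : Fin N, ∑ _k : Fin N ⊕ Fin N, ∑ _a : Fin 2, 0 := by simp
    rw [e0]
    exact tendsto_finsetSum _ fun j _ => tendsto_finsetSum _ fun k _ => tendsto_finsetSum _
      fun a _ => tendsto_commErr hε hlim a
        (hW τ ⟨hτ.1.le, hτ.2.trans_lt ht.2⟩ j k a).weakPartial_eq _

end Regularized

/-- The a priori estimate, for `N` components, obtained by letting `ε = 1 / (n + 1) → 0`. -/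
theorem exists_energy_estimate (N : ℕ) (m : Fin N → ℝ) (hm : ∀ j, m j ≠ 0)
    (μ : Fin N ⊕ Fin N → ℝ) :
    ∃ ω₀ : ℝ, 0 < ω₀ ∧ ∃ C₀ : ℝ, 0 < C₀ ∧ ∀ T t₀ : ℝ, t₀ ∈ Ico 0 T →
      ∀ (g : Coeff N) (G v : ℝ → L2 N), IsSolution m g G v t₀ T →
        bigOmega μ g t₀ T ≤ ENNReal.ofReal ω₀ → ∀ t ∈ Ico t₀ T,
          ‖v t‖ ≤ C₀ * ‖v t₀‖ + C₀ * ∫ τ in t₀..t,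
            ((bigOmega μ g t₀ T).toReal / bracket τ * ‖v τ‖ + ‖G τ‖) := by
  set c : ℝ := ∑ k, 4 * (1 + |μ k|⁻¹) ^ 2 with hcdef
  have hck : ∀ k, 4 * (1 + |μ k|⁻¹) ^ 2 ≤ c := fun k =>
    Finset.single_le_sum (f := fun k => 4 * (1 + |μ k|⁻¹) ^ 2) (fun _ _ => by positivity)
      (Finset.mem_univ k)
  have hc : 0 ≤ c := Finset.sum_nonneg fun _ _ => by positivity
  obtain ⟨M, hM, C, hC, hEn⟩ := exists_energyInequality N m hm hc
  refine ⟨1 / (8 * (M + 1)), by positivity, 4 + 2 * (C + 2 * M) + 8 * N, by positivity,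
    fun T t₀ ht₀ g G v h hΩ t ht => ?_⟩
  obtain ⟨ω, hωdef⟩ : ∃ ω, ω = (bigOmega μ g t₀ T).toReal := ⟨_, rfl⟩
  rw [← hωdef]
  have hω : 0 ≤ ω := hωdef ▸ ENNReal.toReal_nonneg
  have hfin : bigOmega μ g t₀ T ≠ ∞ := (hΩ.trans_lt ENNReal.ofReal_lt_top).ne
  have hωle : ω ≤ 1 / (8 * (M + 1)) := by
    rw [hωdef]; exact ENNReal.toReal_le_of_le_ofReal (by positivity) hΩ
  have hΩω : bigOmega μ g t₀ T ≤ ENNReal.ofReal ω := by rw [hωdef, ENNReal.ofReal_toReal hfin]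
  have hMω : M * ω ≤ 1 / 8 := by
    calc M * ω ≤ (M + 1) * (1 / (8 * (M + 1))) := by gcongr; linarith
      _ = 1 / 8 := by field_simp
  have hb : ∀ τ, 0 < bracket τ := fun τ => zero_lt_one.trans_le (one_le_bracket τ)
  have hW : ∀ t ∈ Ico t₀ T, ∀ j k a, CoeffBound (bracket t) (c * ω) (g t j k a) :=
    fun t ht j k a => (coeffBound_of_bigOmega_le μ g hω hΩω ht j k a).mono (hb t)
      (mul_le_mul_of_nonneg_right (hck k) hω)
  have hW0 : 0 ≤ c * ω := by positivity
  have hv : ContinuousOn v (Icc t₀ t) :=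
    h.continuousOn.mono fun _ hx => ⟨hx.1, hx.2.trans_lt ht.2⟩
  have hq : Continuous fun τ => ω / bracket τ :=
    continuous_const.div continuous_bracket fun τ => (hb τ).ne'
  have iV : IntervalIntegrable (fun τ => ω / bracket τ * ‖v τ‖) volume t₀ t := by
    refine ContinuousOn.intervalIntegrable ?_
    rw [uIcc_of_le ht.1]
    exact hq.continuousOn.mul hv.norm
  have iG : IntervalIntegrable (fun τ => ‖G τ‖) volume t₀ t := (h.source_integrable t ht).norm
  have key : ∀ ε : ℝ, 0 < ε → regNorm v ε t ≤ 4 * ‖v t₀‖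
      + 2 * (∫ τ in t₀..t, ((C + 2 * M) * (ω / bracket τ * ‖v τ‖) + 4 * N * ‖G τ‖))
      + 8 * ∫ τ in t₀..t, errNorm g v ε τ := by
    intro ε hε
    have iE : IntervalIntegrable (errNorm g v ε) volume t₀ t :=
      (intervalIntegrable_iff_integrableOn_Icc_of_le ht.1).2
        (h.integrableOn_errNorm hε hW0 hW ht)
    have hn := h.continuousOn_regNorm ε ht.2
    have iF : IntervalIntegrable (fun τ => (C + 2 * M) * (ω / bracket τ) * regNorm v ε τ
        + 4 * (errNorm g v ε τ + N * ‖G τ‖)) volume t₀ t := by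
      refine (ContinuousOn.intervalIntegrable ?_).add ((iE.add (iG.const_mul _)).const_mul _)
      rw [uIcc_of_le ht.1]
      exact (continuous_const.mul hq).continuousOn.mul hn
    have h1 := le_of_sq_le_add_integral ht.1 hn (regNorm_nonneg v ε) iF (fun τ => by
        have := regNorm_nonneg v ε τ
        have := errNorm_nonneg g v ε τ
        have := hb τ
        positivity)
      fun τ hτ => h.regNorm_sq_le ht₀.1 hm hε hM hc hω hMω hEn hW ⟨hτ.1, hτ.2.trans_lt ht.2⟩
    have i1 : IntervalIntegrable (fun τ => (C + 2 * M) * (ω / bracket τ * ‖v τ‖)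
        + 4 * N * ‖G τ‖) volume t₀ t := (iV.const_mul _).add (iG.const_mul _)
    have h2 : ∫ τ in t₀..t, ((C + 2 * M) * (ω / bracket τ) * regNorm v ε τ
        + 4 * (errNorm g v ε τ + N * ‖G τ‖))
        ≤ (∫ τ in t₀..t, ((C + 2 * M) * (ω / bracket τ * ‖v τ‖) + 4 * N * ‖G τ‖))
          + 4 * ∫ τ in t₀..t, errNorm g v ε τ := by
      rw [← intervalIntegral.integral_const_mul,
        ← intervalIntegral.integral_add i1 (iE.const_mul 4)]
      refine intervalIntegral.integral_mono_on ht.1 iF (i1.add (iE.const_mul 4)) fun τ _ => ?_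
      have h3 := mul_le_mul_of_nonneg_left (regNorm_le v ε τ)
        (show 0 ≤ (C + 2 * M) * (ω / bracket τ) by have := hb τ; positivity)
      linarith
    have h3 := regNorm_le v ε t₀
    linarith
  have hlim := tendsto_one_div_add_atTop_nhds_zero_nat (𝕜 := ℝ)
  have hε : ∀ n : ℕ, (0 : ℝ) < 1 / ((n : ℝ) + 1) := fun n => by positivity
  have h1 := le_of_tendsto_of_tendsto' (tendsto_regNorm hlim v t)
    (tendsto_const_nhds.add ((h.tendsto_integral_errNorm hW0 hW hε hlim ht).const_mul 8))
    fun n => key _ (hε n)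
  rw [mul_zero, add_zero] at h1
  refine h1.trans ?_
  have h2 : 2 * (∫ τ in t₀..t, ((C + 2 * M) * (ω / bracket τ * ‖v τ‖) + 4 * N * ‖G τ‖))
      ≤ (4 + 2 * (C + 2 * M) + 8 * N) * ∫ τ in t₀..t, (ω / bracket τ * ‖v τ‖ + ‖G τ‖) := by
    rw [← intervalIntegral.integral_const_mul, ← intervalIntegral.integral_const_mul]
    refine intervalIntegral.integral_mono_on ht.1
      (((iV.const_mul _).add (iG.const_mul _)).const_mul _) ((iV.add iG).const_mul _)
      fun τ _ => ?_
    have p1 : 0 ≤ ω / bracket τ * ‖v τ‖ := by have := hb τ; positivity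
    have p2 : 0 ≤ ‖G τ‖ := norm_nonneg _
    have p3 : 0 ≤ (N : ℝ) := Nat.cast_nonneg N
    nlinarith [mul_nonneg p3 p1, mul_nonneg (add_nonneg hC (mul_nonneg zero_le_two hM)) p2]
  have h3 : 4 * ‖v t₀‖ ≤ (4 + 2 * (C + 2 * M) + 8 * N) * ‖v t₀‖ := by
    gcongr
    have : 0 ≤ 2 * (C + 2 * M) + 8 * N := by positivity
    linarith
  linarith

end NLSEnergy

end

theorem proposition3p1 (N : ℕ) (m : Fin N → ℝ) (hm : ∀ j, m j ≠ 0)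
    (μ : Fin N ⊕ Fin N → ℝ) (hμ : ∀ k, μ k ≠ 0) :
    ∃ ω₀ : ℝ, 0 < ω₀ ∧ ∃ C₀ : ℝ, 0 < C₀ ∧
      ∀ T t₀ : ℝ, t₀ ∈ Ico 0 T →
      ∀ (g : NLSEnergy.Coeff N) (G v : ℝ → NLSEnergy.L2 N),
        NLSEnergy.IsSolution m g G v t₀ T →
        NLSEnergy.bigOmega μ g t₀ T ≤ ENNReal.ofReal ω₀ →
        ∀ t ∈ Ico t₀ T,
          ‖v t‖ ≤ C₀ * ‖v t₀‖ + C₀ * ∫ τ in t₀..t,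
            ((NLSEnergy.bigOmega μ g t₀ T).toReal / NLSEnergy.bracket τ * ‖v τ‖ + ‖G τ‖) :=
  NLSEnergy.exists_energy_estimate N m hm μ
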